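/- **Setting.** Let $\Omega$ be either a flat torus $\prod_{i=1}^d \mathbb R/L_i\mathbb Z$, $L_i>0$ (periodic boundary conditions), or a compact connected domain $\{r\le 0\}\subset\mathbb R^d$ with smooth boundary $\{r=0\}$, where $r\in C^\infty(\mathbb R^d)$ and $\nabla r\ne0$ on $\{r=0\}$ (Neumann boundary conditions). In the Neumann case every flux $m$ below is required to satisfy $m\cdot\nabla r=0$ on $\partial\Omega$; on the torus there is no boundary condition. $C^\infty(\Omega)$ denotes functions smooth up to the boundary (resp. smooth periodic functions), and $$\mathcal P(\Omega)=\{\rho\in C^\infty(\Omega):\rho>0,\ \textstyle\int_\Omega\rho\,dx=1\},\qquad T\mathcal P(\Omega)=\{\sigma\in C^\infty(\Omega):\textstyle\int_\Omega\sigma\,dx=0\}.$$ Let $\mathcal H:\mathcal P(\Omega)\to\mathbb R$ be a strictly convex entropy with a positive definite, invertible $L^2$ Hessian: for each $\rho\in\mathcal P(\Omega)$, $\delta^2\mathcal H(\rho):C^\infty(\Omega)\to C^\infty(\Omega)$ is a linear bijection, symmetric and positive definite in $L^2$, with $\frac{d^2}{da^2}\big|_{a=0}\mathcal H(\rho+a\sigma)=\int_\Omega\sigma\,\delta^2\mathcal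 H(\rho)\sigma\,dx$ for $\sigma\in T\mathcal P(\Omega)$ (where $a\mapsto \mathcal H(\rho+a\sigma)$ is $C^2$ near $0$). It depends smoothly on $\rho$: $(\rho,h)\mapsto\delta^2\mathcal H(\rho)h$ and $(\rho,h)\mapsto[\delta^2\mathcal H(\rho)]^{-1}h$ map smooth two-parameter families to smooth families, and for a smooth curve $\rho_t$ in $\mathcal P(\Omega)$ and a smooth family $h_t$ in $C^\infty(\Omega)$, $t\in[0,1]$, the functionals $\rho\mapsto\int_\Omega h_t[\delta^2\mathcal H(\rho)]^{-1}h_t\,dx$ have $L^2$ first variations $g_t$ at $\rho_t$ that form a smooth family. Here $g$ is an $L^2$ first variation $\delta_\rho F$ of $F$ at $\rho$ if $\frac{d}{da}\big|_{a=0}F(\rho+a\sigma)=\int_\Omega g\,\sigma\,dx$ for all $\sigma\in T\mathcal P(\Omega)$; it is unique up to an additive constant. Operators act on vector fields componentwise. A *flow* is a pair $(\rho,v)$ of a smooth curve $\rho:[0,1]\to\mathcal P(\Omega)$ and a time-dependent vector field $v$, both smooth on $[0,1]\times\Omega$, such that the flux $m=[\delta^2\mathcal H(\rho)]^{-1}v$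 satisfies the boundary condition and $\partial_t\rho+\nabla\cdot m=0$. Its action is $\mathcal A(\rho,v)=\int_0^1\int_\Omega v\cdot[\delta^2\mathcal H(\rho)]^{-1}v\,dx\,dt=\int_0^1\int_\Omega m\cdot\delta^2\mathcal H(\rho)m\,dx\,dt$, and the Hessian transport distance is $$W_{\mathcal H}(\rho^0,\rho^1)=\Big(\inf\{\mathcal A(\rho,v):(\rho,v)\text{ a flow},\ \rho(0)=\rho^0,\ \rho(1)=\rho^1\}\Big)^{1/2}\in[0,\infty].$$ A flow is a *minimizer* if its action is minimal among all flows with the same endpoints. It is a *geodesic* if it is a critical point of the action with fixed endpoints, i.e. $\frac{d}{d\varepsilon}\big|_{\varepsilon=0}\int_0^1\int_\Omega (m+\varepsilon w)\cdot\delta^2\mathcal H(\rho+\varepsilon\eta)(m+\varepsilon w)\,dx\,dt=0$ for all smooth $(\eta,w)$ with $\partial_t\eta+\nabla\cdot w=0$, $\eta(0)=\eta(1)=0$, and $w$ satisfying the boundary condition. **Theorem (Hessian transport geodesic).** 1. $W_{\mathcal H}(\rho^0,\rho^1)<+\infty$ for all $\rho^0,\rho^1\in\mathcal P(\Omega)$.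 2. A pair $(\rho,v)$ is a geodesic if and only if there is a smooth function $\Phi$ on $[0,1]\times\Omega$ such that $v=\nabla\Phi$, $\rho$ is a smooth curve in $\mathcal P(\Omega)$, the flux $[\delta^2\mathcal H(\rho)]^{-1}\nabla\Phi$ satisfies the boundary condition, and $$\partial_t\rho+\nabla\cdot\big([\delta^2\mathcal H(\rho)]^{-1}\nabla\Phi\big)=0,\qquad \partial_t\Phi+\tfrac12\,\delta_\rho\int_\Omega\nabla\Phi\cdot[\delta^2\mathcal H(\rho)]^{-1}\nabla\Phi\,dx=0$$ on $[0,1]\times\Omega$, for some choice of the first variation at each time (the variation is taken with $\Phi(t,\cdot)$ fixed). In particular every minimizer is of this form. 3. Let $f\in C^\infty((0,\infty))$ with $f''>0$ and $\mathcal H_f(\rho)=\int_\Omega f(\rho)\,dx$. Then multiplication by $f''(\rho)$ is an $L^2$ Hessian $\delta^2\mathcal H_f(\rho)$ with all of the properties above, and, with this Hessian, $(\rho,v)$ is a geodesic if and only if $v=\nabla\Phi$ for a smooth $\Phi$ such that $\rho$ is a smooth curve in $\mathcal P(\Omega)$, the flux $f''(\rho)^{-1}\nabla\Phi$ satisfies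 the boundary condition, and $$\partial_t\rho+\nabla\cdot\big(f''(\rho)^{-1}\nabla\Phi\big)=0,\qquad \partial_t\Phi-\tfrac12|\nabla\Phi|^2\,\frac{f'''(\rho)}{f''(\rho)^2}=0 .$$ In particular every minimizer is of this form. -/

import Mathlib

open Set MeasureTheory
open scoped ContDiff ENNReal

noncomputable section

namespace HessianTransport

/-- Euclidean space `ℝ^d`. -/
abbrev E (d : ℕ) : Type := EuclideanSpace ℝ (Fin d)

/-- The sample space with its boundary condition.
* `periodic L`: the flat torus `∏ᵢ ℝ / Lᵢ ℤ` (functions on it are periodic functions on `ℝ^d`);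
* `neumann r`: the compact connected domain `{r ≤ 0}` with smooth boundary `{r = 0}`, where `r` is
  a smooth defining function (`∇ r` is an outer normal on the boundary), with the Neumann
  (no-flux) boundary condition. -/
inductive SampleSpace (d : ℕ) : Type
  | periodic (L : Fin d → ℝ) (hL : ∀ i, 0 < L i)
  | neumann (r : E d → ℝ) (smooth : ContDiff ℝ ∞ r)
      (regular : ∀ x, r x = 0 → fderiv ℝ r x ≠ 0)
      (compact : IsCompact {x | r x ≤ 0}) (connected : IsConnected {x | r x ≤ 0})

namespace SampleSpace

variable {d : ℕ}

/-- The set of points at which functions on the sample space are evaluated. -/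
def carrier : SampleSpace d → Set (E d)
  | periodic _ _ => univ
  | neumann r _ _ _ _ => {x | r x ≤ 0}

/-- The region of integration: one period cell, respectively the domain itself. -/
def cell : SampleSpace d → Set (E d)
  | periodic L _ => {x | ∀ i, 0 ≤ x i ∧ x i < L i}
  | neumann r _ _ _ _ => {x | r x ≤ 0}

/-- Compatibility of a function on `ℝ^d` with the periods (no condition for a domain). -/
def IsPeriodic : SampleSpace d → (E d → ℝ) → Prop
  | periodic L _, f => ∀ (i : Fin d) (x : E d), f (x + EuclideanSpace.single i (L i)) = f x
  | neumann _ _ _ _ _, _ => True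

/-- The boundary condition on a flux `m`: `m · n = 0` on the boundary of a domain, and no
condition on a torus. -/
def NoFlux : SampleSpace d → (Fin d → E d → ℝ) → Prop
  | periodic _ _, _ => True
  | neumann r _ _ _ _, m =>
      ∀ x, r x = 0 → ∑ i, m i x * fderiv ℝ r x (EuclideanSpace.single i 1) = 0

theorem uniqueDiffOn_carrier (Ω : SampleSpace d) : UniqueDiffOn ℝ Ω.carrier := by
  cases Ω with
  | periodic L hL => exact uniqueDiffOn_univ
  | neumann r hr hreg hc hconn =>
    intro x hx
    have hx' : r x ≤ 0 := hx
    rcases hx'.lt_or_eq with hlt | heq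
    · have : {y | r y < 0} ∈ nhds x := (isOpen_lt hr.continuous continuous_const).mem_nhds hlt
      exact uniqueDiffWithinAt_of_mem_nhds
        (Filter.mem_of_superset this fun y (hy : r y < 0) => hy.le)
    · have hd : HasFDerivAt r (fderiv ℝ r x) x :=
        (hr.differentiable (by simp)).differentiableAt.hasFDerivAt
      set l := fderiv ℝ r x with hl
      have hl0 : l ≠ 0 := hreg x heq
      -- the open half-space `l < 0` consists of tangent directions
      have hsub : {y : E d | l y < 0} ⊆ tangentConeAt ℝ {x | r x ≤ 0} x := by
        intro y hy
        have hline : HasDerivAt (fun s : ℝ => r (x + s • y)) (l y) 0 := by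
          have h1 : HasDerivAt (fun s : ℝ => x + s • y) y 0 := by
            simpa using ((hasDerivAt_id (0 : ℝ)).smul_const y).const_add x
          have hd' : HasFDerivAt r l (x + (0 : ℝ) • y) := by simpa using hd
          exact hd'.comp_hasDerivAt (0 : ℝ) h1
        have hev : ∀ᶠ s in nhdsWithin (0 : ℝ) (Ioi 0), r (x + s • y) ≤ 0 := by
          have h2 := (hasDerivAt_iff_tendsto_slope.1 hline).eventually
            (gt_mem_nhds (show l y < 0 from hy))
          have h3 : nhdsWithin (0 : ℝ) (Ioi 0) ≤ nhdsWithin (0 : ℝ) {0}ᶜ :=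
            nhdsWithin_mono _ fun s (hs : 0 < s) => ne_of_gt hs
          filter_upwards [h3 h2, self_mem_nhdsWithin] with s hs hs0
          have hs0' : (0 : ℝ) < s := hs0
          rw [slope_def_field] at hs
          simp only [zero_smul, add_zero, heq, sub_zero] at hs
          exact ((div_neg_iff.1 hs).resolve_left fun h => absurd h.2 (not_lt.2 hs0'.le)).1.le
        have hfr := hev.frequently
        refine mem_tangentConeAt_of_frequently (nhdsWithin (0 : ℝ) (Ioi 0))
          (fun s : ℝ => s⁻¹) (fun s : ℝ => s • y) ?_ ?_ ?_
        · have : Filter.Tendsto (fun s : ℝ => s • y) (nhds 0) (nhds ((0 : ℝ) • y)) :=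
            (continuous_id.smul continuous_const).tendsto 0
          rw [zero_smul] at this
          exact this.mono_left nhdsWithin_le_nhds
        · exact hfr
        · refine tendsto_const_nhds.congr' ?_
          filter_upwards [self_mem_nhdsWithin] with s hs
          rw [smul_smul, inv_mul_cancel₀ (ne_of_gt hs), one_smul]
      have hne : ({y : E d | l y < 0}).Nonempty := by
        obtain ⟨y, hy⟩ : ∃ y, l y ≠ 0 := by
          by_contra h
          push Not at h
          exact hl0 (ContinuousLinearMap.ext h)
        rcases lt_or_gt_of_ne hy with h | h
        · exact ⟨y, h⟩
        · exact ⟨-y, by simpa using h⟩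
      have hopen : IsOpen {y : E d | l y < 0} := isOpen_lt l.continuous continuous_const
      refine ⟨?_, subset_closure hx⟩
      have htop : Submodule.span ℝ (tangentConeAt ℝ {x | r x ≤ 0} x) = ⊤ := by
        apply Submodule.eq_top_of_nonempty_interior'
        obtain ⟨y, hy⟩ := hne
        exact ⟨y, mem_interior.2 ⟨_, hsub.trans Submodule.subset_span, hopen, hy⟩⟩
      have hcar : (neumann r hr hreg hc hconn).carrier = {x | r x ≤ 0} := rfl
      rw [hcar, htop]
      simp

end SampleSpace

variable {d : ℕ} (Ω : SampleSpace d)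

/-- `C^∞(Ω)`: the functions that are smooth (up to the boundary) on the sample space. In order
that equality of elements is equality on `Ω`, they are extended by `0` outside of a domain. -/
def SmoothFn : Submodule ℝ (E d → ℝ) where
  carrier := {f | ContDiffOn ℝ ∞ f Ω.carrier ∧ (∀ x, x ∉ Ω.carrier → f x = 0) ∧ Ω.IsPeriodic f}
  add_mem' := by
    rintro f g ⟨hf, hf0, hfp⟩ ⟨hg, hg0, hgp⟩
    refine ⟨hf.add hg, fun x hx => by simp [hf0 x hx, hg0 x hx], ?_⟩
    cases Ω with
    | periodic L hL => intro i x; simp only [Pi.add_apply, hfp i x, hgp i x]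
    | neumann => trivial
  zero_mem' := by
    refine ⟨contDiffOn_const, fun _ _ => rfl, ?_⟩
    cases Ω with
    | periodic L hL => intro i x; rfl
    | neumann => trivial
  smul_mem' := by
    rintro c f ⟨hf, hf0, hfp⟩
    refine ⟨hf.const_smul c, fun x hx => by simp [hf0 x hx], ?_⟩
    cases Ω with
    | periodic L hL => intro i x; simp only [Pi.smul_apply, hfp i x]
    | neumann => trivial

/-- Smooth vector fields on `Ω`, given by their components. -/
abbrev SmoothVec : Type := Fin d → SmoothFn Ω

variable {Ω} in
/-- Evaluation of `f ∈ C^∞(Ω)` at a point. -/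
def ev (f : SmoothFn Ω) (x : E d) : ℝ := (f : E d → ℝ) x

/-- `∫_Ω f dx`. -/
def integral (f : E d → ℝ) : ℝ := ∫ x in Ω.cell, f x

/-- The partial derivative `∂ᵢ f` on `Ω` (one-sided at the boundary). -/
def partialD (i : Fin d) (f : E d → ℝ) (x : E d) : ℝ :=
  fderivWithin ℝ f Ω.carrier x (EuclideanSpace.single i 1)

/-- The divergence `∇ · m`. -/
def divergence (m : Fin d → E d → ℝ) (x : E d) : ℝ := ∑ i, partialD Ω i (m i) x

variable {Ω} in
/-- The gradient of a smooth function, a smooth vector field. -/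
def grad (f : SmoothFn Ω) : SmoothVec Ω := fun i =>
  ⟨Ω.carrier.indicator (partialD Ω i f), by
    refine ⟨?_, fun x hx => indicator_of_notMem hx _, ?_⟩
    · have h : ContDiffOn ℝ ∞ (partialD Ω i f) Ω.carrier :=
        (f.2.1.fderivWithin Ω.uniqueDiffOn_carrier (m := ∞) (by simp)).clm_apply contDiffOn_const
      exact h.congr fun x hx => indicator_of_mem hx _
    · obtain ⟨f, hf⟩ := f
      cases Ω with
      | periodic L hL =>
        intro j x
        have hp : (fun y => f (y + EuclideanSpace.single j (L j))) = f := funext (hf.2.2 j)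
        have hc : (SampleSpace.periodic L hL).carrier = univ := rfl
        simp only [partialD, hc, indicator_univ, fderivWithin_univ]
        rw [← fderiv_comp_add_right, hp]
      | neumann => trivial⟩

/-- `ρ ∈ P(Ω)`: a smooth and strictly positive probability density. -/
structure IsDensity (ρ : SmoothFn Ω) : Prop where
  pos : ∀ x ∈ Ω.carrier, 0 < ev ρ x
  mass : integral Ω (ev ρ) = 1

/-- `σ ∈ T_ρ P(Ω)`: a smooth function of mean zero. -/
def IsTangent (σ : SmoothFn Ω) : Prop := integral Ω (ev σ) = 0

/-- A family `(f s)_{s ∈ S}` in `C^∞(Ω)` that is jointly smooth in `(s, x) ∈ S × Ω`. -/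
def SmoothFamily {V : Type} [NormedAddCommGroup V] [NormedSpace ℝ V] (S : Set V)
    (f : V → SmoothFn Ω) : Prop :=
  ContDiffOn ℝ ∞ (fun p : V × E d => ev (f p.1) p.2) (S ×ˢ Ω.carrier)

/-- `g` is an `L²` first variation `δ_ρ F(ρ)` at the density `ρ` of a functional `F` on `P(Ω)`
(of which only the values on densities matter):
`d/da F(ρ + a σ) = ∫ g σ dx` at `a = 0` for all tangent vectors `σ`. It is unique up to an
additive constant. -/
def HasFirstVariation (F : SmoothFn Ω → ℝ) (ρ g : SmoothFn Ω) : Prop :=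
  ∀ σ : SmoothFn Ω, IsTangent Ω σ →
    HasDerivAt (fun a : ℝ => F (ρ + a • σ)) (integral Ω fun x => ev g x * ev σ x) 0

/-- A field of invertible linear operators on `C^∞(Ω)`, indexed by densities (the values at
functions `ρ` that are not densities are never used). -/
abbrev OperatorField : Type := SmoothFn Ω → (SmoothFn Ω ≃ₗ[ℝ] SmoothFn Ω)

/-- `K ρ = δ²H(ρ)` is the `L²` Hessian operator of the entropy `H : P(Ω) → ℝ`; it is positive
definite and invertible, and depends smoothly on `ρ`. -/
structure IsL2Hessian (H : SmoothFn Ω → ℝ) (K : OperatorField Ω) : Prop where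
  /-- `H` is `C²` along lines in `P(Ω)`, and `d²/da² H(ρ + a σ) = ∫ σ δ²H(ρ) σ dx` at `a = 0`. -/
  second_variation : ∀ ρ σ : SmoothFn Ω, IsDensity Ω ρ → IsTangent Ω σ →
    ContDiffAt ℝ 2 (fun a : ℝ => H (ρ + a • σ)) 0 ∧
    iteratedDeriv 2 (fun a : ℝ => H (ρ + a • σ)) 0 = integral Ω fun x => ev σ x * ev (K ρ σ) x
  symmetric : ∀ ρ : SmoothFn Ω, IsDensity Ω ρ → ∀ f g : SmoothFn Ω,
    integral Ω (fun x => ev f x * ev (K ρ g) x) = integral Ω fun x => ev g x * ev (K ρ f) x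
  positive : ∀ ρ : SmoothFn Ω, IsDensity Ω ρ → ∀ f : SmoothFn Ω, f ≠ 0 →
    0 < integral Ω fun x => ev f x * ev (K ρ f) x
  /-- `(ρ, f) ↦ δ²H(ρ) f` and `(ρ, f) ↦ [δ²H(ρ)]⁻¹ f` map smooth families to smooth families. -/
  smooth : ∀ (a b a' b' : ℝ), a < b → a' < b' → ∀ ρ f : ℝ × ℝ → SmoothFn Ω,
    SmoothFamily Ω (Icc a b ×ˢ Icc a' b') ρ → (∀ s ∈ Icc a b ×ˢ Icc a' b', IsDensity Ω (ρ s)) →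
    SmoothFamily Ω (Icc a b ×ˢ Icc a' b') f →
    SmoothFamily Ω (Icc a b ×ˢ Icc a' b') (fun s => K (ρ s) (f s)) ∧
    SmoothFamily Ω (Icc a b ×ˢ Icc a' b') (fun s => (K (ρ s)).symm (f s))
  /-- `ρ ↦ ∫ f [δ²H(ρ)]⁻¹ f dx` has an `L²` first variation, smooth along smooth curves. -/
  variation : ∀ ρ f : ℝ → SmoothFn Ω, SmoothFamily Ω (Icc 0 1) ρ →
    (∀ t ∈ Icc (0 : ℝ) 1, IsDensity Ω (ρ t)) → SmoothFamily Ω (Icc 0 1) f →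
    ∃ g : ℝ → SmoothFn Ω, SmoothFamily Ω (Icc 0 1) g ∧ ∀ t ∈ Icc (0 : ℝ) 1,
      HasFirstVariation Ω (fun ρ' => integral Ω fun x => ev (f t) x * ev ((K ρ').symm (f t)) x)
        (ρ t) (g t)

/-- The continuity equation `∂_t ρ + ∇ · m = 0` on `[0,1] × Ω` with its boundary condition. -/
structure ContinuityEquation (ρ : ℝ → E d → ℝ) (m : ℝ → Fin d → E d → ℝ) : Prop where
  equation : ∀ t ∈ Icc (0 : ℝ) 1, ∀ x ∈ Ω.carrier,
    derivWithin (fun s => ρ s x) (Icc 0 1) t + divergence Ω (m t) x = 0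
  boundary : ∀ t ∈ Icc (0 : ℝ) 1, Ω.NoFlux (m t)

variable {Ω}

/-- The operator `K ρ` acts on vector fields componentwise; this is `[δ²H(ρ)]⁻¹ v`. -/
def flux (K : OperatorField Ω) (ρ : SmoothFn Ω) (v : SmoothVec Ω) : SmoothVec Ω :=
  fun i => (K ρ).symm (v i)

/-- `∬ (v(x), [δ²H(ρ)]⁻¹(x,y) v(y)) dx dy`. -/
def dualEnergy (K : OperatorField Ω) (v : SmoothVec Ω) (ρ : SmoothFn Ω) : ℝ :=
  integral Ω fun x => ∑ i, ev (v i) x * ev (flux K ρ v i) x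

/-- `∬ (m(x), δ²H(ρ)(x,y) m(y)) dx dy`. -/
def fluxEnergy (K : OperatorField Ω) (m : SmoothVec Ω) (ρ : SmoothFn Ω) : ℝ :=
  integral Ω fun x => ∑ i, ev (m i) x * ev (K ρ (m i)) x

/-- A smooth curve `ρ : [0,1] → P(Ω)` with smooth vector fields `v` that satisfy the continuity
equation `∂_t ρ + ∇ · ([δ²H(ρ)]⁻¹ v) = 0`. (Values at `t ∉ [0,1]` are irrelevant.) -/
structure IsFlow (K : OperatorField Ω) (ρ : ℝ → SmoothFn Ω) (v : ℝ → SmoothVec Ω) : Prop where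
  smooth_density : SmoothFamily Ω (Icc 0 1) ρ
  smooth_field : ∀ i, SmoothFamily Ω (Icc 0 1) (fun t => v t i)
  density : ∀ t ∈ Icc (0 : ℝ) 1, IsDensity Ω (ρ t)
  continuity : ContinuityEquation Ω (fun t => ev (ρ t)) (fun t i => ev (flux K (ρ t) (v t) i))

/-- The action `∫₀¹ ∬ (v, [δ²H(ρ)]⁻¹ v) dx dy dt`. -/
def action (K : OperatorField Ω) (ρ : ℝ → SmoothFn Ω) (v : ℝ → SmoothVec Ω) : ℝ≥0∞ :=
  ∫⁻ t in Icc (0 : ℝ) 1, ENNReal.ofReal (dualEnergy K (v t) (ρ t))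

/-- The Hessian transport distance, with value `∞` if there is no path of finite action. -/
def distance (K : OperatorField Ω) (ρ₀ ρ₁ : SmoothFn Ω) : ℝ≥0∞ :=
  (⨅ (ρ : ℝ → SmoothFn Ω) (v : ℝ → SmoothVec Ω) (_ : IsFlow K ρ v) (_ : ρ 0 = ρ₀)
    (_ : ρ 1 = ρ₁), action K ρ v) ^ (1 / 2 : ℝ)

/-- `(ρ, v)` attains the infimum in the distance between `ρ(0)` and `ρ(1)`. -/
def IsMinimizer (K : OperatorField Ω) (ρ : ℝ → SmoothFn Ω) (v : ℝ → SmoothVec Ω) : Prop :=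
  IsFlow K ρ v ∧ ∀ ρ' v', IsFlow K ρ' v' → ρ' 0 = ρ 0 → ρ' 1 = ρ 1 →
    action K ρ v ≤ action K ρ' v'

/-- Geodesics: `(ρ, v)` is a critical point of the action among the curves with the same endpoints.
In the variables `(ρ, m)`, `m = [δ²H(ρ)]⁻¹ v`, the constraint `∂_t ρ + ∇ · m = 0` is linear; hence
the admissible variations are `(ρ + ε η, m + ε w)` with `∂_t η + ∇ · w = 0`, `η(0) = η(1) = 0`. -/
def IsGeodesic (K : OperatorField Ω) (ρ : ℝ → SmoothFn Ω) (v : ℝ → SmoothVec Ω) : Prop :=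
  IsFlow K ρ v ∧ ∀ (η : ℝ → SmoothFn Ω) (w : ℝ → SmoothVec Ω),
    SmoothFamily Ω (Icc 0 1) η → (∀ i, SmoothFamily Ω (Icc 0 1) (fun t => w t i)) →
    ContinuityEquation Ω (fun t => ev (η t)) (fun t i => ev (w t i)) → η 0 = 0 → η 1 = 0 →
    HasDerivAt (fun ε : ℝ => ∫ t in (0 : ℝ)..1,
      fluxEnergy K (flux K (ρ t) (v t) + ε • w t) (ρ t + ε • η t)) 0 0

/-- The geodesic system
`∂_t ρ + ∇ · ([δ²H(ρ)]⁻¹ ∇Φ) = 0`, `∂_t Φ + ½ δ_ρ ∬ (∇Φ, [δ²H(ρ)]⁻¹ ∇Φ) dx dy = 0`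
for a smooth curve `ρ` of densities and a smooth `Φ`, with the boundary condition on the flux. -/
structure GeodesicSystem (K : OperatorField Ω) (ρ Φ : ℝ → SmoothFn Ω) : Prop where
  smooth_density : SmoothFamily Ω (Icc 0 1) ρ
  smooth_potential : SmoothFamily Ω (Icc 0 1) Φ
  density : ∀ t ∈ Icc (0 : ℝ) 1, IsDensity Ω (ρ t)
  continuity : ContinuityEquation Ω (fun t => ev (ρ t))
    (fun t i => ev (flux K (ρ t) (grad (Φ t)) i))
  hamiltonJacobi : ∀ t ∈ Icc (0 : ℝ) 1, ∃ g : SmoothFn Ω,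
    HasFirstVariation Ω (dualEnergy K (grad (Φ t))) (ρ t) g ∧
    ∀ x ∈ Ω.carrier,
      derivWithin (fun s => ev (Φ s) x) (Icc 0 1) t + 1 / 2 * ev g x = 0

/-- The system
`∂_t ρ + ∇ · (f''(ρ)⁻¹ ∇Φ) = 0`, `∂_t Φ - ½ |∇Φ|² f'''(ρ) / f''(ρ)² = 0`
for a smooth curve `ρ` of densities and a smooth `Φ`, with the boundary condition on the flux. -/
structure FGeodesicSystem (f : ℝ → ℝ) (ρ Φ : ℝ → SmoothFn Ω) : Prop where
  smooth_density : SmoothFamily Ω (Icc 0 1) ρ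
  smooth_potential : SmoothFamily Ω (Icc 0 1) Φ
  density : ∀ t ∈ Icc (0 : ℝ) 1, IsDensity Ω (ρ t)
  continuity : ContinuityEquation Ω (fun t => ev (ρ t))
    (fun t i x => (deriv (deriv f) (ev (ρ t) x))⁻¹ * ev (grad (Φ t) i) x)
  hamiltonJacobi : ∀ t ∈ Icc (0 : ℝ) 1, ∀ x ∈ Ω.carrier,
    derivWithin (fun s => ev (Φ s) x) (Icc 0 1) t
      - 1 / 2 * (∑ i, ev (grad (Φ t) i) x ^ 2)
        * (deriv (deriv (deriv f)) (ev (ρ t) x) / deriv (deriv f) (ev (ρ t) x) ^ 2) = 0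

/-- A smooth function on `(0,∞)` with positive second derivative. -/
structure IsConvexIntegrand (f : ℝ → ℝ) : Prop where
  smooth : ContDiffOn ℝ ∞ f (Ioi 0)
  pos : ∀ s, 0 < s → 0 < deriv (deriv f) s

variable (Ω) in
/-- `H_f(ρ) = ∫ f(ρ(x)) dx`. -/
def fEntropy (f : ℝ → ℝ) (ρ : SmoothFn Ω) : ℝ := integral Ω fun x => f (ev ρ x)

theorem mul_mem {f : ℝ → ℝ} (hf : ContDiffOn ℝ ∞ f (Ioi 0)) {ρ : SmoothFn Ω}
    (hρ : IsDensity Ω ρ) (g : SmoothFn Ω) : (fun x => f (ev ρ x) * ev g x) ∈ SmoothFn Ω := by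
  refine ⟨(hf.comp ρ.2.1 hρ.pos).mul g.2.1, fun x hx => ?_, ?_⟩
  · simp only [ev, g.2.2.1 x hx, mul_zero]
  · obtain ⟨ρ, h⟩ := ρ
    obtain ⟨g, h'⟩ := g
    cases Ω with
    | periodic L hL => intro i x; simp only [ev, h.2.2 i x, h'.2.2 i x]
    | neumann => trivial

theorem IsConvexIntegrand.smooth_deriv2 {f : ℝ → ℝ} (hf : IsConvexIntegrand f) :
    ContDiffOn ℝ ∞ (deriv (deriv f)) (Ioi 0) :=
  (hf.smooth.deriv_of_isOpen (m := ∞) isOpen_Ioi (by simp)).deriv_of_isOpen isOpen_Ioi (by simp)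

/-- Multiplication by `f''(ρ)`, with inverse the multiplication by `1 / f''(ρ)`. -/
def mulEquiv {f : ℝ → ℝ} (hf : IsConvexIntegrand f) {ρ : SmoothFn Ω} (hρ : IsDensity Ω ρ) :
    SmoothFn Ω ≃ₗ[ℝ] SmoothFn Ω where
  toFun g := ⟨fun x => deriv (deriv f) (ev ρ x) * ev g x, mul_mem hf.smooth_deriv2 hρ g⟩
  invFun g := ⟨fun x => (deriv (deriv f) (ev ρ x))⁻¹ * ev g x,
    mul_mem (f := fun s => (deriv (deriv f) s)⁻¹)
      (hf.smooth_deriv2.inv fun s hs => (hf.pos s hs).ne') hρ g⟩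
  map_add' g h := by ext x; simp [ev, mul_add]
  map_smul' c g := by ext x; simp [ev]; ring
  left_inv g := by
    ext x
    by_cases hx : x ∈ Ω.carrier
    · have := (hf.pos _ (hρ.pos x hx)).ne'
      simp only [ev] at this ⊢
      field_simp
    · simp [ev, g.2.2.1 x hx]
  right_inv g := by
    ext x
    by_cases hx : x ∈ Ω.carrier
    · have := (hf.pos _ (hρ.pos x hx)).ne'
      simp only [ev] at this ⊢
      field_simp
    · simp [ev, g.2.2.1 x hx]

open Classical in
variable (Ω) in
/-- The operator field `δ²H_f(ρ) = f''(ρ)` (multiplication). -/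
def fHessian {f : ℝ → ℝ} (hf : IsConvexIntegrand f) : OperatorField Ω := fun ρ =>
  if hρ : IsDensity Ω ρ then mulEquiv hf hρ else LinearEquiv.refl ℝ _

end HessianTransport

end

/-! In the variables `(ρ, m)` the continuity equation is linear, so the action is varied along
straight lines `(ρ + ε η, m + ε w)`. Its derivative is `∫ (2 ∫ w·v - ∫ g η) dt`, where `g` is the
first variation of the dual energy `∫ v·K⁻¹v` (`IsL2Hessian.hasDerivAt_action`). The sign of the
second term is the Legendre duality between `∫ m·K m` and `∫ v·K⁻¹v`.

Two kinds of variation give the geodesic equations. Taking `w = ∂ₜB` and `η = -div B` yields `2 ∂ₜv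
+ ∇g = 0` (`IsGeodesic.dt_field`). Taking `η = 0` and `w = c(t) W` with `div W = 0` shows that `v 0`
is orthogonal to the divergence-free fields, hence a gradient `∇Φ₀`
(`IsGeodesic.exists_grad_eq_zero_time`). Then `Φ = Φ₀ - ½ ∫₀ᵗ g` is a potential of `v` at all times
and solves the Hamilton-Jacobi equation. Conversely, for such a `Φ` the integrand of the first
variation is the total derivative `2 d/dt ∫ Φ η` (`isGeodesic_of_potential`). A minimizer is
critical because small variations of a flow are again flows. The distance is finite because the
segment from `ρ₀` to `ρ₁` is a flow with a constant flux `m`, `div m = ρ₀ - ρ₁`.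

Two facts about the divergence on fields with the boundary condition remain: it reaches every
function of mean zero (`exists_divS_eq`), and a field orthogonal to its kernel is a gradient
(`exists_grad_eq`). On the torus both follow from averaging one coordinate after the other. On a
domain no elliptic theory is used. Both reduce to `exists_eq_intS_mul_of_hasPotential`: a linear
functional `T` on `C^∞(Ω)`, not assumed continuous, with `T (div m) = -∫ m·v` for a curl-free `v`,
is integration against a smooth potential of `v`. This is proved locally. In an interior cube every
function is a divergence plus a multiple of one fixed function. Near the boundary mass is
transported inwards along segments, by a field that vanishes on the boundary. The local potentials
agree on overlaps because `T` fixes their constants.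

The remaining analysis is calculus up to the boundary. Differentiation under the integral needs only
that the domain is locally quasiconvex, and the divergence theorem is obtained with cutoffs in a
collar. -/

noncomputable section

namespace HessianTransport

set_option linter.unusedSectionVars false


/-! ### Differentiation under the integral sign on locally quasiconvex sets. -/

section Analysis

open Filter Topology

variable {V : Type} [NormedAddCommGroup V] [NormedSpace ℝ V]

/-- Near each of its points `x`, the set `A` is quasiconvex: a point `y ∈ A` close to `x` is joined
to `x` inside `A` by three segments whose lengths are at most a multiple of `dist x y`. -/
def LocallyQuasiconvex (A : Set V) : Prop :=
  ∀ x ∈ A, ∃ C : ℝ, ∀ᶠ y in 𝓝[A] x, ∃ p q, segment ℝ x p ⊆ A ∧ segment ℝ p q ⊆ A ∧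
    segment ℝ q y ⊆ A ∧ dist x p ≤ C * dist x y ∧ dist p q ≤ C * dist x y ∧
    dist q y ≤ C * dist x y

theorem _root_.Convex.locallyQuasiconvex {A : Set V} (hA : Convex ℝ A) :
    LocallyQuasiconvex A := by
  intro x hx
  refine ⟨1, ?_⟩
  filter_upwards [self_mem_nhdsWithin] with y hy
  refine ⟨x, y, ?_, hA.segment_subset hx hy, ?_, ?_⟩ <;> simp [hx, hy]

/-- The convex factor is crossed along the middle segment only, which is why the constant is raised
to at least `1`. It serves functions that are smooth jointly in time and space. -/
theorem LocallyQuasiconvex.prod {W : Type} [NormedAddCommGroup W] [NormedSpace ℝ W]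
    {I : Set W} {A : Set V} (hI : Convex ℝ I) (hA : LocallyQuasiconvex A) :
    LocallyQuasiconvex (I ×ˢ A) := by
  rintro ⟨t, x⟩ ⟨ht, hx⟩
  obtain ⟨C, hC⟩ := hA x hx
  refine ⟨max C 1, ?_⟩
  rw [nhdsWithin_prod_eq]
  filter_upwards [prod_mem_prod self_mem_nhdsWithin hC] with ⟨s, y⟩ ⟨hs, p, q, h1, h2, h3, d1, d2, d3⟩
  have hseg : ∀ {t t' : W} {a b : V}, t ∈ I → t' ∈ I → segment ℝ a b ⊆ A →
      segment ℝ (t, a) (t', b) ⊆ I ×ˢ A := fun ht ht' h z hz =>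
    have hz' := Prod.segment_subset (𝕜 := ℝ) _ _ hz
    ⟨hI.segment_subset ht ht' hz'.1, h hz'.2⟩
  have hd : dist x y ≤ dist (t, x) (s, y) := le_max_right _ _
  have hd' : dist t s ≤ dist (t, x) (s, y) := le_max_left _ _
  have h0 : 0 ≤ dist x y := dist_nonneg
  have key : ∀ {a : ℝ}, a ≤ C * dist x y → a ≤ max C 1 * dist (t, x) (s, y) := fun h =>
    h.trans (mul_le_mul (le_max_left _ _) hd h0 (le_trans zero_le_one (le_max_right _ _)))
  refine ⟨(t, p), (s, q), hseg ht ht h1, hseg ht hs h2, hseg hs hs h3, ?_, ?_, ?_⟩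
  · simpa [Prod.dist_eq] using key d1
  · rw [Prod.dist_eq]
    refine max_le ?_ (key d2)
    calc dist t s ≤ 1 * dist (t, x) (s, y) := by simpa using hd'
      _ ≤ _ := mul_le_mul_of_nonneg_right (le_max_right _ _) dist_nonneg
  · simpa [Prod.dist_eq] using key d3

/-- Open subsets of locally quasiconvex sets are locally quasiconvex. -/
theorem LocallyQuasiconvex.inter_isOpen {A U : Set V} (hA : LocallyQuasiconvex A)
    (hU : IsOpen U) : LocallyQuasiconvex (A ∩ U) := by
  rintro x ⟨hx, hxU⟩
  obtain ⟨C, hC⟩ := hA x hx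
  refine ⟨C, ?_⟩
  obtain ⟨δ, hδ, hball⟩ := Metric.isOpen_iff.1 hU x hxU
  -- The three segments have total length at most `3 * |C| * dist x y`, so the whole path stays in
  -- the ball.
  have h1 : ∀ᶠ y in 𝓝[A ∩ U] x, (3 * |C|) * dist x y < δ := by
    have : Tendsto (fun y => (3 * |C|) * dist x y) (𝓝 x) (𝓝 ((3 * |C|) * dist x x)) :=
      (continuous_const.mul (continuous_const.dist continuous_id)).tendsto x
    rw [dist_self, mul_zero] at this
    exact nhdsWithin_le_nhds (this.eventually (gt_mem_nhds hδ))
  filter_upwards [nhdsWithin_mono _ inter_subset_left hC, h1]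
    with y ⟨p, q, s1, s2, s3, d1, d2, d3⟩ hy
  have hle : C * dist x y ≤ |C| * dist x y :=
    mul_le_mul_of_nonneg_right (le_abs_self C) dist_nonneg
  have h0 : 0 ≤ |C| * dist x y := by positivity
  have hx' : x ∈ Metric.ball x δ := Metric.mem_ball_self hδ
  have hp : p ∈ Metric.ball x δ := by
    rw [Metric.mem_ball, dist_comm]; nlinarith
  have hq : q ∈ Metric.ball x δ := by
    rw [Metric.mem_ball, dist_comm]
    have := dist_triangle x p q
    nlinarith
  have hy' : y ∈ Metric.ball x δ := by
    rw [Metric.mem_ball, dist_comm]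
    have := dist_triangle x p q
    have := dist_triangle x q y
    nlinarith
  have hc := convex_ball x δ
  exact ⟨p, q, subset_inter s1 ((hc.segment_subset hx' hp).trans hball),
    subset_inter s2 ((hc.segment_subset hp hq).trans hball),
    subset_inter s3 ((hc.segment_subset hq hy').trans hball), d1, d2, d3⟩

variable {U G : Type} [NormedAddCommGroup U] [NormedSpace ℝ U] [NormedAddCommGroup G]
  [NormedSpace ℝ G]

/-- A function is differentiable within a locally quasiconvex set, uniformly in a compact set of
parameters. -/
theorem LocallyQuasiconvex.eventually_norm_sub_le {A : Set V} (hA : LocallyQuasiconvex A)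
    {K : Set U} (hK : IsCompact K) {F : V × U → G} {D : V × U → V →L[ℝ] G}
    (hF : ∀ x ∈ A, ∀ u ∈ K, HasFDerivWithinAt (fun y => F (y, u)) (D (x, u)) A x)
    (hD : ContinuousOn D (A ×ˢ K)) {x : V} (hx : x ∈ A) {ε : ℝ} (hε : 0 < ε) :
    ∀ᶠ y in 𝓝[A] x, ∀ u ∈ K, ‖F (y, u) - F (x, u) - D (x, u) (y - x)‖ ≤ ε * ‖y - x‖ := by
  obtain ⟨C, hC⟩ := hA x hx
  -- There are three segments, each of length at most `|C| * dist x y`; the summand `1` covers `C =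
  -- 0`.
  set ε' := ε / (3 * (|C| + 1)) with hε'
  have hε'0 : 0 < ε' := by positivity
  -- Compactness of `K` makes the continuity of `D` at `x` uniform in the parameter.
  obtain ⟨v, hv, hvD⟩ := hK.mem_uniformity_of_prod (f := fun x u => D (x, u)) (s := A)
    (by exact hD) hx (Metric.dist_mem_uniformity hε'0)
  obtain ⟨δ, hδ, hball⟩ := Metric.mem_nhdsWithin_iff.1 hv
  have h1 : ∀ᶠ y in 𝓝[A] x, (3 * |C|) * dist x y < δ := by
    have : Tendsto (fun y => (3 * |C|) * dist x y) (𝓝 x) (𝓝 ((3 * |C|) * dist x x)) :=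
      (continuous_const.mul (continuous_const.dist continuous_id)).tendsto x
    rw [dist_self, mul_zero] at this
    exact nhdsWithin_le_nhds (this.eventually (gt_mem_nhds hδ))
  filter_upwards [hC, h1] with y ⟨p, q, s1, s2, s3, d1, d2, d3⟩ hy u hu
  have hle : C * dist x y ≤ |C| * dist x y :=
    mul_le_mul_of_nonneg_right (le_abs_self C) dist_nonneg
  have h0 : 0 ≤ |C| * dist x y := by positivity
  have hx' : x ∈ Metric.ball x δ := Metric.mem_ball_self hδ
  have hp : p ∈ Metric.ball x δ := by
    rw [Metric.mem_ball, dist_comm]; nlinarith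
  have hq : q ∈ Metric.ball x δ := by
    rw [Metric.mem_ball, dist_comm]
    have := dist_triangle x p q
    nlinarith
  have hy' : y ∈ Metric.ball x δ := by
    rw [Metric.mem_ball, dist_comm]
    have := dist_triangle x p q
    have := dist_triangle x q y
    nlinarith
  -- The mean value inequality needs a convex set; it is applied on each segment, where `D` is
  -- `ε'`-close to its value at `x`.
  have key : ∀ {a b : V}, segment ℝ a b ⊆ A → a ∈ Metric.ball x δ → b ∈ Metric.ball x δ →
      dist a b ≤ C * dist x y →
      ‖F (b, u) - F (a, u) - D (x, u) (b - a)‖ ≤ ε' * (|C| * dist x y) := by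
    intro a b hab ha hb hd
    have := Convex.norm_image_sub_le_of_norm_hasFDerivWithin_le' (f := fun y => F (y, u))
      (f' := fun z => D (z, u)) (φ := D (x, u)) (C := ε')
      (fun z hz => (hF z (hab hz) u hu).mono hab)
      (fun z hz => ?_) (convex_segment a b) (left_mem_segment ℝ a b) (right_mem_segment ℝ a b)
    · refine this.trans (mul_le_mul_of_nonneg_left ?_ hε'0.le)
      rw [← dist_eq_norm, dist_comm]
      exact hd.trans hle
    · have := hvD z (hball ⟨(convex_ball x δ).segment_subset ha hb hz, hab hz⟩) u hu
      rw [← dist_eq_norm]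
      exact le_of_lt this
  have e1 := key s1 hx' hp d1
  have e2 := key s2 hp hq d2
  have e3 := key s3 hq hy' d3
  have hsum : F (y, u) - F (x, u) - D (x, u) (y - x) =
      (F (p, u) - F (x, u) - D (x, u) (p - x)) + (F (q, u) - F (p, u) - D (x, u) (q - p)) +
      (F (y, u) - F (q, u) - D (x, u) (y - q)) := by
    simp only [map_sub]; abel
  rw [hsum]
  refine (norm_add₃_le).trans ((add_le_add (add_le_add e1 e2) e3).trans ?_)
  rw [dist_comm, dist_eq_norm]
  have : ε' * (|C| * ‖y - x‖) + ε' * (|C| * ‖y - x‖) + ε' * (|C| * ‖y - x‖) =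
      ε * ‖y - x‖ * (|C| / (|C| + 1)) := by
    rw [hε']; field_simp; ring
  rw [this]
  refine mul_le_of_le_one_right (by positivity) ?_
  rw [div_le_one (by positivity)]
  linarith

theorem hasFDerivWithinAt_slice_left {A : Set V} {K : Set U} {F : V × U → G}
    (hF : DifferentiableOn ℝ F (A ×ˢ K)) {x : V} (hx : x ∈ A) {u : U} (hu : u ∈ K) :
    HasFDerivWithinAt (fun y => F (y, u))
      ((fderivWithin ℝ F (A ×ˢ K) (x, u)).comp (ContinuousLinearMap.inl ℝ V U)) A x :=
  (hF (x, u) ⟨hx, hu⟩).hasFDerivWithinAt.comp (f := fun y => (y, u)) x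
    (hasFDerivAt_prodMk_left x u).hasFDerivWithinAt fun _ hy => ⟨hy, hu⟩

variable [MeasurableSpace U] [BorelSpace U]

theorem integrable_of_continuousOn_compact {K : Set U} (hK : IsCompact K) {μ : Measure U}
    [IsFiniteMeasure μ] (hμ : ∀ᵐ u ∂μ, u ∈ K) {F : U → G} (hF : ContinuousOn F K) :
    Integrable F μ := by
  rw [← Measure.restrict_eq_self_of_ae_mem hμ]
  exact hF.integrableOn_compact hK

variable [CompleteSpace G]

/-- Differentiation under the integral sign, within a locally quasiconvex set. -/
theorem LocallyQuasiconvex.hasFDerivWithinAt_integral {A : Set V} (hA : LocallyQuasiconvex A)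
    {K : Set U} (hK : IsCompact K) {μ : Measure U} [IsFiniteMeasure μ] (hμ : ∀ᵐ u ∂μ, u ∈ K)
    {F : V × U → G} {D : V × U → V →L[ℝ] G}
    (hF : ∀ x ∈ A, ∀ u ∈ K, HasFDerivWithinAt (fun y => F (y, u)) (D (x, u)) A x)
    (hFc : ContinuousOn F (A ×ˢ K)) (hD : ContinuousOn D (A ×ˢ K)) {x : V} (hx : x ∈ A) :
    HasFDerivWithinAt (fun y => ∫ u, F (y, u) ∂μ) (∫ u, D (x, u) ∂μ) A x := by
  rw [hasFDerivWithinAt_iff_isLittleO, Asymptotics.isLittleO_iff]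
  intro c hc
  set m := μ.real univ with hm
  have hm0 : 0 ≤ m := measureReal_nonneg
  have hslice : ∀ z ∈ A, MapsTo (fun u => (z, u)) K (A ×ˢ K) := fun z hz u hu => ⟨hz, hu⟩
  have hFi : ∀ z ∈ A, Integrable (fun u => F (z, u)) μ := fun z hz =>
    integrable_of_continuousOn_compact hK hμ
      (hFc.comp (by fun_prop) (hslice z hz))
  have hDi : Integrable (fun u => D (x, u)) μ :=
    integrable_of_continuousOn_compact hK hμ (hD.comp (by fun_prop) (hslice x hx))
  filter_upwards [hA.eventually_norm_sub_le hK hF hD hx (ε := c / (m + 1)) (by positivity),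
    self_mem_nhdsWithin] with y hy hyA
  have hDy : Integrable (fun u => D (x, u) (y - x)) μ := hDi.apply_continuousLinearMap _
  rw [ContinuousLinearMap.integral_apply hDi, ← integral_sub (hFi y hyA) (hFi x hx),
    ← integral_sub (by exact (hFi y hyA).sub (hFi x hx)) hDy]
  refine (norm_integral_le_of_norm_le_const (C := c / (m + 1) * ‖y - x‖) ?_).trans ?_
  · filter_upwards [hμ] with u hu using hy u hu
  · rw [← hm]
    have : c / (m + 1) * ‖y - x‖ * m = c * ‖y - x‖ * (m / (m + 1)) := by field_simp
    rw [this]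
    refine mul_le_of_le_one_right (by positivity) ?_
    rw [div_le_one (by positivity)]
    linarith

theorem continuousOn_integral_of_compact {A : Set V}
    {K : Set U} (hK : IsCompact K) {μ : Measure U} [IsFiniteMeasure μ] (hμ : ∀ᵐ u ∂μ, u ∈ K)
    {F : V × U → G} (hFc : ContinuousOn F (A ×ˢ K)) :
    ContinuousOn (fun y => ∫ u, F (y, u) ∂μ) A := by
  intro x hx
  rw [ContinuousWithinAt, Metric.tendsto_nhds]
  intro ε hε
  set m := μ.real univ with hm
  have hm0 : 0 ≤ m := measureReal_nonneg
  have hFi : ∀ z ∈ A, Integrable (fun u => F (z, u)) μ := fun z hz =>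
    integrable_of_continuousOn_compact hK hμ
      (hFc.comp (by fun_prop) fun u hu => ⟨hz, hu⟩)
  obtain ⟨v, hv, hvD⟩ := hK.mem_uniformity_of_prod (f := fun x u => F (x, u)) (s := A)
    (by exact hFc) hx (Metric.dist_mem_uniformity (show 0 < ε / (m + 1) by positivity))
  filter_upwards [hv, self_mem_nhdsWithin] with y hy hyA
  rw [dist_eq_norm, ← integral_sub (hFi y hyA) (hFi x hx)]
  refine (norm_integral_le_of_norm_le_const (C := ε / (m + 1)) ?_).trans_lt ?_
  · filter_upwards [hμ] with u hu
    rw [← dist_eq_norm]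
    exact le_of_lt (hvD y hy u hu)
  · rw [← hm, div_mul_eq_mul_div, div_lt_iff₀ (by positivity)]
    nlinarith

/-- Smooth dependence of integrals on parameters, up to the boundary. -/
theorem LocallyQuasiconvex.contDiffOn_integral {A : Set V} (hA : LocallyQuasiconvex A)
    (hA' : UniqueDiffOn ℝ A) {K : Set U} (hK : IsCompact K) (hK' : UniqueDiffOn ℝ K)
    {μ : Measure U} [IsFiniteMeasure μ] (hμ : ∀ᵐ u ∂μ, u ∈ K)
    {F : V × U → G} (hF : ContDiffOn ℝ ∞ F (A ×ˢ K)) :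
    ContDiffOn ℝ ∞ (fun x => ∫ u, F (x, u) ∂μ) A := by
  rw [contDiffOn_infty]
  intro n
  -- The target varies in the induction: the derivative of the integral is the integral of an
  -- operator-valued map.
  induction n generalizing G with
  | zero =>
    rw [Nat.cast_zero, contDiffOn_zero]
    exact continuousOn_integral_of_compact hK hμ hF.continuousOn
  | succ n ih =>
    have hprod := hA'.prod hK'
    have hD : ContDiffOn ℝ ∞ (fun z => (fderivWithin ℝ F (A ×ˢ K) z).comp
        (ContinuousLinearMap.inl ℝ V U)) (A ×ˢ K) :=
      (hF.fderivWithin hprod (m := ∞) (by simp)).clm_comp contDiffOn_const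
    have hder : ∀ x ∈ A, HasFDerivWithinAt (fun y => ∫ u, F (y, u) ∂μ)
        (∫ u, (fderivWithin ℝ F (A ×ˢ K) (x, u)).comp (ContinuousLinearMap.inl ℝ V U) ∂μ) A x :=
      fun x hx => hA.hasFDerivWithinAt_integral hK hμ
        (D := fun z => (fderivWithin ℝ F (A ×ˢ K) z).comp (ContinuousLinearMap.inl ℝ V U))
        (fun x hx u hu => hasFDerivWithinAt_slice_left (hF.differentiableOn (by simp)) hx hu)
        hF.continuousOn hD.continuousOn hx
    rw [Nat.cast_add, Nat.cast_one]
    refine (contDiffOn_succ_iff_fderivWithin hA').2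
      ⟨fun x hx => (hder x hx).differentiableWithinAt, by simp, ?_⟩
    exact (ih hD).congr fun x hx => (hder x hx).fderivWithin (hA' x hx)

end Analysis

/-! ### Geometry of the domain near its boundary. -/

section Geometry

open Filter Topology

variable {d : ℕ}

/-- Near a regular boundary point there is an inward direction along which the defining function
decreases at least at unit speed. -/
theorem exists_inward_direction {r : E d → ℝ} (hr : ContDiff ℝ ∞ r) {x : E d}
    (hx : fderiv ℝ r x ≠ 0) : ∃ e : E d, ∃ δ > 0, ∀ z ∈ Metric.ball x δ, fderiv ℝ r z e < -1 := by
  obtain ⟨y, hy⟩ : ∃ y, fderiv ℝ r x y ≠ 0 := by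
    by_contra h
    push Not at h
    exact hx (ContinuousLinearMap.ext h)
  -- The derivative at `x` in this direction is `-2`, which leaves room for `< -1` at nearby points.
  refine ⟨(-2 / fderiv ℝ r x y) • y, ?_⟩
  have hc : Continuous fun z => fderiv ℝ r z ((-2 / fderiv ℝ r x y) • y) :=
    (hr.continuous_fderiv (by simp)).clm_apply continuous_const
  have h0 : fderiv ℝ r x ((-2 / fderiv ℝ r x y) • y) < -1 := by
    rw [map_smul, smul_eq_mul, div_mul_cancel₀ _ hy]; norm_num
  exact Metric.eventually_nhds_iff_ball.1 (hc.continuousAt.eventually (gt_mem_nhds h0))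

theorem le_sub_of_direction {r : E d → ℝ} (hr : ContDiff ℝ ∞ r) {x e : E d} {δ : ℝ}
    (he : ∀ z ∈ Metric.ball x δ, fderiv ℝ r z e < -1) {z : E d} (hz : z ∈ Metric.ball x δ) {τ : ℝ}
    (hτ : 0 ≤ τ) (hzτ : z + τ • e ∈ Metric.ball x δ) : r (z + τ • e) ≤ r z - τ := by
  have hd : ∀ s : ℝ, HasDerivAt (fun s : ℝ => r (z + s • e)) (fderiv ℝ r (z + s • e) e) s := by
    intro s
    have h1 : HasDerivAt (fun s : ℝ => z + s • e) e s := by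
      simpa using ((hasDerivAt_id s).smul_const e).const_add z
    exact ((hr.differentiable (by simp)).differentiableAt.hasFDerivAt).comp_hasDerivAt s h1
  have hmem : ∀ s ∈ Icc 0 τ, z + s • e ∈ Metric.ball x δ := by
    intro s hs
    rcases hτ.eq_or_lt with h | h
    · have : s = 0 := le_antisymm (h ▸ hs.2) hs.1
      simpa [this] using hz
    · have := (convex_ball x δ).add_smul_sub_mem hz hzτ (t := s / τ)
        ⟨div_nonneg hs.1 hτ, (div_le_one h).2 hs.2⟩
      rwa [add_sub_cancel_left, smul_smul, div_mul_cancel₀ _ h.ne'] at this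
  have := Convex.image_sub_le_mul_sub_of_deriv_le (convex_Icc (0 : ℝ) τ)
    (f := fun s : ℝ => r (z + s • e)) (C := -1)
    (fun s _ => (hd s).continuousAt.continuousWithinAt)
    (fun s _ => (hd s).differentiableAt.differentiableWithinAt)
    (fun s hs => by
      rw [(hd s).deriv]
      exact (he _ (hmem s (interior_subset hs))).le)
    0 (left_mem_Icc.2 hτ) τ (right_mem_Icc.2 hτ) hτ
  simp only [zero_smul, add_zero, sub_zero] at this
  linarith

/-- Near a boundary point `x` the chord to `y` may leave the domain, but `r ≤ L * dist x y` along
it. Shifting it by `L * dist x y` in an inward direction lowers `r` by at least that amount. The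
path therefore goes inwards from `x`, along the shifted chord, and back to `y`. -/
theorem SampleSpace.locallyQuasiconvex_carrier (Ω : SampleSpace d) :
    LocallyQuasiconvex Ω.carrier := by
  cases Ω with
  | periodic L hL => exact convex_univ.locallyQuasiconvex
  | neumann r hr hreg hc hconn =>
    change LocallyQuasiconvex {x | r x ≤ 0}
    intro x hx
    have hx' : r x ≤ 0 := hx
    rcases hx'.lt_or_eq with hlt | heq
    · refine ⟨1, ?_⟩
      have : {y | r y < 0} ∈ 𝓝 x := (isOpen_lt hr.continuous continuous_const).mem_nhds hlt
      obtain ⟨δ, hδ, hb⟩ := Metric.mem_nhds_iff.1 this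
      filter_upwards [mem_nhdsWithin_of_mem_nhds (Metric.ball_mem_nhds x hδ)] with y hy
      have hs : segment ℝ x y ⊆ {x | r x ≤ 0} := fun z hz =>
        (show r z < 0 from
          hb ((convex_ball x δ).segment_subset (Metric.mem_ball_self hδ) hy hz)).le
      refine ⟨x, y, ?_, hs, ?_, ?_⟩
      · simpa using hx
      · have := hs (right_mem_segment ℝ x y)
        simpa using this
      · simp
    · obtain ⟨e, δ, hδ, he⟩ := exists_inward_direction hr (hreg x heq)
      have hLc : Continuous fun z => ‖fderiv ℝ r z‖ := (hr.continuous_fderiv (by simp)).norm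
      obtain ⟨δ', hδ', hL⟩ := Metric.eventually_nhds_iff_ball.1
        (hLc.continuousAt.eventually (gt_mem_nhds (lt_add_one ‖fderiv ℝ r x‖)))
      set L := ‖fderiv ℝ r x‖ + 1 with hLdef
      have hL0 : 0 < L := by positivity
      set ρ := min δ δ' with hρ
      have hρ0 : 0 < ρ := lt_min hδ hδ'
      have hlip : ∀ z ∈ Metric.ball x ρ, r z ≤ L * dist x z := by
        intro z hz
        have := Convex.norm_image_sub_le_of_norm_fderiv_le (𝕜 := ℝ) (f := r)
          (s := Metric.ball x ρ) (C := L)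
          (fun y _ => (hr.differentiable (by simp)).differentiableAt)
          (fun y hy => (hL y (Metric.ball_subset_ball (min_le_right _ _) hy)).le)
          (convex_ball x ρ) (Metric.mem_ball_self hρ0) hz
        rw [heq, sub_zero, Real.norm_eq_abs, ← dist_eq_norm, dist_comm] at this
        exact (le_abs_self _).trans this
      have hmono : ∀ z ∈ Metric.ball x ρ, ∀ τ : ℝ, 0 ≤ τ → z + τ • e ∈ Metric.ball x ρ →
          r (z + τ • e) ≤ r z - τ := fun z hz τ hτ hzτ =>
        le_sub_of_direction hr he (Metric.ball_subset_ball (min_le_left _ _) hz) hτ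
          (Metric.ball_subset_ball (min_le_left _ _) hzτ)
      refine ⟨L * ‖e‖ + 1, ?_⟩
      have h1 : ∀ᶠ y in 𝓝[{x | r x ≤ 0}] x, (1 + L * ‖e‖) * dist x y < ρ := by
        have : Tendsto (fun y => (1 + L * ‖e‖) * dist x y) (𝓝 x)
            (𝓝 ((1 + L * ‖e‖) * dist x x)) :=
          (continuous_const.mul (continuous_const.dist continuous_id)).tendsto x
        rw [dist_self, mul_zero] at this
        exact nhdsWithin_le_nhds (this.eventually (gt_mem_nhds hρ0))
      filter_upwards [h1, self_mem_nhdsWithin] with y hy hyA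
      have hyA : r y ≤ 0 := hyA
      have hd0 : 0 ≤ dist x y := dist_nonneg
      -- The depth by which the chord is shifted: the largest value of `r` that the Lipschitz bound
      -- allows on it.
      set s := L * dist x y with hs
      have hs0 : 0 ≤ s := by positivity
      have hball : ∀ z, dist x z ≤ dist x y → ∀ τ, 0 ≤ τ → τ ≤ s →
          z + τ • e ∈ Metric.ball x ρ := by
        intro z hz τ hτ hτs
        rw [Metric.mem_ball, dist_comm]
        calc dist x (z + τ • e) ≤ dist x z + dist z (z + τ • e) := dist_triangle _ _ _
          _ = dist x z + τ * ‖e‖ := by rw [dist_self_add_right, norm_smul, Real.norm_of_nonneg hτ]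
          _ ≤ dist x y + s * ‖e‖ := by gcongr
          _ = (1 + L * ‖e‖) * dist x y := by rw [hs]; ring
          _ < ρ := hy
      have hball0 : ∀ z, dist x z ≤ dist x y → z ∈ Metric.ball x ρ := fun z hz => by
        simpa using hball z hz 0 le_rfl hs0
      have hvert : ∀ z, r z ≤ 0 → dist x z ≤ dist x y →
          segment ℝ z (z + s • e) ⊆ {x | r x ≤ 0} := by
        intro z hz hzd w hw
        rw [segment_eq_image'] at hw
        obtain ⟨θ, hθ, rfl⟩ := hw
        have hτ : 0 ≤ θ * s := mul_nonneg hθ.1 hs0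
        have hτ' : θ * s ≤ s := mul_le_of_le_one_left hs0 hθ.2
        have := hmono z (hball0 z hzd) (θ * s) hτ (hball z hzd _ hτ hτ')
        change r (z + θ • (z + s • e - z)) ≤ 0
        rw [add_sub_cancel_left, smul_smul]
        linarith
      have hdist : ∀ z, dist z (z + s • e) ≤ (L * ‖e‖ + 1) * dist x y := by
        intro z
        rw [dist_self_add_right, norm_smul, Real.norm_of_nonneg hs0, hs]
        nlinarith
      refine ⟨x + s • e, y + s • e, hvert x hx (by simp), ?_, ?_, hdist x, ?_, ?_⟩
      · intro w hw
        rw [segment_eq_image'] at hw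
        obtain ⟨θ, hθ, rfl⟩ := hw
        have hz : dist x (x + θ • (y - x)) ≤ dist x y := by
          rw [dist_self_add_right, norm_smul, Real.norm_of_nonneg hθ.1, dist_comm x y,
            dist_eq_norm]
          exact mul_le_of_le_one_left (norm_nonneg _) hθ.2
        have e1 := hlip _ (hball0 _ hz)
        have e2 := hmono _ (hball0 _ hz) s hs0 (hball _ hz s hs0 le_rfl)
        have : x + s • e + θ • (y + s • e - (x + s • e)) = x + θ • (y - x) + s • e := by
          simp only [add_sub_add_right_eq_sub]; abel
        change r _ ≤ 0
        dsimp only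
        rw [this]
        have : L * dist x (x + θ • (y - x)) ≤ s := mul_le_mul_of_nonneg_left hz hL0.le
        linarith
      · rw [segment_symm]; exact hvert y hyA le_rfl
      · rw [dist_add_right]
        have : 0 ≤ L * ‖e‖ := by positivity
        nlinarith
      · rw [dist_comm]; exact hdist y

/-- Boundary points are limits of points pushed in the inward direction. This is what makes second
derivatives symmetric up to the boundary. -/
theorem SampleSpace.carrier_subset_closure_interior (Ω : SampleSpace d) :
    Ω.carrier ⊆ closure (interior Ω.carrier) := by
  cases Ω with
  | periodic L hL =>
    have : (periodic L hL).carrier = univ := rfl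
    simp [this]
  | neumann r hr hreg hc hconn =>
    intro x hx
    have hsub : {y | r y < 0} ⊆ interior {y | r y ≤ 0} :=
      interior_maximal (fun y (hy : r y < 0) => hy.le) (isOpen_lt hr.continuous continuous_const)
    refine closure_mono hsub ?_
    have hx' : r x ≤ 0 := hx
    rcases hx'.lt_or_eq with hlt | heq
    · exact subset_closure hlt
    · obtain ⟨e, δ, hδ, he⟩ := exists_inward_direction hr (hreg x heq)
      have ht : Tendsto (fun s : ℝ => x + s • e) (𝓝[>] 0) (𝓝 x) := by
        have : Tendsto (fun s : ℝ => x + s • e) (𝓝 0) (𝓝 (x + (0 : ℝ) • e)) :=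
          (by fun_prop : Continuous fun s : ℝ => x + s • e).tendsto 0
        rw [zero_smul, add_zero] at this
        exact this.mono_left nhdsWithin_le_nhds
      refine mem_closure_of_tendsto ht ?_
      filter_upwards [ht (Metric.ball_mem_nhds x hδ), self_mem_nhdsWithin] with s hs hs0
      have hs0 : (0 : ℝ) < s := hs0
      have := le_sub_of_direction hr he (Metric.mem_ball_self hδ) hs0.le hs
      change r _ < 0
      linarith

theorem SampleSpace.IsPeriodic.comp₂ {Ω : SampleSpace d} {f g : E d → ℝ} (hf : Ω.IsPeriodic f)
    (hg : Ω.IsPeriodic g) (φ : ℝ → ℝ → ℝ) : Ω.IsPeriodic fun x => φ (f x) (g x) := by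
  cases Ω with
  | periodic L hL => intro i x; simp only [hf i x, hg i x]
  | neumann => trivial

theorem SampleSpace.isPeriodic_const (Ω : SampleSpace d) (c : ℝ) :
    Ω.IsPeriodic fun _ => c := by
  cases Ω with
  | periodic L hL => intro i x; rfl
  | neumann => trivial

theorem SampleSpace.IsPeriodic.indicator {Ω : SampleSpace d} {f : E d → ℝ}
    (hf : Ω.IsPeriodic f) : Ω.IsPeriodic (Ω.carrier.indicator f) := by
  cases Ω with
  | periodic L hL =>
    have : (SampleSpace.periodic L hL).carrier = univ := rfl
    rw [this, indicator_univ]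
    exact hf
  | neumann => trivial

end Geometry

/-! ### Algebra and partial derivatives on `C^∞(Ω)`. -/

section SmoothFn

variable {d : ℕ} {Ω : SampleSpace d}

theorem contDiffOn_ev (f : SmoothFn Ω) : ContDiffOn ℝ ∞ (ev f) Ω.carrier := f.2.1

theorem ev_of_notMem (f : SmoothFn Ω) {x : E d} (hx : x ∉ Ω.carrier) : ev f x = 0 := f.2.2.1 x hx

theorem isPeriodic_ev (f : SmoothFn Ω) : Ω.IsPeriodic (ev f) := f.2.2.2

theorem SmoothFn.ext_carrier {f g : SmoothFn Ω} (h : ∀ x ∈ Ω.carrier, ev f x = ev g x) :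
    f = g := by
  ext x
  by_cases hx : x ∈ Ω.carrier
  · exact h x hx
  · exact (ev_of_notMem f hx).trans (ev_of_notMem g hx).symm

@[simp] theorem ev_add (f g : SmoothFn Ω) (x : E d) : ev (f + g) x = ev f x + ev g x := rfl

@[simp] theorem ev_sub (f g : SmoothFn Ω) (x : E d) : ev (f - g) x = ev f x - ev g x := rfl

@[simp] theorem ev_neg (f : SmoothFn Ω) (x : E d) : ev (-f) x = -ev f x := rfl

@[simp] theorem ev_smul (c : ℝ) (f : SmoothFn Ω) (x : E d) : ev (c • f) x = c * ev f x := rfl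

@[simp] theorem ev_zero (x : E d) : ev (0 : SmoothFn Ω) x = 0 := rfl

@[simp] theorem ev_sum {ι : Type*} (s : Finset ι) (f : ι → SmoothFn Ω) (x : E d) :
    ev (∑ i ∈ s, f i) x = ∑ i ∈ s, ev (f i) x := by
  classical
  induction s using Finset.induction_on with
  | empty => simp
  | insert i s hi ih => rw [Finset.sum_insert hi, Finset.sum_insert hi, ev_add, ih]

/-- A smooth function on `Ω`, from its values on `Ω`. -/
def mkFn (F : E d → ℝ) (h : ContDiffOn ℝ ∞ F Ω.carrier) (hp : Ω.IsPeriodic F) : SmoothFn Ω :=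
  ⟨Ω.carrier.indicator F, h.congr fun _ hx => indicator_of_mem hx _,
    fun _ hx => indicator_of_notMem hx _, hp.indicator⟩

theorem ev_mkFn {F : E d → ℝ} (h : ContDiffOn ℝ ∞ F Ω.carrier) (hp : Ω.IsPeriodic F) {x : E d}
    (hx : x ∈ Ω.carrier) : ev (mkFn F h hp) x = F x := indicator_of_mem hx _

instance : Mul (SmoothFn Ω) where
  mul f g := ⟨fun x => ev f x * ev g x, (contDiffOn_ev f).mul (contDiffOn_ev g),
    fun x hx => by simp [ev_of_notMem f hx], (isPeriodic_ev f).comp₂ (isPeriodic_ev g) _⟩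

@[simp] theorem ev_mul (f g : SmoothFn Ω) (x : E d) : ev (f * g) x = ev f x * ev g x := rfl

variable (Ω) in
/-- The constant functions. -/
def constFn (c : ℝ) : SmoothFn Ω := mkFn (fun _ => c) contDiffOn_const (Ω.isPeriodic_const c)

theorem ev_constFn (c : ℝ) {x : E d} (hx : x ∈ Ω.carrier) : ev (constFn Ω c) x = c :=
  ev_mkFn _ _ hx

theorem ev_grad (f : SmoothFn Ω) (i : Fin d) {x : E d} (hx : x ∈ Ω.carrier) :
    ev (grad f i) x = partialD Ω i (ev f) x := indicator_of_mem hx _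

theorem differentiableWithinAt_ev (f : SmoothFn Ω) {x : E d} (hx : x ∈ Ω.carrier) :
    DifferentiableWithinAt ℝ (ev f) Ω.carrier x :=
  (contDiffOn_ev f).differentiableOn (by simp) x hx

theorem ev_grad_of_hasFDerivWithinAt {f : SmoothFn Ω} {x : E d} (hx : x ∈ Ω.carrier)
    {l : E d →L[ℝ] ℝ} (h : HasFDerivWithinAt (ev f) l Ω.carrier x) (i : Fin d) :
    ev (grad f i) x = l (EuclideanSpace.single i 1) := by
  rw [ev_grad f i hx, partialD, h.fderivWithin (Ω.uniqueDiffOn_carrier x hx)]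

theorem clm_apply_eq_sum (l : E d →L[ℝ] ℝ) (y : E d) :
    l y = ∑ i, y i * l (EuclideanSpace.single i 1) := by
  conv_lhs => rw [← (EuclideanSpace.basisFun (Fin d) ℝ).sum_repr y]
  simp [map_sum]

/-- Partial derivatives, as linear maps of `C^∞(Ω)`. -/
def dx (i : Fin d) : SmoothFn Ω →ₗ[ℝ] SmoothFn Ω where
  toFun f := grad f i
  map_add' f g := SmoothFn.ext_carrier fun x hx => by
    rw [ev_add, ev_grad_of_hasFDerivWithinAt (f := f + g) hx
      ((differentiableWithinAt_ev f hx).hasFDerivWithinAt.add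
        (differentiableWithinAt_ev g hx).hasFDerivWithinAt), ev_grad f i hx, ev_grad g i hx]
    rfl
  map_smul' c f := SmoothFn.ext_carrier fun x hx => by
    rw [RingHom.id_apply, ev_smul, ev_grad_of_hasFDerivWithinAt (f := c • f) hx
      ((differentiableWithinAt_ev f hx).hasFDerivWithinAt.const_smul c), ev_grad f i hx]
    rfl

theorem dx_apply (i : Fin d) (f : SmoothFn Ω) : dx i f = grad f i := rfl

theorem ev_dx (f : SmoothFn Ω) (i : Fin d) {x : E d} (hx : x ∈ Ω.carrier) :
    ev (dx i f) x = fderivWithin ℝ (ev f) Ω.carrier x (EuclideanSpace.single i 1) := ev_grad f i hx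

theorem fderivWithin_ev_apply (f : SmoothFn Ω) {x : E d} (hx : x ∈ Ω.carrier) (y : E d) :
    fderivWithin ℝ (ev f) Ω.carrier x y = ∑ i, y i * ev (dx i f) x := by
  rw [clm_apply_eq_sum]
  simp only [ev_dx f _ hx]

theorem dx_mul (i : Fin d) (f g : SmoothFn Ω) : dx i (f * g) = f * dx i g + dx i f * g :=
  SmoothFn.ext_carrier fun x hx => by
    rw [dx_apply, ev_grad_of_hasFDerivWithinAt (f := f * g) hx
      ((differentiableWithinAt_ev f hx).hasFDerivWithinAt.mul
        (differentiableWithinAt_ev g hx).hasFDerivWithinAt), ev_add, ev_mul, ev_mul, ev_dx f i hx,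
      ev_dx g i hx]
    simp [mul_comm]

theorem dx_constFn (i : Fin d) (c : ℝ) : dx i (constFn Ω c) = 0 :=
  SmoothFn.ext_carrier fun x hx => by
    have : HasFDerivWithinAt (ev (constFn Ω c)) (0 : E d →L[ℝ] ℝ) Ω.carrier x :=
      (hasFDerivWithinAt_const c x _).congr (fun y hy => ev_constFn c hy) (ev_constFn c hx)
    rw [dx_apply, ev_grad_of_hasFDerivWithinAt hx this]
    rfl

/-- Mixed directional derivatives commute. -/
theorem fderivWithin_fderivWithin_apply_comm {V : Type} [NormedAddCommGroup V] [NormedSpace ℝ V]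
    {F : V → ℝ} {S : Set V} (hS : UniqueDiffOn ℝ S) (hS' : S ⊆ closure (interior S))
    (hF : ContDiffOn ℝ ∞ F S) {x : V} (hx : x ∈ S) (a b : V) :
    fderivWithin ℝ (fun z => fderivWithin ℝ F S z a) S x b =
      fderivWithin ℝ (fun z => fderivWithin ℝ F S z b) S x a := by
  have hsymm : IsSymmSndFDerivWithinAt ℝ F S x :=
    (hF x hx).isSymmSndFDerivWithinAt
      (by rw [minSmoothness_of_isRCLikeNormedField]; exact WithTop.coe_le_coe.2 le_top) hS (hS' hx) hx
  have hd : DifferentiableWithinAt ℝ (fderivWithin ℝ F S) S x :=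
    (hF.fderivWithin hS (m := ∞) (by simp)).differentiableOn (by simp) x hx
  have key : ∀ c : V, fderivWithin ℝ (fun z => fderivWithin ℝ F S z c) S x =
      (fderivWithin ℝ (fderivWithin ℝ F S) S x).flip c := by
    intro c
    have := hd.hasFDerivWithinAt.clm_apply (hasFDerivWithinAt_const c x S)
    rw [this.fderivWithin (hS x hx)]
    ext y
    simp
  rw [key, key]
  exact hsymm b a

theorem dx_comm (i j : Fin d) (f : SmoothFn Ω) : dx i (dx j f) = dx j (dx i f) :=
  SmoothFn.ext_carrier fun x hx => by
    have key : ∀ k : Fin d, fderivWithin ℝ (ev (dx k f)) Ω.carrier x =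
        fderivWithin ℝ (fun z => fderivWithin ℝ (ev f) Ω.carrier z (EuclideanSpace.single k 1))
          Ω.carrier x := fun k =>
      fderivWithin_congr (fun y hy => ev_dx f k hy) (ev_dx f k hx)
    rw [ev_dx _ _ hx, ev_dx _ _ hx, key, key]
    exact fderivWithin_fderivWithin_apply_comm Ω.uniqueDiffOn_carrier
      Ω.carrier_subset_closure_interior (contDiffOn_ev f) hx _ _

/-- The divergence of a smooth vector field. -/
def divS : SmoothVec Ω →ₗ[ℝ] SmoothFn Ω where
  toFun m := ∑ i, dx i (m i)
  map_add' m n := by simp [Finset.sum_add_distrib]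
  map_smul' c m := by simp [Finset.smul_sum]

theorem divS_apply (m : SmoothVec Ω) : divS m = ∑ i, dx i (m i) := rfl

theorem ev_divS (m : SmoothVec Ω) {x : E d} (hx : x ∈ Ω.carrier) :
    ev (divS m) x = divergence Ω (fun i => ev (m i)) x := by
  rw [divS_apply, ev_sum, divergence]
  exact Finset.sum_congr rfl fun i _ => ev_grad _ _ hx

end SmoothFn

/-! ### The cell of integration. -/

section Cell

open Filter Topology

variable {d : ℕ} (Ω : SampleSpace d)

/-- The closed period cell, respectively the domain itself. -/
def SampleSpace.closedCell : SampleSpace d → Set (E d)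
  | periodic L _ => {x | ∀ i, 0 ≤ x i ∧ x i ≤ L i}
  | neumann r _ _ _ _ => {x | r x ≤ 0}

theorem SampleSpace.cell_subset_closedCell : Ω.cell ⊆ Ω.closedCell := by
  cases Ω with
  | periodic L hL => exact fun x hx i => ⟨(hx i).1, (hx i).2.le⟩
  | neumann => exact Subset.rfl

theorem SampleSpace.closedCell_subset_carrier : Ω.closedCell ⊆ Ω.carrier := by
  cases Ω with
  | periodic L hL => exact subset_univ _
  | neumann => exact Subset.rfl

theorem SampleSpace.cell_subset_carrier : Ω.cell ⊆ Ω.carrier :=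
  Ω.cell_subset_closedCell.trans Ω.closedCell_subset_carrier

theorem SampleSpace.isCompact_closedCell : IsCompact Ω.closedCell := by
  cases Ω with
  | periodic L hL =>
    have h := ((EuclideanSpace.equiv (Fin d) ℝ).toHomeomorph.isCompact_preimage
      (s := Icc 0 L)).2 isCompact_Icc
    convert h using 1
    ext x
    simp only [SampleSpace.closedCell, mem_ofPred_eq, mem_preimage, mem_Icc, Pi.le_def,
      ← forall_and]
    rfl
  | neumann r hr hreg hc hconn => exact hc

theorem interior_box_nonempty {L : Fin d → ℝ} (hL : ∀ i, 0 < L i) {s : Set (E d)}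
    (hs : {x : E d | ∀ i, 0 < x i ∧ x i < L i} ⊆ s) : (interior s).Nonempty := by
  have hopen : IsOpen {x : E d | ∀ i, 0 < x i ∧ x i < L i} := by
    simp only [ofPred_forall]
    refine isOpen_iInter_of_finite fun i => ?_
    have hc : Continuous fun x : E d => x i := by fun_prop
    exact (isOpen_lt continuous_const hc).inter (isOpen_lt hc continuous_const)
  refine ⟨WithLp.toLp 2 fun i => L i / 2, interior_maximal hs hopen fun i => ?_⟩
  have := hL i
  constructor <;> simp <;> linarith

theorem convex_box (L : Fin d → ℝ) : Convex ℝ {x : E d | ∀ i, 0 ≤ x i ∧ x i ≤ L i} := by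
  intro x hx y hy a b ha hb hab i
  have h1 := hx i
  have h2 := hy i
  simp only [PiLp.add_apply, PiLp.smul_apply, smul_eq_mul]
  constructor
  · nlinarith
  · calc a * x i + b * y i ≤ a * L i + b * L i := by gcongr <;> tauto
      _ = L i := by rw [← add_mul, hab, one_mul]

theorem SampleSpace.uniqueDiffOn_closedCell : UniqueDiffOn ℝ Ω.closedCell := by
  cases Ω with
  | periodic L hL =>
    exact uniqueDiffOn_convex (convex_box L)
      (interior_box_nonempty hL fun x hx i => ⟨(hx i).1.le, (hx i).2.le⟩)
  | neumann r hr hreg hc hconn => exact (neumann r hr hreg hc hconn).uniqueDiffOn_carrier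

theorem SampleSpace.measurableSet_cell : MeasurableSet Ω.cell := by
  cases Ω with
  | periodic L hL =>
    change MeasurableSet {x : E d | ∀ i, 0 ≤ x i ∧ x i < L i}
    simp only [ofPred_forall]
    refine MeasurableSet.iInter fun i => ?_
    have hm : Measurable fun x : E d => x i := by fun_prop
    exact (measurableSet_le measurable_const hm).inter (measurableSet_lt hm measurable_const)
  | neumann r hr hreg hc hconn =>
    exact (isClosed_le hr.continuous continuous_const).measurableSet

instance : IsFiniteMeasure (volume.restrict Ω.cell) :=
  ⟨by
    rw [Measure.restrict_apply_univ]
    exact (measure_mono Ω.cell_subset_closedCell).trans_lt Ω.isCompact_closedCell.measure_lt_top⟩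

theorem SampleSpace.ae_mem_closedCell : ∀ᵐ x ∂(volume.restrict Ω.cell), x ∈ Ω.closedCell :=
  (ae_restrict_mem Ω.measurableSet_cell).mono fun _ hx => Ω.cell_subset_closedCell hx

theorem integrable_cell {F : E d → ℝ} (hF : ContinuousOn F Ω.carrier) :
    Integrable F (volume.restrict Ω.cell) :=
  integrable_of_continuousOn_compact Ω.isCompact_closedCell Ω.ae_mem_closedCell
    (hF.mono Ω.closedCell_subset_carrier)

theorem integral_congr_carrier {F G : E d → ℝ} (h : ∀ x ∈ Ω.carrier, F x = G x) :
    integral Ω F = integral Ω G :=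
  setIntegral_congr_fun Ω.measurableSet_cell fun x hx => h x (Ω.cell_subset_carrier hx)

/-- It upgrades almost everywhere equality of continuous functions on the cell to equality
everywhere. -/
theorem SampleSpace.cell_subset_closure_interior : Ω.cell ⊆ closure (interior Ω.cell) := by
  cases Ω with
  | periodic L hL =>
    have hc : Convex ℝ {x : E d | ∀ i, 0 ≤ x i ∧ x i < L i} := by
      intro x hx y hy a b ha hb hab i
      have h1 := hx i
      have h2 := hy i
      simp only [PiLp.add_apply, PiLp.smul_apply, smul_eq_mul]
      constructor
      · nlinarith
      · calc a * x i + b * y i < a * L i + b * L i := by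
              rcases ha.eq_or_lt with h | h
              · have : b = 1 := by linarith
                subst this; rw [← h]; simpa using h2.2
              · have e1 := mul_lt_mul_of_pos_left h1.2 h
                have e2 := mul_le_mul_of_nonneg_left h2.2.le hb
                linarith
          _ = L i := by rw [← add_mul, hab, one_mul]
    have hne : (interior {x : E d | ∀ i, 0 ≤ x i ∧ x i < L i}).Nonempty :=
      interior_box_nonempty hL fun x hx i => ⟨(hx i).1.le, (hx i).2⟩
    exact (hc.closure_interior_eq_closure_of_nonempty_interior hne).symm ▸ subset_closure
  | neumann r hr hreg hc hconn => exact (neumann r hr hreg hc hconn).carrier_subset_closure_interior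

/-- Each point of the sample space has a representative in the cell. -/
theorem SampleSpace.exists_mem_cell {x : E d} (hx : x ∈ Ω.carrier) :
    ∃ y ∈ Ω.cell, ∀ f : E d → ℝ, Ω.IsPeriodic f → f x = f y := by
  cases Ω with
  | neumann => exact ⟨x, hx, fun _ _ => rfl⟩
  | periodic L hL =>
    refine ⟨x + ∑ i, (-toIcoDiv (hL i) 0 (x i)) • EuclideanSpace.single i (L i), fun i => ?_,
      fun f hf => ?_⟩
    · have : (x + ∑ i, (-toIcoDiv (hL i) 0 (x i)) • (EuclideanSpace.single i (L i) : E d)) i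
          = toIcoMod (hL i) 0 (x i) := by
        rw [← self_sub_toIcoDiv_zsmul]
        simp [Finset.sum_apply, Pi.single_apply, sub_eq_add_neg]
      rw [this]
      exact toIcoMod_mem_Ico' (hL i) (x i)
    · have hper : ∀ s : Finset (Fin d),
          f (x + ∑ i ∈ s, (-toIcoDiv (hL i) 0 (x i)) • EuclideanSpace.single i (L i)) = f x := by
        intro s
        induction s using Finset.induction_on with
        | empty => simp
        | insert i s hi ih =>
          rw [Finset.sum_insert hi, add_comm ((-toIcoDiv (hL i) 0 (x i)) • _), ← add_assoc,
            Function.Periodic.zsmul (f := f) (fun y => hf i y), ih]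
      exact (hper _).symm

end Cell

/-! ### The ring `C^∞(Ω)` and the integral as a linear functional. -/

section Integral

open Filter Topology

variable {d : ℕ} {Ω : SampleSpace d}

instance : One (SmoothFn Ω) := ⟨constFn Ω 1⟩

theorem ev_one {x : E d} (hx : x ∈ Ω.carrier) : ev (1 : SmoothFn Ω) x = 1 := ev_constFn 1 hx

instance : CommRing (SmoothFn Ω) :=
  { (inferInstance : AddCommGroup (SmoothFn Ω)), (inferInstance : Mul (SmoothFn Ω)),
    (inferInstance : One (SmoothFn Ω)) with
    mul_assoc := fun f g h => SmoothFn.ext_carrier fun x _ => by simp [mul_assoc]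
    one_mul := fun f => SmoothFn.ext_carrier fun x hx => by simp [ev_one hx]
    mul_one := fun f => SmoothFn.ext_carrier fun x hx => by simp [ev_one hx]
    left_distrib := fun f g h => SmoothFn.ext_carrier fun x _ => by simp [mul_add]
    right_distrib := fun f g h => SmoothFn.ext_carrier fun x _ => by simp [add_mul]
    zero_mul := fun f => SmoothFn.ext_carrier fun x _ => by simp
    mul_zero := fun f => SmoothFn.ext_carrier fun x _ => by simp
    mul_comm := fun f g => SmoothFn.ext_carrier fun x _ => by simp [mul_comm] }

instance : Algebra ℝ (SmoothFn Ω) :=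
  Algebra.ofModule (fun r f g => SmoothFn.ext_carrier fun x _ => by simp [mul_assoc])
    (fun r f g => SmoothFn.ext_carrier fun x _ => by simp [mul_left_comm])

theorem integrable_ev (f : SmoothFn Ω) : Integrable (ev f) (volume.restrict Ω.cell) :=
  integrable_cell Ω (contDiffOn_ev f).continuousOn

/-- The integral, as a linear functional on `C^∞(Ω)`. -/
def intS : SmoothFn Ω →ₗ[ℝ] ℝ where
  toFun f := integral Ω (ev f)
  map_add' f g := integral_add (integrable_ev f) (integrable_ev g)
  map_smul' c f := integral_const_mul c (ev f)

theorem intS_apply (f : SmoothFn Ω) : intS f = integral Ω (ev f) := rfl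

theorem integral_mul_eq (f g : SmoothFn Ω) :
    integral Ω (fun x => ev f x * ev g x) = intS (f * g) := rfl

theorem isTangent_iff (f : SmoothFn Ω) : IsTangent Ω f ↔ intS f = 0 := Iff.rfl

theorem intS_nonneg {f : SmoothFn Ω} (hf : ∀ x ∈ Ω.carrier, 0 ≤ ev f x) : 0 ≤ intS f :=
  setIntegral_nonneg Ω.measurableSet_cell fun x hx => hf x (Ω.cell_subset_carrier hx)

/-- Nonnegativity gives zero almost everywhere on the cell, continuity gives zero on the cell, and
periodicity gives zero on the whole carrier. -/
theorem eq_zero_of_intS_eq_zero {f : SmoothFn Ω} (hf : ∀ x ∈ Ω.carrier, 0 ≤ ev f x)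
    (h : intS f = 0) : f = 0 := by
  have hae : ev f =ᵐ[volume.restrict Ω.cell] fun _ => 0 := by
    refine (setIntegral_eq_zero_iff_of_nonneg_ae ?_ (integrable_ev f)).1 h
    filter_upwards [ae_restrict_mem Ω.measurableSet_cell] with x hx
      using hf x (Ω.cell_subset_carrier hx)
  have heq := Measure.eqOn_of_ae_eq hae
    ((contDiffOn_ev f).continuousOn.mono Ω.cell_subset_carrier) continuousOn_const
    Ω.cell_subset_closure_interior
  refine SmoothFn.ext_carrier fun x hx => ?_
  obtain ⟨y, hy, hxy⟩ := Ω.exists_mem_cell hx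
  rw [hxy _ (isPeriodic_ev f), heq hy, ev_zero]

theorem intS_pos {f : SmoothFn Ω} (hf : ∀ x ∈ Ω.carrier, 0 ≤ ev f x) (h : f ≠ 0) : 0 < intS f :=
  (intS_nonneg hf).lt_of_ne fun h0 => h (eq_zero_of_intS_eq_zero hf h0.symm)

theorem eq_zero_of_intS_mul_self {f : SmoothFn Ω} (h : intS (f * f) = 0) : f = 0 := by
  have := eq_zero_of_intS_eq_zero (f := f * f) (fun x _ => mul_self_nonneg _) h
  refine SmoothFn.ext_carrier fun x _ => ?_
  have h2 : ev (f * f) x = 0 := by rw [this]; rfl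
  exact mul_self_eq_zero.1 h2

end Integral

/-! ### Smooth families and time derivatives. -/

section Family

open Filter Topology

variable {d : ℕ} {Ω : SampleSpace d} {V W : Type} [NormedAddCommGroup V] [NormedSpace ℝ V]
  [NormedAddCommGroup W] [NormedSpace ℝ W] {S : Set V} {f g : V → SmoothFn Ω}

theorem SmoothFamily.congr (hf : SmoothFamily Ω S f) (h : ∀ s ∈ S, g s = f s) :
    SmoothFamily Ω S g :=
  ContDiffOn.congr hf fun p hp => by rw [h p.1 hp.1]

theorem smoothFamily_const (f : SmoothFn Ω) : SmoothFamily Ω S fun _ => f :=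
  (contDiffOn_ev f).comp contDiffOn_snd fun _ hp => hp.2

theorem smoothFamily_zero : SmoothFamily Ω S (0 : V → SmoothFn Ω) := smoothFamily_const 0

theorem SmoothFamily.add (hf : SmoothFamily Ω S f) (hg : SmoothFamily Ω S g) :
    SmoothFamily Ω S fun s => f s + g s := ContDiffOn.add hf hg

theorem SmoothFamily.sub (hf : SmoothFamily Ω S f) (hg : SmoothFamily Ω S g) :
    SmoothFamily Ω S fun s => f s - g s := ContDiffOn.sub hf hg

theorem SmoothFamily.neg (hf : SmoothFamily Ω S f) : SmoothFamily Ω S fun s => - f s :=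
  ContDiffOn.neg hf

theorem SmoothFamily.mul (hf : SmoothFamily Ω S f) (hg : SmoothFamily Ω S g) :
    SmoothFamily Ω S fun s => f s * g s := ContDiffOn.mul hf hg

theorem SmoothFamily.smul {φ : V → ℝ} (hφ : ContDiffOn ℝ ∞ φ S) (hf : SmoothFamily Ω S f) :
    SmoothFamily Ω S fun s => φ s • f s :=
  (hφ.comp contDiffOn_fst fun _ hp => hp.1).mul hf

theorem SmoothFamily.sum {ι : Type*} {s : Finset ι} {f : ι → V → SmoothFn Ω}
    (hf : ∀ i ∈ s, SmoothFamily Ω S (f i)) : SmoothFamily Ω S fun a => ∑ i ∈ s, f i a := by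
  have : ContDiffOn ℝ ∞ (fun p : V × E d => ∑ i ∈ s, ev (f i p.1) p.2) (S ×ˢ Ω.carrier) :=
    ContDiffOn.sum hf
  exact this.congr fun p _ => by rw [ev_sum]

theorem SmoothFamily.comp (hf : SmoothFamily Ω S f) {T : Set W} {φ : W → V}
    (hφ : ContDiffOn ℝ ∞ φ T) (hm : MapsTo φ T S) : SmoothFamily Ω T fun s => f (φ s) :=
  ContDiffOn.comp (s := T ×ˢ Ω.carrier) (t := S ×ˢ Ω.carrier)
    (f := fun p : W × E d => (φ p.1, p.2)) hf
    ((hφ.comp contDiffOn_fst fun _ hp => hp.1).prodMk contDiffOn_snd) fun _ hp => ⟨hm hp.1, hp.2⟩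

theorem SmoothFamily.dx (hS : UniqueDiffOn ℝ S) (hf : SmoothFamily Ω S f) (i : Fin d) :
    SmoothFamily Ω S fun s => dx i (f s) := by
  have hu := hS.prod Ω.uniqueDiffOn_carrier
  have h : ContDiffOn ℝ ∞ (fun p => fderivWithin ℝ (fun p : V × E d => ev (f p.1) p.2)
      (S ×ˢ Ω.carrier) p (0, EuclideanSpace.single i 1)) (S ×ˢ Ω.carrier) :=
    (ContDiffOn.fderivWithin hf hu (m := ∞) (by simp)).clm_apply contDiffOn_const
  refine h.congr fun p hp => ?_
  have hd : HasFDerivWithinAt (ev (f p.1)) ((fderivWithin ℝ (fun p : V × E d => ev (f p.1) p.2)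
      (S ×ˢ Ω.carrier) p).comp (ContinuousLinearMap.inr ℝ V (E d))) Ω.carrier p.2 :=
    (ContDiffOn.differentiableOn hf (by simp) p hp).hasFDerivWithinAt.comp
      (f := fun y => (p.1, y)) p.2 (hasFDerivAt_prodMk_right p.1 p.2).hasFDerivWithinAt
      fun _ hy => ⟨hp.1, hy⟩
  exact ev_grad_of_hasFDerivWithinAt hp.2 hd i

theorem SmoothFamily.divS (hS : UniqueDiffOn ℝ S) {m : V → SmoothVec Ω}
    (hm : ∀ i, SmoothFamily Ω S fun s => m s i) : SmoothFamily Ω S fun s => divS (m s) :=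
  (SmoothFamily.sum (s := Finset.univ) fun i _ => (hm i).dx hS i).congr fun _ _ => rfl

/-- The integral of a smooth family is smooth in the parameters. -/
theorem SmoothFamily.contDiffOn_intS (hS : UniqueDiffOn ℝ S) (hS' : LocallyQuasiconvex S)
    (hf : SmoothFamily Ω S f) : ContDiffOn ℝ ∞ (fun s => intS (f s)) S :=
  hS'.contDiffOn_integral hS Ω.isCompact_closedCell Ω.uniqueDiffOn_closedCell
    Ω.ae_mem_closedCell (ContDiffOn.mono hf (prod_mono Subset.rfl Ω.closedCell_subset_carrier))

theorem SmoothFamily.contDiffOn_slice (hf : SmoothFamily Ω S f) {x : E d} (hx : x ∈ Ω.carrier) :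
    ContDiffOn ℝ ∞ (fun s => ev (f s) x) S :=
  ContDiffOn.comp (f := fun s => (s, x)) hf (by fun_prop) fun _ hs => ⟨hs, hx⟩

theorem SmoothFamily.hasDerivWithinAt_intS {S : Set ℝ} (hS : UniqueDiffOn ℝ S) (hS' : Convex ℝ S)
    {f : ℝ → SmoothFn Ω} (hf : SmoothFamily Ω S f) {t : ℝ} (ht : t ∈ S) :
    HasDerivWithinAt (fun s => intS (f s))
      (integral Ω fun x => derivWithin (fun s => ev (f s) x) S t) S t := by
  have hu := hS.prod Ω.uniqueDiffOn_carrier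
  set F := fun p : ℝ × E d => ev (f p.1) p.2
  have hc := prod_mono (Subset.refl S) Ω.closedCell_subset_carrier
  have hD : ContDiffOn ℝ ∞ (fun p => (fderivWithin ℝ F (S ×ˢ Ω.carrier) p).comp
      (ContinuousLinearMap.inl ℝ ℝ (E d))) (S ×ˢ Ω.carrier) :=
    (ContDiffOn.fderivWithin hf hu (m := ∞) (by simp)).clm_comp contDiffOn_const
  have hsl : ∀ s ∈ S, ∀ x ∈ Ω.carrier, HasFDerivWithinAt (fun s => F (s, x))
      ((fderivWithin ℝ F (S ×ˢ Ω.carrier) (s, x)).comp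
        (ContinuousLinearMap.inl ℝ ℝ (E d))) S s := fun s hs x hx =>
    hasFDerivWithinAt_slice_left (ContDiffOn.differentiableOn hf (by simp)) hs hx
  have key := hS'.locallyQuasiconvex.hasFDerivWithinAt_integral Ω.isCompact_closedCell
    Ω.ae_mem_closedCell (F := F) (D := fun p => (fderivWithin ℝ F (S ×ˢ Ω.carrier) p).comp
      (ContinuousLinearMap.inl ℝ ℝ (E d)))
    (fun s hs x hx => hsl s hs x (Ω.closedCell_subset_carrier hx))
    (ContDiffOn.continuousOn hf |>.mono hc) (hD.continuousOn.mono hc) ht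
  have key2 := key.hasDerivWithinAt
  refine key2.congr_deriv ?_
  rw [ContinuousLinearMap.integral_apply]
  · refine integral_congr_carrier Ω fun x hx => ?_
    exact ((hsl t ht x hx).hasDerivWithinAt.derivWithin (hS t ht)).symm
  · exact integrable_of_continuousOn_compact Ω.isCompact_closedCell Ω.ae_mem_closedCell
      ((hD.continuousOn.mono hc).comp (by fun_prop) fun x hx => ⟨ht, hx⟩)

open Classical in
/-- The time derivative of a curve in `C^∞(Ω)` on the time interval `[0,1]`. -/
def dt (f : ℝ → SmoothFn Ω) (t : ℝ) : SmoothFn Ω :=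
  -- Both conditions hold for a smooth family at every `t ∈ [0,1]` (`SmoothFamily.ev_dt`), so the
  -- default `0` is not reached there.
  if h : ContDiffOn ℝ ∞ (fun x => derivWithin (fun s => ev (f s) x) (Icc 0 1) t) Ω.carrier ∧
      Ω.IsPeriodic (fun x => derivWithin (fun s => ev (f s) x) (Icc 0 1) t)
  then mkFn _ h.1 h.2 else 0

variable {f g : ℝ → SmoothFn Ω}

theorem SmoothFamily.contDiffOn_derivWithin (hf : SmoothFamily Ω (Icc 0 1) f) :
    ContDiffOn ℝ ∞ (fun p : ℝ × E d => derivWithin (fun s => ev (f s) p.2) (Icc 0 1) p.1)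
      (Icc 0 1 ×ˢ Ω.carrier) := by
  have hI := uniqueDiffOn_Icc (zero_lt_one' ℝ)
  have hu := hI.prod Ω.uniqueDiffOn_carrier
  have h : ContDiffOn ℝ ∞ (fun p => fderivWithin ℝ (fun p : ℝ × E d => ev (f p.1) p.2)
      (Icc 0 1 ×ˢ Ω.carrier) p (1, 0)) (Icc 0 1 ×ˢ Ω.carrier) :=
    (ContDiffOn.fderivWithin hf hu (m := ∞) (by simp)).clm_apply contDiffOn_const
  refine h.congr fun p hp => ?_
  exact (hasFDerivWithinAt_slice_left (ContDiffOn.differentiableOn hf (by simp))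
    hp.1 hp.2).hasDerivWithinAt.derivWithin (hI p.1 hp.1)

theorem SmoothFamily.ev_dt (hf : SmoothFamily Ω (Icc 0 1) f) {t : ℝ} (ht : t ∈ Icc (0 : ℝ) 1)
    {x : E d} (hx : x ∈ Ω.carrier) :
    ev (dt f t) x = derivWithin (fun s => ev (f s) x) (Icc 0 1) t := by
  have h1 : ContDiffOn ℝ ∞ (fun x => derivWithin (fun s => ev (f s) x) (Icc 0 1) t)
      Ω.carrier :=
    hf.contDiffOn_derivWithin.comp (f := fun x => (t, x)) (by fun_prop) fun x hx => ⟨ht, hx⟩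
  have h2 : Ω.IsPeriodic (fun x => derivWithin (fun s => ev (f s) x) (Icc 0 1) t) := by
    cases Ω with
    | periodic L hL =>
      intro i x
      have : (fun s => ev (f s) (x + EuclideanSpace.single i (L i))) = fun s => ev (f s) x :=
        funext fun s => isPeriodic_ev (f s) i x
      dsimp only
      rw [this]
    | neumann => trivial
  rw [dt, dif_pos ⟨h1, h2⟩, ev_mkFn _ _ hx]

theorem SmoothFamily.hasDerivWithinAt_ev (hf : SmoothFamily Ω (Icc 0 1) f) {t : ℝ}
    (ht : t ∈ Icc (0 : ℝ) 1) {x : E d} (hx : x ∈ Ω.carrier) :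
    HasDerivWithinAt (fun s => ev (f s) x) (ev (dt f t) x) (Icc 0 1) t := by
  rw [hf.ev_dt ht hx]
  exact ((hf.contDiffOn_slice hx).differentiableOn (by simp) t ht).hasDerivWithinAt

theorem SmoothFamily.dt_eq (hf : SmoothFamily Ω (Icc 0 1) f) {t : ℝ} (ht : t ∈ Icc (0 : ℝ) 1)
    {h : SmoothFn Ω} (hh : ∀ x ∈ Ω.carrier,
      HasDerivWithinAt (fun s => ev (f s) x) (ev h x) (Icc 0 1) t) : dt f t = h :=
  SmoothFn.ext_carrier fun x hx => by
    rw [hf.ev_dt ht hx]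
    exact (hh x hx).derivWithin (uniqueDiffOn_Icc (zero_lt_one' ℝ) t ht)

theorem SmoothFamily.dt (hf : SmoothFamily Ω (Icc 0 1) f) : SmoothFamily Ω (Icc 0 1) (dt f) :=
  hf.contDiffOn_derivWithin.congr fun _ hp => hf.ev_dt hp.1 hp.2

theorem dt_mul (hf : SmoothFamily Ω (Icc 0 1) f) (hg : SmoothFamily Ω (Icc 0 1) g) {t : ℝ}
    (ht : t ∈ Icc (0 : ℝ) 1) : dt (fun s => f s * g s) t = dt f t * g t + f t * dt g t :=
  (hf.mul hg).dt_eq ht fun _ hx =>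
    (hf.hasDerivWithinAt_ev ht hx).mul (hg.hasDerivWithinAt_ev ht hx)

theorem dt_sum {ι : Type*} {s : Finset ι} {f : ι → ℝ → SmoothFn Ω}
    (hf : ∀ i ∈ s, SmoothFamily Ω (Icc 0 1) (f i)) {t : ℝ} (ht : t ∈ Icc (0 : ℝ) 1) :
    dt (fun a => ∑ i ∈ s, f i a) t = ∑ i ∈ s, dt (f i) t :=
  (SmoothFamily.sum hf).dt_eq ht fun x hx => by
    simp only [ev_sum]
    exact HasDerivWithinAt.fun_sum fun i hi => (hf i hi).hasDerivWithinAt_ev ht hx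

/-- Time derivatives and partial derivatives commute. -/
theorem dt_dx (hf : SmoothFamily Ω (Icc 0 1) f) (i : Fin d) {t : ℝ} (ht : t ∈ Icc (0 : ℝ) 1) :
    dt (fun s => dx i (f s)) t = dx i (dt f t) := by
  have hI := uniqueDiffOn_Icc (zero_lt_one' ℝ)
  have hu := hI.prod Ω.uniqueDiffOn_carrier
  have hcl : Icc (0 : ℝ) 1 ×ˢ Ω.carrier ⊆ closure (interior (Icc (0 : ℝ) 1 ×ˢ Ω.carrier)) := by
    rw [interior_prod_eq, closure_prod_eq, interior_Icc, closure_Ioo zero_ne_one]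
    exact prod_mono Subset.rfl Ω.carrier_subset_closure_interior
  have hdx := hf.dx hI i
  refine SmoothFn.ext_carrier fun x hx => ?_
  set S := Icc (0 : ℝ) 1 ×ˢ Ω.carrier with hS
  have hp : (t, x) ∈ S := ⟨ht, hx⟩
  -- Both operations are directional derivatives of one function of `(t, x)`, in the directions `(1,
  -- 0)` and `(0, eᵢ)`, so that the symmetry of second derivatives on `S` applies.
  have key : ∀ {h : ℝ → SmoothFn Ω}, SmoothFamily Ω (Icc 0 1) h → ∀ p ∈ S,
      ev (dt h p.1) p.2 = fderivWithin ℝ (fun p : ℝ × E d => ev (h p.1) p.2) S p (1, 0) ∧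
      ev (dx i (h p.1)) p.2 = fderivWithin ℝ (fun p : ℝ × E d => ev (h p.1) p.2) S p
        (0, EuclideanSpace.single i 1) := by
    intro h hh p hp
    have hd := (ContDiffOn.differentiableOn hh (by simp) p hp).hasFDerivWithinAt
    constructor
    · rw [hh.ev_dt hp.1 hp.2]
      exact (hasFDerivWithinAt_slice_left (ContDiffOn.differentiableOn hh (by simp))
        hp.1 hp.2).hasDerivWithinAt.derivWithin (hI p.1 hp.1)
    · have hd' : HasFDerivWithinAt (ev (h p.1)) ((fderivWithin ℝ
          (fun p : ℝ × E d => ev (h p.1) p.2) S p).comp (ContinuousLinearMap.inr ℝ ℝ (E d)))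
          Ω.carrier p.2 :=
        hd.comp (f := fun y => (p.1, y)) p.2
          (hasFDerivAt_prodMk_right p.1 p.2).hasFDerivWithinAt fun _ hy => ⟨hp.1, hy⟩
      rw [dx_apply, ev_grad_of_hasFDerivWithinAt hp.2 hd']
      rfl
  rw [(key hdx (t, x) hp).1, (key hf.dt (t, x) hp).2,
    fderivWithin_congr (fun p hp => (key hf p hp).2) (key hf (t, x) hp).2,
    fderivWithin_congr (fun p hp => (key hf p hp).1) (key hf (t, x) hp).1]
  exact fderivWithin_fderivWithin_apply_comm hu hcl hf hp _ _

theorem dt_divS {m : ℝ → SmoothVec Ω} (hm : ∀ i, SmoothFamily Ω (Icc 0 1) fun s => m s i) {t : ℝ}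
    (ht : t ∈ Icc (0 : ℝ) 1) :
    dt (fun s => divS (m s)) t = divS fun i => dt (fun s => m s i) t := by
  have h := dt_sum (s := Finset.univ) (f := fun i s => dx i (m s i))
    (fun i _ => (hm i).dx (uniqueDiffOn_Icc (zero_lt_one' ℝ)) i) ht
  rw [divS_apply]
  exact h.trans (Finset.sum_congr rfl fun i _ => dt_dx (hm i) i ht)

/-- The fundamental theorem of calculus for the mass of a smooth curve. -/
theorem intervalIntegral_intS_dt (hf : SmoothFamily Ω (Icc 0 1) f) :
    ∫ t in (0 : ℝ)..1, intS (dt f t) = intS (f 1) - intS (f 0) := by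
  have hI := uniqueDiffOn_Icc (zero_lt_one' ℝ)
  have hC := hf.contDiffOn_intS hI (convex_Icc _ _).locallyQuasiconvex
  rw [← intervalIntegral.integral_derivWithin_Icc_of_contDiffOn_Icc (hC.of_le (by simp))
    zero_le_one]
  refine intervalIntegral.integral_congr fun t ht => ?_
  rw [uIcc_of_le zero_le_one] at ht
  rw [(hf.hasDerivWithinAt_intS hI (convex_Icc _ _) ht).derivWithin (hI t ht)]
  exact integral_congr_carrier Ω fun x hx => hf.ev_dt ht hx

theorem SmoothFamily.continuousOn_intS (hf : SmoothFamily Ω (Icc 0 1) f) :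
    ContinuousOn (fun t => intS (f t)) (Icc 0 1) :=
  (hf.contDiffOn_intS (uniqueDiffOn_Icc (zero_lt_one' ℝ))
    (convex_Icc _ _).locallyQuasiconvex).continuousOn

end Family

/-! ### Transversal lines at the boundary. -/

section BoundaryChart

open Filter Topology

variable {d : ℕ} {r : E d → ℝ} {x₀ : E d}

/-- Near a boundary point `x₀`, the lines in an inward direction `dir` meet the zero set of the
defining function `r` transversally: the point `x` reaches it at the point `x - time x • dir`. -/
structure BoundaryChart (r : E d → ℝ) (x₀ : E d) where
  dir : E d
  radius : ℝ
  height : ℝ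
  time : E d → ℝ
  radius_pos : 0 < radius
  height_pos : 0 < height
  -- Moving against `dir` raises `r` at least at unit speed. Hence the zero on each line is unique,
  -- and inside of the domain `time x ≤ -r x`.
  decrease : ∀ x ∈ Metric.ball x₀ radius, ∀ s s' : ℝ, |s| ≤ height → |s'| ≤ height → s ≤ s' →
    r (x - s • dir) + (s' - s) ≤ r (x - s' • dir)
  abs_time_lt : ∀ x ∈ Metric.ball x₀ radius, |time x| < height
  r_time : ∀ x ∈ Metric.ball x₀ radius, r (x - time x • dir) = 0
  smooth : ContDiffOn ℝ ∞ time (Metric.ball x₀ radius)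

namespace BoundaryChart

variable (c : BoundaryChart r x₀)

theorem time_unique {x : E d} (hx : x ∈ Metric.ball x₀ c.radius) {s : ℝ} (hs : |s| ≤ c.height)
    (h : r (x - s • c.dir) = 0) : s = c.time x := by
  have ht := (c.abs_time_lt x hx).le
  have h0 := c.r_time x hx
  rcases le_total s (c.time x) with h1 | h1
  · have := c.decrease x hx s (c.time x) hs ht h1
    linarith
  · have := c.decrease x hx (c.time x) s ht hs h1
    linarith

theorem time_nonneg {x : E d} (hx : x ∈ Metric.ball x₀ c.radius) (h : r x ≤ 0) :
    0 ≤ c.time x := by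
  by_contra! hlt
  have := c.decrease x hx (c.time x) 0 (c.abs_time_lt x hx).le
    (by simpa using c.height_pos.le) hlt.le
  rw [c.r_time x hx, zero_smul, sub_zero] at this
  linarith

theorem time_le {x : E d} (hx : x ∈ Metric.ball x₀ c.radius) (h : r x ≤ 0) :
    c.time x ≤ -r x := by
  have := c.decrease x hx 0 (c.time x)
    (by simpa using c.height_pos.le) (c.abs_time_lt x hx).le (c.time_nonneg hx h)
  rw [c.r_time x hx, zero_smul, sub_zero] at this
  linarith

theorem nonpos_of_le_time {x : E d} (hx : x ∈ Metric.ball x₀ c.radius) {s : ℝ} (hs : 0 ≤ s)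
    (h : s ≤ c.time x) : r (x - s • c.dir) ≤ 0 := by
  have ht := c.abs_time_lt x hx
  have := c.decrease x hx s (c.time x)
    (by rw [abs_of_nonneg hs]; exact (h.trans (le_abs_self _)).trans ht.le) ht.le h
  rw [c.r_time x hx] at this
  linarith

/-- Both points lie on the same line and reach the same boundary point, so uniqueness of the zero
makes `time` affine with unit slope along the line. -/
theorem time_sub_smul {x : E d} {s : ℝ} (hx : x ∈ Metric.ball x₀ c.radius)
    (hx' : x - s • c.dir ∈ Metric.ball x₀ c.radius) (hs : |c.time x - s| ≤ c.height) :
    c.time (x - s • c.dir) = c.time x - s := by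
  refine (c.time_unique hx' hs ?_).symm
  rw [← c.r_time x hx]
  congr 1
  rw [sub_smul]
  abel

end BoundaryChart

/-- Monotonicity of `r` along an inward direction and the intermediate value theorem produce exactly
one zero on each short line. Uniqueness then identifies this zero with the implicit function at
every point, which gives smoothness on the whole ball and not only at `x₀`. -/
theorem exists_boundaryChart (hr : ContDiff ℝ ∞ r) (h0 : r x₀ = 0) (hx : fderiv ℝ r x₀ ≠ 0) :
    Nonempty (BoundaryChart r x₀) := by
  obtain ⟨e, δ₀, hδ₀, he⟩ := exists_inward_direction hr hx
  -- A displacement by at most `η` along `e` has length below `δ₀ / 2`, so points of the smaller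
  -- ball stay in the ball of radius `δ₀`.
  set η := δ₀ / (2 * (‖e‖ + 1)) with hη
  have hη0 : 0 < η := by positivity
  have hηe : η * ‖e‖ < δ₀ / 2 := by
    have : η * (‖e‖ + 1) = δ₀ / 2 := by rw [hη]; field_simp
    nlinarith
  have hcont : Continuous fun x => |r x| := hr.continuous.abs
  obtain ⟨δ₁, hδ₁, hr₁⟩ := Metric.eventually_nhds_iff_ball.1
    (hcont.continuousAt.eventually (gt_mem_nhds (show |r x₀| < η by rw [h0]; simpa using hη0)))
  set δ := min δ₁ (δ₀ / 2) with hδ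
  have hδ0 : 0 < δ := lt_min hδ₁ (by positivity)
  have hmem : ∀ x ∈ Metric.ball x₀ δ, ∀ s : ℝ, |s| ≤ η → x - s • e ∈ Metric.ball x₀ δ₀ := by
    intro x hx s hs
    have h1 : dist x x₀ < δ₀ / 2 := lt_of_lt_of_le hx (min_le_right _ _)
    have h2 : dist (x - s • e) x ≤ η * ‖e‖ := by
      rw [dist_eq_norm, sub_sub_cancel_left, norm_neg, norm_smul, Real.norm_eq_abs]
      gcongr
    have := dist_triangle (x - s • e) x x₀
    rw [Metric.mem_ball]; linarith
  have hdec : ∀ x ∈ Metric.ball x₀ δ, ∀ s s' : ℝ, |s| ≤ η → |s'| ≤ η → s ≤ s' →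
      r (x - s • e) + (s' - s) ≤ r (x - s' • e) := by
    intro x hx s s' hs hs' hss
    have hz : x - s' • e + (s' - s) • e = x - s • e := by rw [sub_smul]; abel
    have := le_sub_of_direction hr he (hmem x hx s' hs') (sub_nonneg.2 hss)
      (by rw [hz]; exact hmem x hx s hs)
    rw [hz] at this
    linarith
  -- As `|r x| < η`, a displacement by `η` either way changes `r` enough to force opposite signs at
  -- the two ends.
  have hex : ∀ x ∈ Metric.ball x₀ δ, ∃ s : ℝ, |s| < η ∧ r (x - s • e) = 0 := by
    intro x hx
    have hrx : |r x| < η := hr₁ x (Metric.ball_subset_ball (min_le_left _ _) hx)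
    rw [abs_lt] at hrx
    have e1 := hdec x hx 0 η (by simpa using hη0.le) (by rw [abs_of_pos hη0]) hη0.le
    have e2 := hdec x hx (-η) 0 (by rw [abs_neg, abs_of_pos hη0]) (by simpa using hη0.le)
      (by linarith)
    rw [zero_smul, sub_zero] at e1 e2
    obtain ⟨s, hs, hs0⟩ := intermediate_value_Icc (by linarith : -η ≤ η)
      (f := fun s : ℝ => r (x - s • e))
      ((hr.continuous.comp (by fun_prop)).continuousOn)
      (show (0 : ℝ) ∈ Icc (r (x - (-η) • e)) (r (x - η • e)) from
        ⟨by linarith, by linarith⟩)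
    refine ⟨s, abs_lt.2 ⟨lt_of_le_of_ne hs.1 ?_, lt_of_le_of_ne hs.2 ?_⟩, hs0⟩
    · rintro rfl; dsimp only at hs0; linarith
    · rintro rfl; dsimp only at hs0; linarith
  choose! t ht using hex
  have huniq : ∀ x ∈ Metric.ball x₀ δ, ∀ s : ℝ, |s| ≤ η → r (x - s • e) = 0 → s = t x := by
    intro x hx s hs h
    obtain ⟨h1, h2⟩ := ht x hx
    rcases le_total s (t x) with h3 | h3
    · have := hdec x hx s (t x) hs h1.le h3
      linarith
    · have := hdec x hx (t x) s h1.le hs h3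
      linarith
  refine ⟨⟨e, δ, η, t, hδ0, hη0, hdec, fun x hx => (ht x hx).1, fun x hx => (ht x hx).2, ?_⟩⟩
  intro x hx
  obtain ⟨h1, h2⟩ := ht x hx
  set F : E d × ℝ → ℝ := fun p => r (p.1 - p.2 • e) with hF
  have hFs : ContDiff ℝ ∞ F := hr.comp (by fun_prop)
  have hFd : HasFDerivAt F ((fderiv ℝ r (x - t x • e)).comp
      (ContinuousLinearMap.fst ℝ (E d) ℝ - (ContinuousLinearMap.snd ℝ (E d) ℝ).smulRight e))
      (x, t x) := by
    have hd : HasFDerivAt r (fderiv ℝ r (x - t x • e)) (x - t x • e) :=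
      (hr.differentiable (by simp)).differentiableAt.hasFDerivAt
    refine hd.comp (x, t x) (f := fun p : E d × ℝ => p.1 - p.2 • e) ?_
    exact hasFDerivAt_fst.sub (hasFDerivAt_snd.smul_const e)
  set a := fderiv ℝ r (x - t x • e) e with ha
  have ha1 : a < -1 := he _ (hmem x hx _ h1.le)
  have ha0 : a ≠ 0 := by linarith
  -- The partial derivative in the line parameter is `-a`, and `a < -1`.
  have hinv : (fderiv ℝ F (x, t x) ∘L ContinuousLinearMap.inr ℝ (E d) ℝ).IsInvertible := by
    rw [hFd.fderiv]
    refine ContinuousLinearMap.IsInvertible.of_inverse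
      (g := (-a⁻¹) • ContinuousLinearMap.id ℝ ℝ) ?_ ?_ <;>
    · ext
      simp [← ha, ha0]
  have hat : ContDiffAt ℝ ∞ F (x, t x) := hFs.contDiffAt
  set ψ := hat.implicitFunction (by simp) hinv with hψ
  have hψs : ContDiffAt ℝ ∞ ψ x := hat.contDiffAt_implicitFunction (by simp) hinv
  have hψ0 : ψ x = t x := hat.implicitFunction_apply_self (by simp) hinv
  have hψe : ∀ᶠ y in 𝓝 x, F (y, ψ y) = F (x, t x) :=
    hat.eventually_apply_implicitFunction (by simp) hinv
  refine (hψs.congr_of_eventuallyEq ?_).contDiffWithinAt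
  have hev : ∀ᶠ y in 𝓝 x, |ψ y| < η :=
    hψs.continuousAt.abs.eventually (gt_mem_nhds (show |ψ x| < η by rw [hψ0]; exact h1))
  filter_upwards [hψe, hev, Metric.isOpen_ball.mem_nhds hx] with y hy1 hy2 hy3
  refine (huniq y hy3 (ψ y) hy2.le ?_).symm
  have : F (x, t x) = 0 := h2
  rw [this] at hy1
  exact hy1

open scoped Pointwise in
/-- The boundary is a null set. -/
theorem volume_zeroSet (hr : ContDiff ℝ ∞ r) (hreg : ∀ x, r x = 0 → fderiv ℝ r x ≠ 0) :
    volume {x : E d | r x = 0} = 0 := by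
  refine measure_null_of_locally_null _ fun x hx => ?_
  obtain ⟨c⟩ := exists_boundaryChart hr hx (hreg x hx)
  refine ⟨Metric.ball x c.radius ∩ {x | r x = 0},
    inter_mem (mem_nhdsWithin_of_mem_nhds (Metric.ball_mem_nhds _ c.radius_pos))
      self_mem_nhdsWithin, ?_⟩
  have hh := c.height_pos
  have hu : ∀ n : ℕ, c.height / (n + 1) ≤ c.height ∧ 0 < c.height / (n + 1) := fun n =>
    ⟨div_le_self hh.le (by linarith [(Nat.cast_nonneg n : (0 : ℝ) ≤ n)]), by positivity⟩
  -- A bounded set with infinitely many disjoint translates in a bounded region is null. The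
  -- translates along `dir` are disjoint because each line meets the zero set only once.
  have hdisj : ∀ m n : ℕ, m < n → Disjoint
      (({-((c.height / (m + 1)) • c.dir)} : Set (E d)) + (Metric.ball x c.radius ∩ {x | r x = 0}))
      (({-((c.height / (n + 1)) • c.dir)} : Set (E d)) + (Metric.ball x c.radius ∩ {x | r x = 0})) := by
    intro m n hmn
    rw [Set.disjoint_left]
    rintro _ ⟨_, rfl, y, ⟨hy, hry⟩, rfl⟩ ⟨_, rfl, z, ⟨hz, hrz⟩, hyz⟩
    have hmn' : c.height / (n + 1) < c.height / (m + 1) := by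
      have : (m : ℝ) < n := by exact_mod_cast hmn
      gcongr
    have hzy : z - (c.height / (n + 1) - c.height / (m + 1)) • c.dir = y := by
      have hyz' : -((c.height / (n + 1)) • c.dir) + z = -((c.height / (m + 1)) • c.dir) + y := hyz
      have hz' : z = (c.height / (n + 1)) • c.dir + (-((c.height / (m + 1)) • c.dir) + y) := by
        rw [← hyz']; abel
      rw [hz', sub_smul]
      abel
    have hry : r y = 0 := hry
    have hrz : r z = 0 := hrz
    have h1 := (hu m).1
    have h2 := (hu n).2
    have := c.time_unique hz (s := c.height / (n + 1) - c.height / (m + 1))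
      (by rw [abs_le]; constructor <;> linarith) (by rw [hzy, hry])
    have h0 := c.time_unique hz (s := 0) (by simpa using hh.le) (by simpa using hrz)
    linarith
  refine Measure.addHaar_eq_zero_of_disjoint_translates volume
    (fun n : ℕ => -((c.height / (n + 1)) • c.dir)) ?_ ?_
    (measurableSet_ball.inter (measurableSet_eq_fun hr.continuous.measurable measurable_const))
  · refine (Metric.isBounded_closedBall (x := (0 : E d)) (r := c.height * ‖c.dir‖)).subset ?_
    rintro _ ⟨n, rfl⟩
    rw [mem_closedBall_zero_iff, norm_neg, norm_smul, Real.norm_of_nonneg (hu n).2.le]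
    exact mul_le_mul_of_nonneg_right (hu n).1 (norm_nonneg _)
  · intro m n hmn
    rcases lt_or_gt_of_ne hmn with h | h
    · exact hdisj m n h
    · exact (hdisj n m h).symm

end BoundaryChart

/-! ### Divergence theorem on domains and on tori. -/

section Divergence

open Filter Topology

variable {d : ℕ}

theorem integral_fderiv_eq_zero {g : E d → ℝ} (hg : ContDiff ℝ ∞ g) (hc : HasCompactSupport g)
    (v : E d) : ∫ x, fderiv ℝ g x v = 0 := by
  have hg' : Continuous fun x => fderiv ℝ g x v :=
    (hg.continuous_fderiv (by simp)).clm_apply continuous_const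
  have hc' : HasCompactSupport fun x => fderiv ℝ g x v := hc.fderiv_apply ℝ v
  have := integral_mul_fderiv_eq_neg_fderiv_mul_of_integrable (μ := (volume : Measure (E d)))
    (f := fun _ => (1 : ℝ)) (g := g) (v := v) (by simp)
    (by simpa using hg'.integrable_of_hasCompactSupport hc')
    (by simpa using hg.continuous.integrable_of_hasCompactSupport hc)
    (fun x _ => by fun_prop) (fun x _ => (hg.differentiable (by simp)).differentiableAt)
  simpa using this

theorem ev_dx_of_hasFDerivAt {Ω : SampleSpace d} {f : SmoothFn Ω} {F : E d → ℝ}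
    (hf : ∀ x ∈ Ω.carrier, ev f x = F x) {x : E d} (hx : x ∈ Ω.carrier) {l : E d →L[ℝ] ℝ}
    (h : HasFDerivAt F l x) (i : Fin d) : ev (dx i f) x = l (EuclideanSpace.single i 1) := by
  rw [dx_apply]
  exact ev_grad_of_hasFDerivWithinAt hx (h.hasFDerivWithinAt.congr hf (hf x hx)) i

/-- A compact connected domain `{r ≤ 0}` with smooth boundary. -/
structure Domain (d : ℕ) where
  r : E d → ℝ
  smooth : ContDiff ℝ ∞ r
  regular : ∀ x, r x = 0 → fderiv ℝ r x ≠ 0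
  compact : IsCompact {x | r x ≤ 0}
  connected : IsConnected {x | r x ≤ 0}

/-- The domain with the Neumann boundary condition. -/
abbrev Domain.space (D : Domain d) : SampleSpace d :=
  SampleSpace.neumann D.r D.smooth D.regular D.compact D.connected

variable (D : Domain d)

theorem contDiff_of_eq_zero_near_boundary {F : E d → ℝ} (hF : ContDiffOn ℝ ∞ F {x | D.r x < 0})
    {δ : ℝ} (hδ : 0 < δ) (h0 : ∀ x, -δ < D.r x → F x = 0) : ContDiff ℝ ∞ F := by
  rw [contDiff_iff_contDiffAt]
  intro x
  by_cases hx : D.r x < 0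
  · exact hF.contDiffAt ((isOpen_lt D.smooth.continuous continuous_const).mem_nhds hx)
  · have : F =ᶠ[𝓝 x] fun _ => 0 := by
      filter_upwards [(isOpen_lt continuous_const D.smooth.continuous).mem_nhds
        (show -δ < D.r x by linarith [not_lt.1 hx])] with y hy using h0 y hy
    exact contDiffAt_const.congr_of_eventuallyEq this

theorem contDiff_ev_of_eq_zero_near_boundary (f : SmoothFn D.space) {δ : ℝ} (hδ : 0 < δ)
    (h0 : ∀ x ∈ D.space.carrier, -δ < D.r x → ev f x = 0) : ContDiff ℝ ∞ (ev f) := by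
  refine contDiff_of_eq_zero_near_boundary D
    ((contDiffOn_ev f).mono fun x (hx : D.r x < 0) => hx.le) hδ fun x hx => ?_
  by_cases hxc : x ∈ D.space.carrier
  · exact h0 x hxc hx
  · exact ev_of_notMem f hxc

theorem hasCompactSupport_ev (f : SmoothFn D.space) : HasCompactSupport (ev f) :=
  HasCompactSupport.intro D.compact fun _ hx => ev_of_notMem f hx

/-- The extension by zero is smooth with compact support in `ℝ^d`, where the integral of a
derivative vanishes. -/
theorem intS_dx_of_eq_zero_near_boundary (f : SmoothFn D.space) {δ : ℝ} (hδ : 0 < δ)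
    (h0 : ∀ x ∈ D.space.carrier, -δ < D.r x → ev f x = 0) (i : Fin d) : intS (dx i f) = 0 := by
  have hs := contDiff_ev_of_eq_zero_near_boundary D f hδ h0
  have h1 := integral_fderiv_eq_zero hs (hasCompactSupport_ev D f)
    (EuclideanSpace.single i 1)
  rw [← setIntegral_eq_integral_of_forall_compl_eq_zero (s := {x | D.r x ≤ 0})] at h1
  · rw [← h1]
    exact integral_congr_carrier D.space fun x hx => ev_dx_of_hasFDerivAt (fun _ _ => rfl) hx
      (hs.differentiable (by simp)).differentiableAt.hasFDerivAt i
  · intro x hx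
    have hx : 0 < D.r x := not_le.1 hx
    have : ev f =ᶠ[𝓝 x] fun _ => 0 := by
      filter_upwards [(isOpen_lt continuous_const D.smooth.continuous).mem_nhds hx] with y hy
      exact ev_of_notMem f (not_le.2 hy)
    rw [this.fderiv_eq]
    simp

/-- A smooth function that vanishes on the boundary is dominated by the defining function. -/
theorem exists_abs_le_of_eq_zero_on_boundary (u : SmoothFn D.space)
    (hu : ∀ x, D.r x = 0 → ev u x = 0) : ∃ C, 0 ≤ C ∧ ∀ x ∈ D.space.carrier, |ev u x| ≤ C * |D.r x| := by
  have hD : ContinuousOn (fderivWithin ℝ (ev u) D.space.carrier) D.space.carrier :=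
    ((contDiffOn_ev u).fderivWithin D.space.uniqueDiffOn_carrier (m := ∞) (by simp)).continuousOn
  obtain ⟨M, hM⟩ := (show IsCompact D.space.carrier from D.compact).exists_bound_of_continuousOn hD
  -- Sets with such a bound are stable under unions, so compactness reduces the claim to a
  -- neighbourhood of each point.
  have key : ∃ C, 0 ≤ C ∧ ∀ x ∈ D.space.carrier ∩ D.space.carrier, |ev u x| ≤ C * |D.r x| := by
    refine (show IsCompact D.space.carrier from D.compact).induction_on
      (p := fun s => ∃ C, 0 ≤ C ∧ ∀ x ∈ s ∩ D.space.carrier, |ev u x| ≤ C * |D.r x|) ?_ ?_ ?_ ?_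
    · exact ⟨0, le_rfl, by simp⟩
    · rintro s t hst ⟨C, hC, h⟩
      exact ⟨C, hC, fun x hx => h x ⟨hst hx.1, hx.2⟩⟩
    · rintro s t ⟨C, hC, h⟩ ⟨C', hC', h'⟩
      refine ⟨C + C', by positivity, ?_⟩
      rintro x ⟨hx | hx, hx'⟩
      · refine (h x ⟨hx, hx'⟩).trans ?_
        gcongr
        linarith
      · refine (h' x ⟨hx, hx'⟩).trans ?_
        gcongr
        linarith
    · intro x₀ hx₀
      have hx₀' : D.r x₀ ≤ 0 := hx₀
      rcases hx₀'.lt_or_eq with hlt | heq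
      · have h1 : ∀ᶠ x in 𝓝[D.space.carrier] x₀, |ev u x| < |ev u x₀| + 1 :=
          ((contDiffOn_ev u).continuousOn x₀ hx₀).abs.eventually
            (gt_mem_nhds (lt_add_one |ev u x₀|))
        have h2 : ∀ᶠ x in 𝓝[D.space.carrier] x₀, |D.r x₀| / 2 < |D.r x| :=
          (D.smooth.continuous.abs.continuousAt.eventually
            (lt_mem_nhds (half_lt_self (abs_pos.2 hlt.ne)))).filter_mono nhdsWithin_le_nhds
        refine ⟨_, Filter.inter_mem h1 h2, (|ev u x₀| + 1) / (|D.r x₀| / 2), by positivity, ?_⟩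
        rintro x ⟨⟨hx1, hx2⟩, -⟩
        have hp : 0 < |D.r x₀| / 2 := half_pos (abs_pos.2 hlt.ne)
        have hx2 : |D.r x₀| / 2 < |D.r x| := hx2
        have hx1 : |ev u x| < |ev u x₀| + 1 := hx1
        rw [div_mul_eq_mul_div, le_div_iff₀ hp]
        exact mul_le_mul hx1.le hx2.le hp.le (by positivity)
      -- The segment from `x` to its boundary point stays in the domain and has length at most `-r x
      -- * ‖dir‖`. The mean value inequality on it, with `u = 0` at the end, gives the bound.
      · obtain ⟨c⟩ := exists_boundaryChart D.smooth heq (D.regular x₀ heq)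
        refine ⟨Metric.ball x₀ c.radius,
          mem_nhdsWithin_of_mem_nhds (Metric.ball_mem_nhds _ c.radius_pos),
          |M| * ‖c.dir‖, by positivity, ?_⟩
        rintro x ⟨hx, hxc⟩
        have ht0 := c.time_nonneg hx hxc
        have htr := c.time_le hx hxc
        have hseg : segment ℝ (x - c.time x • c.dir) x ⊆ D.space.carrier := by
          intro z hz
          rw [segment_symm, segment_eq_image'] at hz
          obtain ⟨θ, hθ, rfl⟩ := hz
          have : x + θ • (x - c.time x • c.dir - x) = x - (θ * c.time x) • c.dir := by
            rw [sub_sub_cancel_left, smul_neg, smul_smul, sub_eq_add_neg]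
          dsimp only
          rw [this]
          exact c.nonpos_of_le_time hx (mul_nonneg hθ.1 ht0) (mul_le_of_le_one_left ht0 hθ.2)
        have := Convex.norm_image_sub_le_of_norm_hasFDerivWithin_le (f := ev u) (C := |M|)
          (f' := fderivWithin ℝ (ev u) D.space.carrier)
          (fun z hz => ((differentiableWithinAt_ev u (hseg hz)).hasFDerivWithinAt).mono hseg)
          (fun z hz => (hM z (hseg hz)).trans (le_abs_self M))
          (convex_segment _ _) (left_mem_segment ℝ _ _) (right_mem_segment ℝ _ _)
        rw [hu _ (c.r_time x hx), sub_zero, Real.norm_eq_abs, sub_sub_cancel, norm_smul,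
          Real.norm_of_nonneg ht0] at this
        have hxc' : D.r x ≤ 0 := hxc
        rw [abs_of_nonpos hxc']
        calc |ev u x| ≤ |M| * (c.time x * ‖c.dir‖) := this
          _ ≤ |M| * (-D.r x * ‖c.dir‖) := by gcongr
          _ = _ := by ring
  simpa only [inter_self] using key

/-- The function that is `1` where `D.r ≤ -2 δ` and `0` where `D.r ≥ -δ`. -/
def collarCutoff (δ : ℝ) : SmoothFn D.space :=
  mkFn (fun x => Real.smoothTransition (-D.r x / δ - 1))
    (Real.smoothTransition.contDiff.comp ((D.smooth.neg.div_const δ).sub contDiff_const)).contDiffOn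
    trivial

theorem ev_collarCutoff (δ : ℝ) {x : E d} (hx : x ∈ D.space.carrier) :
    ev (collarCutoff D δ) x = Real.smoothTransition (-D.r x / δ - 1) := ev_mkFn _ _ hx

theorem ev_dx_collarCutoff (δ : ℝ) (i : Fin d) {x : E d} (hx : x ∈ D.space.carrier) :
    ev (dx i (collarCutoff D δ)) x =
      -(deriv Real.smoothTransition (-D.r x / δ - 1) / δ) *
        fderiv ℝ D.r x (EuclideanSpace.single i 1) := by
  have hT : HasDerivAt Real.smoothTransition (deriv Real.smoothTransition (-D.r x / δ - 1))
      (-D.r x / δ - 1) :=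
    ((Real.smoothTransition.contDiff (n := 1)).differentiable
      (by simp)).differentiableAt.hasDerivAt
  have hd : HasFDerivAt D.r (fderiv ℝ D.r x) x :=
    (D.smooth.differentiable (by simp)).differentiableAt.hasFDerivAt
  have h2 : HasFDerivAt (fun x => -D.r x / δ - 1) (δ⁻¹ • -fderiv ℝ D.r x) x := by
    simpa only [div_eq_inv_mul] using (hd.fun_neg.const_mul δ⁻¹).sub_const 1
  have := hT.comp_hasFDerivAt x h2
  rw [ev_dx_of_hasFDerivAt (fun y hy => ev_collarCutoff D δ hy) hx this]
  simp
  ring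

theorem deriv_smoothTransition_eq_zero {s : ℝ} (hs : s < 0 ∨ 1 < s) :
    deriv Real.smoothTransition s = 0 := by
  rcases hs with hs | hs
  · have : Real.smoothTransition =ᶠ[𝓝 s] fun _ => 0 := by
      filter_upwards [gt_mem_nhds hs] with y hy using Real.smoothTransition.zero_of_nonpos hy.le
    rw [this.deriv_eq]; simp
  · have : Real.smoothTransition =ᶠ[𝓝 s] fun _ => 1 := by
      filter_upwards [lt_mem_nhds hs] with y hy using Real.smoothTransition.one_of_one_le hy.le
    rw [this.deriv_eq]; simp

theorem exists_deriv_smoothTransition_bound : ∃ M, 0 ≤ M ∧ ∀ s,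
    |deriv Real.smoothTransition s| ≤ M := by
  have hcont : Continuous (deriv Real.smoothTransition) :=
    (Real.smoothTransition.contDiff (n := 1)).continuous_deriv (by simp)
  obtain ⟨M, hM⟩ := hcont.bounded_above_of_compact_support
    (HasCompactSupport.intro (isCompact_Icc (a := (0 : ℝ)) (b := 1)) fun s hs => by
      refine deriv_smoothTransition_eq_zero ?_
      by_contra! h
      exact hs ⟨h.1, h.2⟩)
  exact ⟨M, (norm_nonneg _).trans (hM 0), hM⟩

/-- The components of `∇ r`, which is normal to the boundary. -/
def normalFn (i : Fin d) : SmoothFn D.space :=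
  mkFn (fun x => fderiv ℝ D.r x (EuclideanSpace.single i 1))
    ((D.smooth.fderiv_right (m := ∞) le_rfl).clm_apply contDiff_const).contDiffOn trivial

theorem ev_normalFn (i : Fin d) {x : E d} (hx : x ∈ D.space.carrier) :
    ev (normalFn D i) x = fderiv ℝ D.r x (EuclideanSpace.single i 1) := ev_mkFn _ _ hx

/-- No surface measure is needed. With cutoffs `χ n` the field `χ n * m` has integrated divergence
zero, so `∫ χ n div m = -∫ ∇(χ n)·m`. The integrand on the right is of size `|m·∇r| / δ n` on a
collar of width comparable to `δ n`. The boundary condition gives `|m·∇r| ≤ C |r|`, so it stays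
bounded while the collar shrinks, and dominated convergence concludes. -/
theorem intS_divS_neumann (m : SmoothVec D.space) (hm : D.space.NoFlux fun i => ev (m i)) :
    intS (divS m) = 0 := by
  set u : SmoothFn D.space := ∑ i, m i * normalFn D i with hu
  have hux : ∀ x ∈ D.space.carrier, ev u x =
      ∑ i, ev (m i) x * fderiv ℝ D.r x (EuclideanSpace.single i 1) := by
    intro x hx
    rw [hu, ev_sum]
    exact Finset.sum_congr rfl fun i _ => by rw [ev_mul, ev_normalFn D i hx]
  obtain ⟨C, hC, huC⟩ := exists_abs_le_of_eq_zero_on_boundary D u fun x hx => by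
    rw [hux x (show D.r x ≤ 0 from hx.le)]; exact hm x hx
  obtain ⟨M, hM0, hM⟩ := exists_deriv_smoothTransition_bound
  set δ : ℕ → ℝ := fun n => 1 / ((n : ℝ) + 1) with hδ
  have hδ0 : ∀ n, 0 < δ n := fun n => Nat.one_div_pos_of_nat
  have hδt : Tendsto δ atTop (𝓝 0) := tendsto_one_div_add_atTop_nhds_zero_nat
  set χ : ℕ → SmoothFn D.space := fun n => collarCutoff D (δ n) with hχ
  set T : ℕ → SmoothFn D.space := fun n => ∑ i, dx i (χ n) * m i with hT
  have hTx : ∀ n, ∀ x ∈ D.space.carrier, ev (T n) x =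
      -(deriv Real.smoothTransition (-D.r x / δ n - 1) / δ n) * ev u x := by
    intro n x hx
    rw [hT, ev_sum, hux x hx, Finset.mul_sum]
    refine Finset.sum_congr rfl fun i _ => ?_
    rw [ev_mul, ev_dx_collarCutoff D _ _ hx]
    ring
  have hid : ∀ n, intS (χ n * divS m) = -intS (T n) := by
    intro n
    have h1 : intS (divS fun i => χ n * m i) = 0 := by
      rw [divS_apply, map_sum]
      refine Finset.sum_eq_zero fun i _ => ?_
      refine intS_dx_of_eq_zero_near_boundary D _ (hδ0 n) (fun x hx hxr => ?_) i
      rw [ev_mul, ev_collarCutoff D _ hx, Real.smoothTransition.zero_of_nonpos,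
        zero_mul]
      rw [sub_nonpos, div_le_one (hδ0 n)]
      linarith
    have h2 : divS (fun i => χ n * m i) = χ n * divS m + T n := by
      simp only [divS_apply, dx_mul, Finset.sum_add_distrib, Finset.mul_sum, hT]
    rw [h2, map_add] at h1
    linarith
  -- The boundary is null, so pointwise limits are needed only at interior points, which leave the
  -- collar eventually.
  have hneg : ∀ᵐ x ∂(volume.restrict D.space.cell), D.r x < 0 := by
    have h0 : ∀ᵐ x : E d, D.r x ≠ 0 := by
      have := volume_zeroSet D.smooth D.regular
      rw [measure_eq_zero_iff_ae_notMem] at this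
      exact this
    filter_upwards [ae_restrict_mem D.space.measurableSet_cell, ae_restrict_of_ae h0] with x hx hx0
    exact lt_of_le_of_ne hx hx0
  have hlim1 : Tendsto (fun n => intS (χ n * divS m)) atTop (𝓝 (intS (divS m))) := by
    refine tendsto_integral_of_dominated_convergence (fun x => |ev (divS m) x|)
      (fun n => (integrable_ev _).1) (integrable_ev _).abs (fun n => ?_) ?_
    · filter_upwards [ae_restrict_mem D.space.measurableSet_cell] with x hx
      rw [ev_mul, ev_collarCutoff D _ hx, norm_mul, Real.norm_eq_abs,
        Real.norm_eq_abs, abs_of_nonneg (Real.smoothTransition.nonneg _)]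
      exact mul_le_of_le_one_left (abs_nonneg _) (Real.smoothTransition.le_one _)
    · filter_upwards [hneg] with x hx
      refine tendsto_const_nhds.congr' ?_
      have hev : ∀ᶠ n in atTop, δ n < -D.r x / 2 := hδt.eventually (gt_mem_nhds (by linarith))
      filter_upwards [hev] with n hn
      rw [ev_mul, ev_collarCutoff D _ (show D.r x ≤ 0 from hx.le),
        Real.smoothTransition.one_of_one_le, one_mul]
      rw [le_sub_iff_add_le, le_div_iff₀ (hδ0 n)]
      linarith
  have hlim2 : Tendsto (fun n => intS (T n)) atTop (𝓝 0) := by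
    have : Tendsto (fun n => intS (T n)) atTop (𝓝 (∫ _, (0 : ℝ) ∂(volume.restrict D.space.cell))) := by
      refine tendsto_integral_of_dominated_convergence (fun _ => M * (2 * C))
        (fun n => (integrable_ev _).1) (integrable_const _) (fun n => ?_) ?_
      · filter_upwards [ae_restrict_mem D.space.measurableSet_cell] with x hx
        rw [hTx n x hx, neg_mul, norm_neg, Real.norm_eq_abs, abs_mul, abs_div,
          abs_of_pos (hδ0 n)]
        have hrx : D.r x ≤ 0 := hx
        -- The gradient of the cutoff lives where `-r ≤ 2 * δ n`; there `|u| ≤ 2 * C * δ n` cancels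
        -- the factor `1 / δ n`.
        by_cases h : -D.r x ≤ 2 * δ n
        · have h1 := huC x hx
          rw [abs_of_nonpos hrx] at h1
          have h2 : |ev u x| ≤ 2 * C * δ n := by nlinarith
          calc |deriv Real.smoothTransition (-D.r x / δ n - 1)| / δ n * |ev u x|
              ≤ M / δ n * (2 * C * δ n) := by
                have := hδ0 n
                gcongr
                exact hM _
            _ = M * (2 * C) := by have := (hδ0 n).ne'; field_simp
        · rw [deriv_smoothTransition_eq_zero (Or.inr _)]
          · simp; positivity
          · rw [lt_sub_iff_add_lt, lt_div_iff₀ (hδ0 n)]; linarith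
      · filter_upwards [hneg, ae_restrict_mem D.space.measurableSet_cell] with x hx hxc
        refine tendsto_const_nhds.congr' ?_
        have hev : ∀ᶠ n in atTop, δ n < -D.r x / 2 := hδt.eventually (gt_mem_nhds (by linarith))
        filter_upwards [hev] with n hn
        rw [hTx n x hxc, deriv_smoothTransition_eq_zero (Or.inr _)]
        · simp
        · rw [lt_sub_iff_add_lt, lt_div_iff₀ (hδ0 n)]; linarith
    simpa using this
  have := tendsto_nhds_unique hlim1 (by simpa only [hid, neg_zero] using hlim2.neg)
  exact this

/-- The divergence theorem on a box, applied to the field whose only component is `f` in the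
direction `i`: the integrals over opposite faces cancel by periodicity. -/
theorem intS_dx_periodic {L : Fin d → ℝ} (hL : ∀ i, 0 < L i)
    (f : SmoothFn (SampleSpace.periodic L hL)) (i : Fin d) : intS (dx i f) = 0 := by
  rcases d with _ | n
  · exact i.elim0
  have hf : ContDiff ℝ ∞ (ev f) := contDiffOn_univ.1 (contDiffOn_ev f)
  set φ := (EuclideanSpace.equiv (Fin (n + 1)) ℝ).symm with hφ
  set F : (Fin (n + 1) → ℝ) → ℝ := fun y => ev f (φ y) with hF
  have hFd : ∀ y, HasFDerivAt F ((fderiv ℝ (ev f) (φ y)).comp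
      (φ : (Fin (n + 1) → ℝ) →L[ℝ] E (n + 1))) y := fun y =>
    (hf.differentiable (by simp)).differentiableAt.hasFDerivAt.comp y φ.hasFDerivAt
  have hcont : Continuous fun y => fderiv ℝ (ev f) (φ y) (EuclideanSpace.single i 1) :=
    ((hf.continuous_fderiv (by simp)).comp φ.continuous).clm_apply continuous_const
  have hsum : ∀ y, ∑ j, (if j = i then ((fderiv ℝ (ev f) (φ y)).comp
      (φ : (Fin (n + 1) → ℝ) →L[ℝ] E (n + 1))) else 0) (Pi.single j 1) =
      fderiv ℝ (ev f) (φ y) (EuclideanSpace.single i 1) := by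
    intro y
    rw [Finset.sum_eq_single i (fun j _ hj => by simp [hj]) (by simp)]
    simp only [if_true]
    rfl
  have key := integral_divergence_of_hasFDerivAt_off_countable' (0 : Fin (n + 1) → ℝ) L
    (fun j => (hL j).le) (fun j => if j = i then F else 0)
    (fun j y => if j = i then ((fderiv ℝ (ev f) (φ y)).comp
      (φ : (Fin (n + 1) → ℝ) →L[ℝ] E (n + 1))) else 0) ∅ countable_empty
    (fun j => by
      split_ifs
      · exact (hf.continuous.comp φ.continuous).continuousOn
      · exact continuousOn_const)
    (fun y _ j => by
      split_ifs
      · exact hFd y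
      · exact hasFDerivAt_const 0 y)
    (by
      simp only [hsum]
      exact hcont.continuousOn.integrableOn_compact isCompact_Icc)
  simp only [hsum] at key
  have hz : ∀ j : Fin (n + 1),
      ((∫ x in Icc ((0 : Fin (n + 1) → ℝ) ∘ j.succAbove) (L ∘ j.succAbove),
        (if j = i then F else 0) (j.insertNth (L j) x)) -
      ∫ x in Icc ((0 : Fin (n + 1) → ℝ) ∘ j.succAbove) (L ∘ j.succAbove),
        (if j = i then F else 0) (j.insertNth ((0 : Fin (n + 1) → ℝ) j) x)) = 0 := by
    intro j
    rw [sub_eq_zero]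
    congr 1
    ext x
    split_ifs
    · have : (φ (j.insertNth (L j) x) : E (n + 1)) =
          φ (j.insertNth ((0 : Fin (n + 1) → ℝ) j) x) + EuclideanSpace.single j (L j) := by
        ext k
        rcases Fin.eq_self_or_eq_succAbove j k with rfl | ⟨k, rfl⟩
        · simp [hφ]
        · simp [hφ, Fin.succAbove_ne]
      change ev f (φ _) = ev f (φ _)
      rw [this]
      exact isPeriodic_ev f j _
    · rfl
  rw [Finset.sum_eq_zero fun j _ => hz j] at key
  rw [← key, intS_apply]
  have hmp := (EuclideanSpace.volume_preserving_symm_measurableEquiv_toLp (Fin (n + 1))).symm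
  have hcell : (MeasurableEquiv.toLp 2 (Fin (n + 1) → ℝ)) ⁻¹'
      (SampleSpace.periodic L hL).cell = univ.pi fun j => Ico ((0 : Fin (n + 1) → ℝ) j) (L j) := by
    ext y
    simp [SampleSpace.cell]
  have h1 := hmp.setIntegral_preimage_emb (MeasurableEquiv.measurableEmbedding _)
    (ev (dx i f)) (SampleSpace.periodic L hL).cell
  rw [integral, ← h1]
  -- The cell is half-open while the divergence theorem uses the closed box; they differ by a null
  -- set.
  have hae : (univ.pi fun j => Ico ((0 : Fin (n + 1) → ℝ) j) (L j)) =ᵐ[volume] Icc 0 L :=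
    Measure.univ_pi_Ico_ae_eq_Icc
  change ∫ y in (MeasurableEquiv.toLp 2 (Fin (n + 1) → ℝ)) ⁻¹' _, _ = _
  rw [hcell, setIntegral_congr_set hae]
  refine setIntegral_congr_fun measurableSet_Icc fun y _ => ?_
  exact ev_dx_of_hasFDerivAt (fun _ _ => rfl) (mem_univ _)
    (hf.differentiable (by simp)).differentiableAt.hasFDerivAt i

end Divergence

/-! ### Integration by parts without boundary term. -/

section DivergenceTheorem

variable {d : ℕ} {Ω : SampleSpace d}

/-- The divergence theorem for fluxes that satisfy the boundary condition. -/
theorem intS_divS (m : SmoothVec Ω) (hm : Ω.NoFlux fun i => ev (m i)) : intS (divS m) = 0 := by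
  cases Ω with
  | periodic L hL =>
    rw [divS_apply, map_sum]
    exact Finset.sum_eq_zero fun i _ => intS_dx_periodic hL _ i
  | neumann r hr hreg hc hconn => exact intS_divS_neumann ⟨r, hr, hreg, hc, hconn⟩ m hm

theorem SampleSpace.NoFlux.mul {m : SmoothVec Ω} (hm : Ω.NoFlux fun i => ev (m i))
    (f : SmoothFn Ω) : Ω.NoFlux fun i => ev (f * m i) := by
  cases Ω with
  | periodic => trivial
  | neumann r hr hreg hc hconn =>
    intro x hx
    simp only [ev_mul, mul_assoc, ← Finset.mul_sum]
    rw [hm x hx, mul_zero]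

theorem SampleSpace.NoFlux.add {m n : SmoothVec Ω} (hm : Ω.NoFlux fun i => ev (m i))
    (hn : Ω.NoFlux fun i => ev (n i)) : Ω.NoFlux fun i => ev (m i + n i) := by
  cases Ω with
  | periodic => trivial
  | neumann r hr hreg hc hconn =>
    intro x hx
    simp only [ev_add, add_mul, Finset.sum_add_distrib]
    rw [hm x hx, hn x hx, add_zero]

theorem SampleSpace.NoFlux.smul {m : SmoothVec Ω} (hm : Ω.NoFlux fun i => ev (m i))
    (c : ℝ) : Ω.NoFlux fun i => ev (c • m i) := by
  cases Ω with
  | periodic => trivial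
  | neumann r hr hreg hc hconn =>
    intro x hx
    simp only [ev_smul, mul_assoc, ← Finset.mul_sum]
    rw [hm x hx, mul_zero]

/-- Integration by parts. -/
theorem intS_mul_divS (f : SmoothFn Ω) (m : SmoothVec Ω) (hm : Ω.NoFlux fun i => ev (m i)) :
    intS (f * divS m) = -intS (∑ i, m i * dx i f) := by
  have h := intS_divS (fun i => f * m i) (hm.mul f)
  have h2 : divS (fun i => f * m i) = f * divS m + ∑ i, m i * dx i f := by
    simp only [divS_apply, dx_mul, Finset.sum_add_distrib, Finset.mul_sum, mul_comm (dx _ _)]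
  rw [h2, map_add] at h
  linarith

end DivergenceTheorem

/-! ### A weight that turns fields into admissible ones. -/

section Weight

open Filter Topology

variable {d : ℕ}

/-- The defining function as an element of `C^∞(Ω)`. -/
def defFn (D : Domain d) : SmoothFn D.space := mkFn D.r D.smooth.contDiffOn trivial

theorem ev_defFn (D : Domain d) {x : E d} (hx : x ∈ D.space.carrier) : ev (defFn D) x = D.r x :=
  ev_mkFn _ _ hx

/-- A nonnegative function that is positive inside of `Ω` and vanishes to second order on the
boundary. -/
def weight : (Ω : SampleSpace d) → SmoothFn Ω
  | .periodic _ _ => 1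
  | .neumann r hr hreg hc hconn => defFn ⟨r, hr, hreg, hc, hconn⟩ * defFn ⟨r, hr, hreg, hc, hconn⟩

variable {Ω : SampleSpace d}

theorem weight_nonneg {x : E d} (hx : x ∈ Ω.carrier) : 0 ≤ ev (weight Ω) x := by
  cases Ω with
  | periodic L hL => rw [weight, ev_one hx]; exact zero_le_one
  | neumann => exact mul_self_nonneg _

theorem noFlux_weight_mul (m : SmoothVec Ω) : Ω.NoFlux fun i => ev (weight Ω * m i) := by
  cases Ω with
  | periodic => trivial
  | neumann r hr hreg hc hconn =>
    intro x hx
    refine Finset.sum_eq_zero fun i _ => ?_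
    have : ev (defFn ⟨r, hr, hreg, hc, hconn⟩) x = 0 :=
      (ev_defFn ⟨r, hr, hreg, hc, hconn⟩ (show r x ≤ 0 from hx.le)).trans hx
    simp [weight, this]

/-- On a domain the weight is the square of `r`, so it vanishes on the boundary together with its
first derivatives. This is why a square is taken. -/
theorem noFlux_sum_dx_weight_mul (A : Fin d → Fin d → SmoothFn Ω) :
    Ω.NoFlux fun i => ev (∑ j, dx j (weight Ω * A i j)) := by
  cases Ω with
  | periodic => trivial
  | neumann r hr hreg hc hconn =>
    intro x hx
    refine Finset.sum_eq_zero fun i _ => ?_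
    have : ev (defFn ⟨r, hr, hreg, hc, hconn⟩) x = 0 :=
      (ev_defFn ⟨r, hr, hreg, hc, hconn⟩ (show r x ≤ 0 from hx.le)).trans hx
    simp [weight, dx_mul, this]

/-- The weight is positive off the boundary, and the boundary is a null set, so testing with the
weight loses nothing. -/
theorem eq_zero_of_intS_weight_mul {f : SmoothFn Ω} (h : intS (weight Ω * (f * f)) = 0) :
    f = 0 := by
  cases Ω with
  | periodic L hL =>
    rw [weight, one_mul] at h
    exact eq_zero_of_intS_mul_self h
  | neumann r hr hreg hc hconn =>
    have h0 := eq_zero_of_intS_eq_zero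
      (f := weight (SampleSpace.neumann r hr hreg hc hconn) * (f * f))
      (fun x hx => mul_nonneg (weight_nonneg hx) (mul_self_nonneg _)) h
    refine eq_zero_of_intS_mul_self ?_
    have hz : ∀ x, r x < 0 → ev (f * f) x = 0 := by
      intro x hx
      have hxc : x ∈ (SampleSpace.neumann r hr hreg hc hconn).carrier := hx.le
      have h1 : ev (weight (SampleSpace.neumann r hr hreg hc hconn) * (f * f)) x = 0 := by
        rw [h0, ev_zero]
      rw [ev_mul, mul_eq_zero] at h1
      refine h1.resolve_left ?_
      have h2 := ev_defFn ⟨r, hr, hreg, hc, hconn⟩ hxc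
      simp only [weight, ev_mul, h2]
      exact mul_ne_zero hx.ne hx.ne
    have hae : ∀ᵐ x ∂(volume.restrict (SampleSpace.neumann r hr hreg hc hconn).cell),
        ev (f * f) x = 0 := by
      have h0 : ∀ᵐ x : E d, r x ≠ 0 := by
        have := volume_zeroSet hr hreg
        rw [measure_eq_zero_iff_ae_notMem] at this
        exact this
      filter_upwards [ae_restrict_mem (SampleSpace.measurableSet_cell _),
        ae_restrict_of_ae h0] with x hx hx0
      exact hz x (lt_of_le_of_ne hx hx0)
    exact integral_eq_zero_of_ae hae

end Weight

/-! ### First variation of the action. -/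

section FirstVariation

open Filter Topology

variable {d : ℕ} {Ω : SampleSpace d}

theorem uniqueDiffOn_unitInterval : UniqueDiffOn ℝ (Icc (0 : ℝ) 1) :=
  uniqueDiffOn_Icc (zero_lt_one' ℝ)

theorem fluxEnergy_eq (K : OperatorField Ω) (m : SmoothVec Ω) (ρ : SmoothFn Ω) :
    fluxEnergy K m ρ = intS (∑ i, m i * K ρ (m i)) :=
  integral_congr_carrier Ω fun x _ => by simp

theorem dualEnergy_eq (K : OperatorField Ω) (v : SmoothVec Ω) (ρ : SmoothFn Ω) :
    dualEnergy K v ρ = intS (∑ i, v i * (K ρ).symm (v i)) :=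
  integral_congr_carrier Ω fun x _ => by simp [flux]

/-- The minimum over `T` and the compact closed cell is attained; periodicity carries the bound to
the whole carrier. -/
theorem exists_lower_bound {T : Set ℝ} (hT : IsCompact T) {ρ : ℝ → SmoothFn Ω}
    (hρ : SmoothFamily Ω T ρ) (hpos : ∀ t ∈ T, ∀ x ∈ Ω.carrier, 0 < ev (ρ t) x) :
    ∃ c > 0, ∀ t ∈ T, ∀ x ∈ Ω.carrier, c ≤ ev (ρ t) x := by
  have hc : ContinuousOn (fun p : ℝ × E d => ev (ρ p.1) p.2) (T ×ˢ Ω.closedCell) :=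
    (ContDiffOn.continuousOn hρ).mono (prod_mono Subset.rfl Ω.closedCell_subset_carrier)
  rcases (T ×ˢ Ω.closedCell).eq_empty_or_nonempty with he | hne
  · refine ⟨1, one_pos, fun t ht x hx => ?_⟩
    obtain ⟨y, hy, -⟩ := Ω.exists_mem_cell hx
    have : (t, y) ∈ T ×ˢ Ω.closedCell := ⟨ht, Ω.cell_subset_closedCell hy⟩
    rw [he] at this
    exact this.elim
  · obtain ⟨⟨t₀, x₀⟩, h₀, hmin⟩ := (hT.prod Ω.isCompact_closedCell).exists_isMinOn hne hc
    refine ⟨ev (ρ t₀) x₀, hpos t₀ h₀.1 x₀ (Ω.closedCell_subset_carrier h₀.2), fun t ht x hx => ?_⟩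
    obtain ⟨y, hy, hxy⟩ := Ω.exists_mem_cell hx
    rw [hxy _ (isPeriodic_ev _)]
    exact hmin (show (t, y) ∈ T ×ˢ Ω.closedCell from ⟨ht, Ω.cell_subset_closedCell hy⟩)

theorem exists_upper_bound {T : Set ℝ} (hT : IsCompact T) {η : ℝ → SmoothFn Ω}
    (hη : SmoothFamily Ω T η) :
    ∃ M, 0 ≤ M ∧ ∀ t ∈ T, ∀ x ∈ Ω.carrier, |ev (η t) x| ≤ M := by
  have hc : ContinuousOn (fun p : ℝ × E d => ev (η p.1) p.2) (T ×ˢ Ω.closedCell) :=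
    (ContDiffOn.continuousOn hη).mono (prod_mono Subset.rfl Ω.closedCell_subset_carrier)
  obtain ⟨M, hM⟩ := (hT.prod Ω.isCompact_closedCell).exists_bound_of_continuousOn hc
  refine ⟨|M|, abs_nonneg M, fun t ht x hx => ?_⟩
  obtain ⟨y, hy, hxy⟩ := Ω.exists_mem_cell hx
  rw [hxy _ (isPeriodic_ev _)]
  exact (hM (t, y) ⟨ht, Ω.cell_subset_closedCell hy⟩).trans (le_abs_self M)

/-- Small perturbations of a smooth curve of densities in tangent directions are densities. -/
theorem exists_isDensity_add_smul {T : Set ℝ} (hT : IsCompact T) {ρ η : ℝ → SmoothFn Ω}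
    (hρ : SmoothFamily Ω T ρ) (hη : SmoothFamily Ω T η) (hd : ∀ t ∈ T, IsDensity Ω (ρ t))
    (h0 : ∀ t ∈ T, IsTangent Ω (η t)) :
    ∃ δ > (0 : ℝ), ∀ ε ∈ Icc (-δ) δ, ∀ t ∈ T, IsDensity Ω (ρ t + ε • η t) := by
  obtain ⟨c, hc, hcρ⟩ := exists_lower_bound hT hρ fun t ht => (hd t ht).pos
  obtain ⟨M, hM, hMη⟩ := exists_upper_bound hT hη
  refine ⟨c / (M + 1), by positivity, fun ε hε t ht => ⟨fun x hx => ?_, ?_⟩⟩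
  · have h1 : |ε * ev (η t) x| < c := by
      rw [abs_mul]
      calc |ε| * |ev (η t) x| ≤ c / (M + 1) * M := by
            gcongr
            · exact abs_le.2 hε
            · exact hMη t ht x hx
        _ < c := by
            rw [div_mul_eq_mul_div, div_lt_iff₀ (by positivity)]
            nlinarith
    have := hcρ t ht x hx
    rw [ev_add, ev_smul]
    linarith [(abs_lt.1 h1).1]
  · change intS (ρ t + ε • η t) = 1
    rw [map_add, map_smul, (isTangent_iff _).1 (h0 t ht), smul_zero, add_zero]
    exact (hd t ht).mass

theorem contDiffOn_comp_family_fst {ρ : ℝ → SmoothFn Ω} {S T : Set ℝ} (h : SmoothFamily Ω S ρ) :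
    SmoothFamily Ω (S ×ˢ T) fun p => ρ p.1 :=
  h.comp contDiffOn_fst fun _ hp => hp.1

theorem contDiffOn_comp_family_snd {ρ : ℝ → SmoothFn Ω} {S T : Set ℝ} (h : SmoothFamily Ω S ρ) :
    SmoothFamily Ω (T ×ˢ S) fun p => ρ p.2 :=
  h.comp contDiffOn_snd fun _ hp => hp.2

variable {H : SmoothFn Ω → ℝ} {K : OperatorField Ω}

theorem IsL2Hessian.smooth_curve (hK : IsL2Hessian Ω H K) {a b : ℝ} (hab : a < b)
    {ρ f : ℝ → SmoothFn Ω} (hρ : SmoothFamily Ω (Icc a b) ρ)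
    (hd : ∀ s ∈ Icc a b, IsDensity Ω (ρ s)) (hf : SmoothFamily Ω (Icc a b) f) :
    SmoothFamily Ω (Icc a b) (fun s => K (ρ s) (f s)) ∧
      SmoothFamily Ω (Icc a b) (fun s => (K (ρ s)).symm (f s)) := by
  -- The second parameter is a dummy, later frozen at `0`.
  have h := hK.smooth a b 0 1 hab one_pos (fun p => ρ p.1) (fun p => f p.1)
    (contDiffOn_comp_family_fst hρ) (fun s hs => hd s.1 hs.1) (contDiffOn_comp_family_fst hf)
  have hφ : ContDiffOn ℝ ∞ (fun s : ℝ => (s, (0 : ℝ))) (Icc a b) := by fun_prop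
  have hm : MapsTo (fun s : ℝ => (s, (0 : ℝ))) (Icc a b) (Icc a b ×ˢ Icc 0 1) :=
    fun s hs => ⟨hs, by simp⟩
  exact ⟨h.1.comp hφ hm, h.2.comp hφ hm⟩

theorem IsL2Hessian.symm' (hK : IsL2Hessian Ω H K) {ρ : SmoothFn Ω} (hρ : IsDensity Ω ρ)
    (f g : SmoothFn Ω) : intS (f * K ρ g) = intS (g * K ρ f) := hK.symmetric ρ hρ f g

/-- If two smooth curves both vanish at an interior time, the integral of their product has
derivative zero there. -/
theorem hasDerivAt_intS_mul_of_eq_zero {a b : ℝ → SmoothFn Ω} {δ : ℝ} (hδ : 0 < δ)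
    (ha : SmoothFamily Ω (Icc (-δ) δ) a) (hb : SmoothFamily Ω (Icc (-δ) δ) b)
    (ha0 : a 0 = 0) (hb0 : b 0 = 0) : HasDerivAt (fun ε => intS (a ε * b ε)) 0 0 := by
  have hu : UniqueDiffOn ℝ (Icc (-δ) δ) := uniqueDiffOn_Icc (by linarith)
  have h0 : (0 : ℝ) ∈ Icc (-δ) δ := ⟨by linarith, hδ.le⟩
  have h := (ha.mul hb).hasDerivWithinAt_intS hu (convex_Icc _ _) h0
  have hz : (integral Ω fun x => derivWithin (fun s => ev (a s * b s) x) (Icc (-δ) δ) 0) = 0 := by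
    rw [integral_congr_carrier Ω (G := fun _ => 0)]
    · simp [integral]
    · intro x hx
      have h1 := ((ha.contDiffOn_slice hx).differentiableOn (by simp) 0 h0).hasDerivWithinAt
      have h2 := ((hb.contDiffOn_slice hx).differentiableOn (by simp) 0 h0).hasDerivWithinAt
      have h3 := (h1.mul h2).derivWithin (hu 0 h0)
      rw [ha0, hb0] at h3
      refine Eq.trans ?_ (h3.trans (by simp))
      rfl
  rw [hz] at h
  exact h.hasDerivAt (Icc_mem_nhds (by linarith) hδ)

/-- The derivative of the energy of a flux in the direction of a variation of the flux and the
density. -/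
theorem IsL2Hessian.hasDerivAt_fluxEnergy (hK : IsL2Hessian Ω H K) {ρ σ g : SmoothFn Ω}
    (hρ : IsDensity Ω ρ) (hσ : IsTangent Ω σ) (v w : SmoothVec Ω)
    (hg : HasFirstVariation Ω (dualEnergy K v) ρ g) :
    HasDerivAt (fun ε : ℝ => fluxEnergy K (flux K ρ v + ε • w) (ρ + ε • σ))
      (2 * intS (∑ i, w i * v i) - intS (g * σ)) 0 := by
  obtain ⟨δ, hδ, hdens⟩ := exists_isDensity_add_smul (isCompact_singleton (x := (0 : ℝ)))
    (ρ := fun _ => ρ) (η := fun _ => σ) (smoothFamily_const ρ) (smoothFamily_const σ)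
    (fun _ _ => hρ) (fun _ _ => hσ)
  replace hdens : ∀ ε ∈ Icc (-δ) δ, IsDensity Ω (ρ + ε • σ) := fun ε hε => hdens ε hε 0 rfl
  have hu : UniqueDiffOn ℝ (Icc (-δ) δ) := uniqueDiffOn_Icc (by linarith)
  have hnhds : Icc (-δ) δ ∈ 𝓝 (0 : ℝ) := Icc_mem_nhds (by linarith) hδ
  have h0 : (0 : ℝ) ∈ Icc (-δ) δ := ⟨by linarith, hδ.le⟩
  have hfam : SmoothFamily Ω (Icc (-δ) δ) fun ε : ℝ => ρ + ε • σ :=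
    (smoothFamily_const ρ).add (SmoothFamily.smul contDiffOn_id (smoothFamily_const σ))
  set m := flux K ρ v with hm
  have hop := fun f : SmoothFn Ω =>
    hK.smooth_curve (show -δ < δ by linarith) hfam hdens (smoothFamily_const f)
  have hKm : ∀ i, K ρ (m i) = v i := fun i => (K ρ).apply_symm_apply (v i)
  have hρ0 : ρ + (0 : ℝ) • σ = ρ := by rw [zero_smul, add_zero]
  -- the remainder, quadratic in the variation of the density
  have hR : ∀ i, HasDerivAt (fun ε : ℝ => intS ((K (ρ + ε • σ) (m i) - v i) *
      (m i - (K (ρ + ε • σ)).symm (v i)))) 0 0 := fun i =>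
    hasDerivAt_intS_mul_of_eq_zero hδ ((hop (m i)).1.sub (smoothFamily_const _))
      ((smoothFamily_const _).sub (hop (v i)).2) (by rw [hρ0, hKm, sub_self])
      (by rw [hρ0]; exact sub_self _)
  have hA : ∀ i, DifferentiableAt ℝ (fun ε : ℝ => intS (w i * K (ρ + ε • σ) (m i))) 0 := fun i =>
    ((((smoothFamily_const (w i)).mul (hop (m i)).1).contDiffOn_intS hu
      (convex_Icc _ _).locallyQuasiconvex).differentiableOn (by simp) 0 h0).differentiableAt hnhds
  have hC : ∀ i, DifferentiableAt ℝ (fun ε : ℝ => intS (w i * K (ρ + ε • σ) (w i))) 0 := fun i =>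
    ((((smoothFamily_const (w i)).mul (hop (w i)).1).contDiffOn_intS hu
      (convex_Icc _ _).locallyQuasiconvex).differentiableOn (by simp) 0 h0).differentiableAt hnhds
  have hdual : HasDerivAt (fun ε : ℝ => dualEnergy K v (ρ + ε • σ)) (intS (g * σ)) 0 := hg σ hσ
  -- Write `L = K (ρ + ε σ)` and `v = K ρ m`. Symmetry of `L` gives `∫ m·Lm = ∫ (Lm - v)·(m - L⁻¹v)
  -- + 2 ∫ m·v - ∫ v·L⁻¹v`. Both factors of the first term vanish at `ε = 0`, so the derivative of
  -- `∫ m·Lm` is minus that of the dual energy, which is the only first variation that is given.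
  have hterm : ∀ i, HasDerivAt (fun ε : ℝ =>
      intS ((K (ρ + ε • σ) (m i) - v i) * (m i - (K (ρ + ε • σ)).symm (v i))) +
      2 * intS (m i * v i) + 2 * (ε * intS (w i * K (ρ + ε • σ) (m i))) +
      ε ^ 2 * intS (w i * K (ρ + ε • σ) (w i))) (2 * intS (w i * v i)) 0 := by
    intro i
    have h1 := ((hasDerivAt_id (0 : ℝ)).mul (hA i).hasDerivAt).const_mul 2
    have h2 := ((hasDerivAt_id (0 : ℝ)).pow 2).mul (hC i).hasDerivAt
    refine ((((hR i).add_const (2 * intS (m i * v i))).add h1).add h2).congr_deriv ?_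
    simp only [id, zero_smul, add_zero, hKm, Pi.pow_apply]
    ring
  have hsum := (HasDerivAt.fun_sum fun i (_ : i ∈ Finset.univ) => hterm i).sub hdual
  have hval : ∑ i, 2 * intS (w i * v i) = 2 * intS (∑ i, w i * v i) := by
    rw [map_sum, Finset.mul_sum]
  rw [hval] at hsum
  refine hsum.congr_of_eventuallyEq ?_
  filter_upwards [hnhds] with ε hε
  have hρε := hdens ε hε
  set L := K (ρ + ε • σ) with hL
  have hsymm : ∀ a b : SmoothFn Ω, intS (a * L b) = intS (b * L a) := hK.symm' hρε
  change fluxEnergy K (m + ε • w) (ρ + ε • σ) = _ - dualEnergy K v (ρ + ε • σ)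
  rw [fluxEnergy_eq, dualEnergy_eq, map_sum, map_sum, ← Finset.sum_sub_distrib]
  refine Finset.sum_congr rfl fun i _ => ?_
  have e1 : (m + ε • w) i * L ((m + ε • w) i) =
      m i * L (m i) + ε • (m i * L (w i)) + ε • (w i * L (m i)) +
        ε ^ 2 • (w i * L (w i)) := by
    simp only [Pi.add_apply, Pi.smul_apply, map_add, map_smul, pow_two]
    simp only [Algebra.smul_def]
    rw [map_mul]
    ring
  have e2 : (L (m i) - v i) * (m i - L.symm (v i)) =
      m i * L (m i) - L.symm (v i) * L (m i) - m i * v i + v i * L.symm (v i) := by ring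
  have e3 : intS (L.symm (v i) * L (m i)) = intS (m i * v i) := by
    rw [hsymm, L.apply_symm_apply]
  rw [e1, e2]
  simp only [map_add, map_sub, map_smul, smul_eq_mul, e3, hsymm (m i) (w i)]
  ring

theorem hasDerivAt_intervalIntegral_of_contDiffOn {δ : ℝ} (hδ : 0 < δ) {F : ℝ × ℝ → ℝ}
    (hF : ContDiffOn ℝ ∞ F (Icc (-δ) δ ×ˢ Icc 0 1)) {F' : ℝ → ℝ}
    (h : ∀ t ∈ Icc (0 : ℝ) 1, HasDerivAt (fun ε => F (ε, t)) (F' t) 0) :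
    HasDerivAt (fun ε => ∫ t in (0 : ℝ)..1, F (ε, t)) (∫ t in (0 : ℝ)..1, F' t) 0 := by
  have hu : UniqueDiffOn ℝ (Icc (-δ) δ) := uniqueDiffOn_Icc (by linarith)
  have hu2 := hu.prod uniqueDiffOn_unitInterval
  have h0 : (0 : ℝ) ∈ Icc (-δ) δ := ⟨by linarith, hδ.le⟩
  have hnhds : Icc (-δ) δ ∈ 𝓝 (0 : ℝ) := Icc_mem_nhds (by linarith) hδ
  have hmem : ∀ᵐ t ∂(volume.restrict (Ioc (0 : ℝ) 1)), t ∈ Icc (0 : ℝ) 1 :=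
    (ae_restrict_mem measurableSet_Ioc).mono fun t ht => ⟨ht.1.le, ht.2⟩
  have hD : ContDiffOn ℝ ∞ (fun p => (fderivWithin ℝ F (Icc (-δ) δ ×ˢ Icc 0 1) p).comp
      (ContinuousLinearMap.inl ℝ ℝ ℝ)) (Icc (-δ) δ ×ˢ Icc 0 1) :=
    (hF.fderivWithin hu2 (m := ∞) (by simp)).clm_comp contDiffOn_const
  have hsl : ∀ s ∈ Icc (-δ) δ, ∀ t ∈ Icc (0 : ℝ) 1, HasFDerivWithinAt (fun s => F (s, t))
      ((fderivWithin ℝ F (Icc (-δ) δ ×ˢ Icc 0 1) (s, t)).comp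
        (ContinuousLinearMap.inl ℝ ℝ ℝ)) (Icc (-δ) δ) s := fun s hs t ht =>
    hasFDerivWithinAt_slice_left (hF.differentiableOn (by simp)) hs ht
  have key := ((convex_Icc (-δ) δ).locallyQuasiconvex.hasFDerivWithinAt_integral isCompact_Icc
    hmem hsl hF.continuousOn hD.continuousOn h0).hasDerivWithinAt.hasDerivAt hnhds
  simp only [intervalIntegral.integral_of_le zero_le_one]
  refine key.congr_deriv ?_
  rw [ContinuousLinearMap.integral_apply]
  · refine setIntegral_congr_fun measurableSet_Ioc fun t ht => ?_
    have ht' : t ∈ Icc (0 : ℝ) 1 := ⟨ht.1.le, ht.2⟩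
    exact ((hsl 0 h0 t ht').hasDerivWithinAt.hasDerivAt hnhds).unique (h t ht')
  · exact integrable_of_continuousOn_compact isCompact_Icc hmem
      (hD.continuousOn.comp (by fun_prop) fun t ht => ⟨h0, ht⟩)

/-- The first variation of the action. -/
theorem IsL2Hessian.hasDerivAt_action (hK : IsL2Hessian Ω H K) {ρ η g : ℝ → SmoothFn Ω}
    {v w : ℝ → SmoothVec Ω} (hρ : SmoothFamily Ω (Icc 0 1) ρ)
    (hd : ∀ t ∈ Icc (0 : ℝ) 1, IsDensity Ω (ρ t))
    (hv : ∀ i, SmoothFamily Ω (Icc 0 1) fun t => v t i) (hη : SmoothFamily Ω (Icc 0 1) η)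
    (hη0 : ∀ t ∈ Icc (0 : ℝ) 1, IsTangent Ω (η t))
    (hw : ∀ i, SmoothFamily Ω (Icc 0 1) fun t => w t i)
    (hg : ∀ t ∈ Icc (0 : ℝ) 1, HasFirstVariation Ω (dualEnergy K (v t)) (ρ t) (g t)) :
    HasDerivAt (fun ε : ℝ => ∫ t in (0 : ℝ)..1,
      fluxEnergy K (flux K (ρ t) (v t) + ε • w t) (ρ t + ε • η t))
      (∫ t in (0 : ℝ)..1, (2 * intS (∑ i, w t i * v t i) - intS (g t * η t))) 0 := by
  obtain ⟨δ, hδ, hdens⟩ := exists_isDensity_add_smul isCompact_Icc hρ hη hd hη0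
  refine hasDerivAt_intervalIntegral_of_contDiffOn hδ
    (F := fun p => fluxEnergy K (flux K (ρ p.2) (v p.2) + p.1 • w p.2) (ρ p.2 + p.1 • η p.2)) ?_
    fun t ht => hK.hasDerivAt_fluxEnergy (hd t ht) (hη0 t ht) (v t) (w t) (hg t ht)
  have hu : UniqueDiffOn ℝ (Icc (-δ) δ) := uniqueDiffOn_Icc (by linarith)
  have hfam : ∀ {a b : ℝ → SmoothFn Ω}, SmoothFamily Ω (Icc 0 1) a → SmoothFamily Ω (Icc 0 1) b →
      SmoothFamily Ω (Icc (-δ) δ ×ˢ Icc 0 1) fun p : ℝ × ℝ => a p.2 + p.1 • b p.2 :=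
    fun ha hb => (contDiffOn_comp_family_snd ha).add
      (SmoothFamily.smul contDiffOn_fst (contDiffOn_comp_family_snd hb))
  have hm : ∀ i, SmoothFamily Ω (Icc 0 1) fun t => flux K (ρ t) (v t) i := fun i =>
    (hK.smooth_curve one_pos hρ hd (hv i)).2
  have hterm : ∀ i, SmoothFamily Ω (Icc (-δ) δ ×ˢ Icc 0 1) fun p : ℝ × ℝ =>
      (flux K (ρ p.2) (v p.2) i + p.1 • w p.2 i) *
        K (ρ p.2 + p.1 • η p.2) (flux K (ρ p.2) (v p.2) i + p.1 • w p.2 i) := fun i =>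
    (hfam (hm i) (hw i)).mul (hK.smooth (-δ) δ 0 1 (by linarith) one_pos _ _ (hfam hρ hη)
      (fun s hs => hdens s.1 hs.1 s.2 hs.2) (hfam (hm i) (hw i))).1
  have hsum := (SmoothFamily.sum (s := Finset.univ) fun i _ => hterm i).contDiffOn_intS
    (hu.prod uniqueDiffOn_unitInterval)
    ((convex_Icc _ _).prod (convex_Icc _ _)).locallyQuasiconvex
  exact hsum.congr fun p _ => fluxEnergy_eq _ _ _

theorem HasFirstVariation.sum {ι : Type*} {s : Finset ι} {F : ι → SmoothFn Ω → ℝ}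
    {ρ : SmoothFn Ω} {g : ι → SmoothFn Ω} (h : ∀ i ∈ s, HasFirstVariation Ω (F i) ρ (g i)) :
    HasFirstVariation Ω (fun ρ' => ∑ i ∈ s, F i ρ') ρ (∑ i ∈ s, g i) := by
  intro σ hσ
  have : (integral Ω fun x => ev (∑ i ∈ s, g i) x * ev σ x) = ∑ i ∈ s, intS (g i * σ) := by
    rw [integral_mul_eq, Finset.sum_mul, map_sum]
  rw [this]
  exact HasDerivAt.fun_sum fun i hi => h i hi σ hσ

theorem IsL2Hessian.exists_firstVariation (hK : IsL2Hessian Ω H K) {ρ : ℝ → SmoothFn Ω}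
    {v : ℝ → SmoothVec Ω} (hρ : SmoothFamily Ω (Icc 0 1) ρ)
    (hd : ∀ t ∈ Icc (0 : ℝ) 1, IsDensity Ω (ρ t))
    (hv : ∀ i, SmoothFamily Ω (Icc 0 1) fun t => v t i) :
    ∃ g : ℝ → SmoothFn Ω, SmoothFamily Ω (Icc 0 1) g ∧
      ∀ t ∈ Icc (0 : ℝ) 1, HasFirstVariation Ω (dualEnergy K (v t)) (ρ t) (g t) := by
  choose g hg hg' using fun i => hK.variation ρ (fun t => v t i) hρ hd (hv i)
  refine ⟨fun t => ∑ i, g i t, SmoothFamily.sum fun i _ => hg i, fun t ht => ?_⟩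
  have := HasFirstVariation.sum (s := Finset.univ) fun i _ => hg' i t ht
  convert this using 1
  ext ρ'
  rw [dualEnergy_eq, map_sum]
  rfl

end FirstVariation

/-! ### Curl-free fields by orthogonality. -/

section CurlFree

variable {d : ℕ} {Ω : SampleSpace d}

/-- A vector field orthogonal to the divergence-free fields is curl-free. -/
theorem dx_eq_dx_of_orthogonal (v : SmoothVec Ω) (h : ∀ w : SmoothVec Ω,
    (Ω.NoFlux fun i => ev (w i)) → divS w = 0 → intS (∑ i, w i * v i) = 0) (i j : Fin d) :
    dx i (v j) = dx j (v i) := by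
  set A : Fin d → Fin d → SmoothFn Ω := fun i j => dx i (v j) - dx j (v i) with hA
  have hanti : ∀ i j, A i j = -A j i := fun i j => (neg_sub _ _).symm
  -- The test field `wᵢ = ∑ⱼ ∂ⱼ (weight * Aᵢⱼ)` is divergence-free because `A` is antisymmetric and
  -- partial derivatives commute.
  have hdiv : divS (fun i => divS fun j => weight Ω * A i j) = 0 := by
    have : ∑ i, ∑ j, dx i (dx j (weight Ω * A i j)) = -∑ i, ∑ j, dx i (dx j (weight Ω * A i j)) := by
      conv_lhs => rw [Finset.sum_comm]
      rw [← Finset.sum_neg_distrib]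
      refine Finset.sum_congr rfl fun i _ => ?_
      rw [← Finset.sum_neg_distrib]
      refine Finset.sum_congr rfl fun j _ => ?_
      rw [hanti j i, dx_comm, mul_neg, map_neg, map_neg]
    simp only [divS_apply, map_sum]
    refine SmoothFn.ext_carrier fun x _ => ?_
    have e := congrArg (fun f => ev f x) this
    rw [ev_neg] at e
    rw [ev_zero]
    linarith
  have key := h _ (noFlux_sum_dx_weight_mul A) hdiv
  have h1 : ∀ i, intS (divS (fun j => weight Ω * A i j) * v i) =
      -∑ j, intS (weight Ω * A i j * dx j (v i)) := fun i => by
    rw [mul_comm, intS_mul_divS _ _ (noFlux_weight_mul _), map_sum]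
  -- Orthogonality to the test field kills the sum against `∂ⱼ vᵢ`. Exchanging the indices kills the
  -- sum against `∂ᵢ vⱼ`. Their difference is the weighted square of the curl.
  have h2 : ∑ i, ∑ j, intS (weight Ω * (A i j * A i j)) = 0 := by
    have e : ∑ i, ∑ j, intS (weight Ω * A i j * dx j (v i)) = 0 := by
      rw [map_sum] at key
      rw [← neg_eq_zero, ← Finset.sum_neg_distrib, ← key]
      exact Finset.sum_congr rfl fun i _ => (h1 i).symm
    have e' : ∑ i, ∑ j, intS (weight Ω * A i j * dx i (v j)) = 0 := by
      rw [Finset.sum_comm, ← neg_eq_zero, ← e, ← Finset.sum_neg_distrib]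
      refine Finset.sum_congr rfl fun i _ => ?_
      rw [← Finset.sum_neg_distrib]
      refine Finset.sum_congr rfl fun j _ => ?_
      rw [hanti j i, mul_neg, neg_mul, map_neg, neg_neg]
    have : ∀ i j, intS (weight Ω * (A i j * A i j)) =
        intS (weight Ω * A i j * dx i (v j)) - intS (weight Ω * A i j * dx j (v i)) := fun i j => by
      rw [← map_sub, ← mul_sub, mul_assoc]
    simp only [this, Finset.sum_sub_distrib, e, e', sub_zero]
  have h3 : ∀ i j, 0 ≤ intS (weight Ω * (A i j * A i j)) := fun i j =>
    intS_nonneg fun x hx => mul_nonneg (weight_nonneg hx) (mul_self_nonneg _)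
  rw [Finset.sum_eq_zero_iff_of_nonneg fun i _ => Finset.sum_nonneg fun j _ => h3 i j] at h2
  have h4 := h2 i (Finset.mem_univ i)
  rw [Finset.sum_eq_zero_iff_of_nonneg fun j _ => h3 i j] at h4
  exact sub_eq_zero.1 (eq_zero_of_intS_weight_mul (h4 j (Finset.mem_univ j)))

end CurlFree

/-! ### Divergence and gradient on the torus by averaging coordinates. -/

section Torus

variable {d : ℕ} {L : Fin d → ℝ} {hL : ∀ i, 0 < L i}

/-- The weighted average of a periodic function over a period in the direction `i`. -/
def lineInt (w : ℝ → ℝ) (hw : ContDiff ℝ ∞ w) (i : Fin d)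
    (f : SmoothFn (SampleSpace.periodic L hL)) : SmoothFn (SampleSpace.periodic L hL) :=
  mkFn (fun x => ∫ s in Icc (0 : ℝ) 1, w s * ev f (x + s • EuclideanSpace.single i (L i)))
    (convex_univ.locallyQuasiconvex.contDiffOn_integral uniqueDiffOn_univ
      (isCompact_Icc (a := (0 : ℝ)) (b := 1)) uniqueDiffOn_unitInterval
      (ae_restrict_mem measurableSet_Icc)
      (F := fun p : E d × ℝ => w p.2 * ev f (p.1 + p.2 • EuclideanSpace.single i (L i)))
      ((hw.comp contDiff_snd).mul ((contDiffOn_univ.1 (contDiffOn_ev f)).comp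
        (by fun_prop : ContDiff ℝ ∞ fun p : E d × ℝ =>
          p.1 + p.2 • EuclideanSpace.single i (L i)))).contDiffOn)
    (fun j x => by
      refine integral_congr_ae (Filter.Eventually.of_forall fun s => ?_)
      dsimp only
      rw [add_right_comm, isPeriodic_ev f j])

variable (f : SmoothFn (SampleSpace.periodic L hL))

theorem hasFDerivAt_ev_periodic (x : E d) : HasFDerivAt (ev f) (fderiv ℝ (ev f) x) x :=
  (((contDiffOn_univ.1 (contDiffOn_ev f)).differentiable (by simp)) x).hasFDerivAt

theorem ev_dx_periodic (i : Fin d) (x : E d) :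
    ev (dx i f) x = fderiv ℝ (ev f) x (EuclideanSpace.single i 1) :=
  ev_dx_of_hasFDerivAt (fun _ _ => rfl) (mem_univ x) (hasFDerivAt_ev_periodic f x) i

theorem ev_lineInt (w : ℝ → ℝ) (hw : ContDiff ℝ ∞ w) (i : Fin d) (x : E d) :
    ev (lineInt w hw i f) x =
      ∫ s in Icc (0 : ℝ) 1, w s * ev f (x + s • EuclideanSpace.single i (L i)) :=
  ev_mkFn _ _ (mem_univ x)

theorem dx_lineInt (w : ℝ → ℝ) (hw : ContDiff ℝ ∞ w) (i j : Fin d) :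
    dx j (lineInt w hw i f) = lineInt w hw i (dx j f) := by
  refine SmoothFn.ext_carrier fun x hx => ?_
  have hf := contDiffOn_univ.1 (contDiffOn_ev f)
  have hc : ContDiff ℝ ∞ fun p : E d × ℝ => p.1 + p.2 • EuclideanSpace.single i (L i) := by fun_prop
  have hD : Continuous fun p : E d × ℝ =>
      w p.2 • fderiv ℝ (ev f) (p.1 + p.2 • EuclideanSpace.single i (L i)) :=
    (hw.continuous.comp continuous_snd).smul
      ((hf.continuous_fderiv (by simp)).comp hc.continuous)
  have key := (convex_univ (𝕜 := ℝ) (E := E d)).locallyQuasiconvex.hasFDerivWithinAt_integral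
    (isCompact_Icc (a := (0 : ℝ)) (b := 1)) (μ := volume.restrict (Icc (0 : ℝ) 1))
    (ae_restrict_mem measurableSet_Icc)
    (F := fun p : E d × ℝ => w p.2 * ev f (p.1 + p.2 • EuclideanSpace.single i (L i)))
    (D := fun p => w p.2 • fderiv ℝ (ev f) (p.1 + p.2 • EuclideanSpace.single i (L i)))
    (fun y _ s _ => (((hasFDerivAt_comp_add_right (s • EuclideanSpace.single i (L i))).2
      (hasFDerivAt_ev_periodic f (y + s • EuclideanSpace.single i (L i)))).const_mul
      (w s)).hasFDerivWithinAt)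
    ((hw.comp contDiff_snd).mul (hf.comp hc)).continuous.continuousOn hD.continuousOn (mem_univ x)
  rw [hasFDerivWithinAt_univ] at key
  rw [ev_dx_of_hasFDerivAt (fun y _ => ev_lineInt f w hw i y) hx key, ev_lineInt,
    ContinuousLinearMap.integral_apply]
  · refine integral_congr_ae (Filter.Eventually.of_forall fun s => ?_)
    dsimp only
    rw [ev_dx_periodic]
    rfl
  · exact (hD.comp (by fun_prop : Continuous fun s : ℝ => (x, s))).continuousOn.integrableOn_compact
      isCompact_Icc

/-- The average over a period. -/
def avg (i : Fin d) : SmoothFn (SampleSpace.periodic L hL) → SmoothFn (SampleSpace.periodic L hL) :=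
  lineInt (fun _ => 1) contDiff_const i

/-- The primitive of the difference of a function and its average. -/
def avgPrimitive (i : Fin d) :
    SmoothFn (SampleSpace.periodic L hL) → SmoothFn (SampleSpace.periodic L hL) :=
  lineInt (fun s => s * L i) (contDiff_id.mul contDiff_const) i

theorem hasDerivAt_ev_line (i : Fin d) (x : E d) (s : ℝ) :
    HasDerivAt (fun s : ℝ => ev f (x + s • EuclideanSpace.single i (L i)))
      (L i * ev (dx i f) (x + s • EuclideanSpace.single i (L i))) s := by
  have h1 : HasDerivAt (fun s : ℝ => x + s • EuclideanSpace.single i (L i))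
      (EuclideanSpace.single i (L i)) s := by
    simpa using ((hasDerivAt_id s).smul_const (EuclideanSpace.single i (L i))).const_add x
  refine ((hasFDerivAt_ev_periodic f _).comp_hasDerivAt s h1).congr_deriv ?_
  rw [ev_dx_periodic, ← smul_eq_mul, ← map_smul]
  congr 1
  ext j
  by_cases h : j = i <;> simp [h]

theorem continuous_ev_line (i : Fin d) (x : E d) :
    Continuous fun s : ℝ => ev f (x + s • EuclideanSpace.single i (L i)) :=
  (contDiffOn_univ.1 (contDiffOn_ev f)).continuous.comp (by fun_prop)

theorem dx_avg_self (i : Fin d) : dx i (avg i f) = 0 := by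
  refine SmoothFn.ext_carrier fun x _ => ?_
  have h := intervalIntegral.integral_eq_sub_of_hasDerivAt (a := 0) (b := 1)
    (fun s _ => hasDerivAt_ev_line f i x s)
    ((continuous_const.mul (continuous_ev_line (dx i f) i x)).intervalIntegrable 0 1)
  rw [intervalIntegral.integral_const_mul, one_smul, zero_smul, add_zero, isPeriodic_ev f i, sub_self,
    mul_eq_zero, or_iff_right (hL i).ne'] at h
  rw [avg, dx_lineInt, ev_lineInt, ev_zero, integral_Icc_eq_integral_Ioc,
    ← intervalIntegral.integral_of_le zero_le_one]
  simp only [one_mul]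
  exact h

/-- Integration by parts in `s` over a period: the weight `s` contributes `f (x + Lᵢ eᵢ) = f x` at
the upper end, nothing at the lower end, and minus the average. -/
theorem dx_avgPrimitive_self (i : Fin d) : dx i (avgPrimitive i f) = f - avg i f := by
  refine SmoothFn.ext_carrier fun x _ => ?_
  have h := intervalIntegral.integral_mul_deriv_eq_deriv_mul (a := 0) (b := 1)
    (u := id) (u' := fun _ => 1) (fun s _ => hasDerivAt_id s)
    (fun s _ => hasDerivAt_ev_line f i x s) intervalIntegrable_const
    ((continuous_const.mul (continuous_ev_line (dx i f) i x)).intervalIntegrable 0 1)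
  rw [avgPrimitive, dx_lineInt, ev_lineInt, ev_sub, avg, ev_lineInt, integral_Icc_eq_integral_Ioc,
    integral_Icc_eq_integral_Ioc, ← intervalIntegral.integral_of_le zero_le_one,
    ← intervalIntegral.integral_of_le zero_le_one]
  simp only [id, one_mul, zero_mul, sub_zero, one_smul] at h ⊢
  rw [isPeriodic_ev f i] at h
  rw [← h]
  simp only [mul_assoc]

theorem eq_constFn_of_dx_eq_zero (h : ∀ i, dx i f = 0) : f = constFn _ (ev f 0) := by
  refine SmoothFn.ext_carrier fun x hx => ?_
  rw [ev_constFn _ hx]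
  refine is_const_of_fderiv_eq_zero
    ((contDiffOn_univ.1 (contDiffOn_ev f)).differentiable (by simp)) (fun y => ?_) x 0
  ext z
  rw [clm_apply_eq_sum]
  refine Finset.sum_eq_zero fun i _ => ?_
  rw [← ev_dx_periodic, h, ev_zero, mul_zero]

theorem eq_zero_of_dx_eq_zero (h : ∀ i, dx i f = 0) (h0 : intS f = 0) : f = 0 := by
  have hc := eq_constFn_of_dx_eq_zero f h
  refine eq_zero_of_intS_mul_self ?_
  have : f * f = ev f 0 • f := by
    conv_lhs => rw [hc]
    refine SmoothFn.ext_carrier fun x hx => ?_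
    rw [ev_mul, ev_constFn _ hx, ev_smul]
    conv_rhs => rw [hc]
    rw [ev_constFn _ hx, ev_constFn _ (mem_univ _)]
  rw [this, map_smul, h0, smul_zero]

/-- Subtracting the average in the direction `i` costs a derivative `∂ᵢ`, and the average is still
constant in the directions treated before. -/
theorem exists_divS_add_periodic (s : Finset (Fin d)) :
    ∃ (m : SmoothVec (SampleSpace.periodic L hL)) (g : SmoothFn (SampleSpace.periodic L hL)),
      f = divS m + g ∧ ∀ i ∈ s, dx i g = 0 := by
  classical
  induction s using Finset.induction_on with
  | empty => exact ⟨0, f, by simp, by simp⟩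
  | insert i s hi ih =>
    obtain ⟨m, g, hf, hg⟩ := ih
    refine ⟨m + Pi.single i (avgPrimitive i g), avg i g, ?_, fun j hj => ?_⟩
    · have : divS (Pi.single i (avgPrimitive i g)) = dx i (avgPrimitive i g) := by
        rw [divS_apply, Finset.sum_eq_single i]
        · rw [Pi.single_eq_same]
        · intro j _ hj
          rw [Pi.single_eq_of_ne hj, map_zero]
        · simp
      rw [map_add, this, dx_avgPrimitive_self, hf]
      abel
    · rcases Finset.mem_insert.1 hj with rfl | hj
      · exact dx_avg_self g j
      · rw [avg, dx_lineInt, hg j hj]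
        exact SmoothFn.ext_carrier fun x _ => by simp [ev_lineInt]

theorem exists_divS_eq_periodic (h : intS f = 0) :
    ∃ m : SmoothVec (SampleSpace.periodic L hL), divS m = f := by
  obtain ⟨m, g, hf, hg⟩ := exists_divS_add_periodic f Finset.univ
  have : g = 0 := by
    refine eq_zero_of_dx_eq_zero g (fun i => hg i (Finset.mem_univ i)) ?_
    rwa [hf, map_add, intS_divS m trivial, zero_add] at h
  exact ⟨m, by rw [hf, this, add_zero]⟩

/-- Orthogonality to the divergence-free fields makes `v` curl-free. Orthogonality to the constant
fields gives each component mean zero, which excludes harmonic fields. The potential is then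
corrected one coordinate at a time by a periodic primitive of the error. -/
theorem exists_grad_eq_periodic (v : SmoothVec (SampleSpace.periodic L hL))
    (h : ∀ w : SmoothVec (SampleSpace.periodic L hL), divS w = 0 → intS (∑ i, w i * v i) = 0) :
    ∃ Φ : SmoothFn (SampleSpace.periodic L hL), grad Φ = v := by
  classical
  have hcurl := dx_eq_dx_of_orthogonal v fun w _ => h w
  have hmean : ∀ i, intS (v i) = 0 := fun i => by
    have := h (Pi.single i 1) (by
      rw [divS_apply]
      refine Finset.sum_eq_zero fun j _ => ?_
      by_cases hj : j = i
      · subst hj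
        rw [Pi.single_eq_same]
        exact dx_constFn j 1
      · rw [Pi.single_eq_of_ne hj, map_zero])
    rwa [Finset.sum_eq_single i (fun j _ hj => by rw [Pi.single_eq_of_ne hj, zero_mul]) (by simp),
      Pi.single_eq_same, one_mul] at this
  have key : ∀ s : Finset (Fin d), ∃ Φ : SmoothFn (SampleSpace.periodic L hL),
      ∀ i ∈ s, dx i Φ = v i := by
    intro s
    induction s using Finset.induction_on with
    | empty => exact ⟨0, by simp⟩
    | insert i s hi ih =>
      obtain ⟨Φ, hΦ⟩ := ih
      set u := v i - dx i Φ with hu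
      have hju : ∀ j ∈ s, dx j u = 0 := fun j hj => by
        rw [hu, map_sub, hcurl j i, dx_comm, hΦ j hj, sub_self]
      have hz : ∀ w hw, lineInt w hw i (0 : SmoothFn (SampleSpace.periodic L hL)) = 0 := fun w hw =>
        SmoothFn.ext_carrier fun x _ => by simp [ev_lineInt]
      -- The average of `∂ᵢ Φ` is zero, and `∂ⱼ` of the average of `vᵢ` is the average of `∂ᵢ vⱼ`,
      -- again zero. So `avg i u` is constant, and it has mean zero; hence the primitive of `u`
      -- needs no correction.
      have havg : avg i u = 0 := by
        refine eq_zero_of_dx_eq_zero _ (fun j => ?_) ?_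
        · have : avg i u = avg i (v i) - dx i (avg i Φ) := by
            rw [hu, avg, dx_lineInt]
            refine SmoothFn.ext_carrier fun x _ => ?_
            simp only [ev_lineInt, ev_sub, mul_sub]
            exact integral_sub
              ((continuous_const.mul (continuous_ev_line _ i x)).continuousOn.integrableOn_compact
                isCompact_Icc)
              ((continuous_const.mul (continuous_ev_line _ i x)).continuousOn.integrableOn_compact
                isCompact_Icc)
          rw [this, dx_avg_self, sub_zero, avg, dx_lineInt, hcurl j i, ← dx_lineInt]
          exact dx_avg_self (v j) i
        · have : avg i u = u - divS (Pi.single i (avgPrimitive i u)) := by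
            rw [divS_apply, Finset.sum_eq_single i (fun j _ hj => by
              rw [Pi.single_eq_of_ne hj, map_zero]) (by simp), Pi.single_eq_same,
              dx_avgPrimitive_self]
            abel
          have h2 : intS (dx i Φ) = 0 := intS_dx_periodic hL Φ i
          rw [this, map_sub, intS_divS (Ω := SampleSpace.periodic L hL) _ trivial, hu, map_sub, hmean, h2, sub_zero, sub_zero]
      refine ⟨Φ + avgPrimitive i u, fun j hj => ?_⟩
      rw [map_add]
      rcases Finset.mem_insert.1 hj with rfl | hj
      · rw [dx_avgPrimitive_self, havg, hu]
        abel
      · rw [avgPrimitive, dx_lineInt, hju j hj, hz, add_zero, hΦ j hj]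
  obtain ⟨Φ, hΦ⟩ := key Finset.univ
  exact ⟨Φ, funext fun i => hΦ i (Finset.mem_univ i)⟩

end Torus

/-! ### Functions supported in a cube, modulo divergences. -/

section Cube

variable {d : ℕ}

theorem integral_eq_mul_integral_unitInterval (F : ℝ → ℝ) (a b : ℝ) :
    ∫ s in a..b, F s = ∫ u in Icc (0 : ℝ) 1, (b - a) * F (a + (b - a) * u) := by
  rw [integral_const_mul, integral_Icc_eq_integral_Ioc,
    ← intervalIntegral.integral_of_le zero_le_one, intervalIntegral.mul_integral_comp_add_mul]
  simp

/-- A smooth step from `0` on `(-∞, -δ]` to `1` on `[δ, ∞)`. -/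
def smoothStep (δ t : ℝ) : ℝ := Real.smoothTransition ((t + δ) / (2 * δ))

/-- The derivative of the smooth step, which is supported in `[-δ, δ]`. -/
def stepDeriv (δ t : ℝ) : ℝ := deriv Real.smoothTransition ((t + δ) / (2 * δ)) / (2 * δ)

theorem contDiff_smoothStep (δ : ℝ) : ContDiff ℝ ∞ (smoothStep δ) :=
  Real.smoothTransition.contDiff.comp ((contDiff_id.add contDiff_const).div_const _)

theorem hasDerivAt_smoothStep (δ t : ℝ) : HasDerivAt (smoothStep δ) (stepDeriv δ t) t := by
  have h1 : HasDerivAt (fun t => (t + δ) / (2 * δ)) (1 / (2 * δ)) t :=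
    ((hasDerivAt_id t).add_const δ).div_const _
  have h2 : HasDerivAt Real.smoothTransition (deriv Real.smoothTransition ((t + δ) / (2 * δ)))
      ((t + δ) / (2 * δ)) :=
    ((Real.smoothTransition.contDiff (n := 1)).differentiable (by simp)).differentiableAt.hasDerivAt
  refine (h2.comp t h1).congr_deriv ?_
  rw [stepDeriv, mul_one_div]

theorem contDiff_stepDeriv (δ : ℝ) : ContDiff ℝ ∞ (stepDeriv δ) := by
  have : stepDeriv δ = deriv (smoothStep δ) := funext fun t => (hasDerivAt_smoothStep δ t).deriv.symm
  rw [this]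
  exact ((contDiff_infty_iff_deriv (𝕜 := ℝ)).1 (contDiff_smoothStep δ)).2

theorem smoothStep_of_le_neg {δ t : ℝ} (hδ : 0 < δ) (h : t ≤ -δ) : smoothStep δ t = 0 :=
  Real.smoothTransition.zero_of_nonpos (div_nonpos_of_nonpos_of_nonneg (by linarith) (by linarith))

theorem smoothStep_of_le {δ t : ℝ} (hδ : 0 < δ) (h : δ ≤ t) : smoothStep δ t = 1 :=
  Real.smoothTransition.one_of_one_le ((one_le_div (by linarith)).2 (by linarith))

/-- At `|t| = δ` the transition function is not locally constant, so its derivative there is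
obtained by continuity. -/
theorem stepDeriv_eq_zero {δ t : ℝ} (hδ : 0 < δ) (h : δ ≤ |t|) : stepDeriv δ t = 0 := by
  have hcl : ∀ s : ℝ, s ∈ closure (Iio (0 : ℝ) ∪ Ioi 1) → deriv Real.smoothTransition s = 0 := by
    have hc : Continuous (deriv Real.smoothTransition) :=
      (Real.smoothTransition.contDiff (n := 1)).continuous_deriv (by simp)
    exact fun s hs => closure_minimal (fun s hs => deriv_smoothTransition_eq_zero hs)
      (isClosed_singleton.preimage hc) hs
  rw [stepDeriv, hcl, zero_div]
  rw [closure_union, closure_Iio, closure_Ioi]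
  rcases le_abs.1 h with h | h
  · exact Or.inr (show 1 ≤ (t + δ) / (2 * δ) from (one_le_div (by linarith)).2 (by linarith))
  · exact Or.inl (show (t + δ) / (2 * δ) ≤ 0 from
      div_nonpos_of_nonpos_of_nonneg (by linarith) (by linarith))

/-- A smooth function supported in a slab is, up to a function of the other variables times a
bump function, the derivative of a function supported in the slab. -/
theorem exists_line_primitive {h : E d → ℝ} (hh : ContDiff ℝ ∞ h) (c : E d) (i : Fin d) {δ : ℝ}
    (hδ : 0 < δ) (h0 : ∀ x, δ ≤ |x i - c i| → h x = 0) :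
    ∃ a H : E d → ℝ, ContDiff ℝ ∞ a ∧ ContDiff ℝ ∞ H ∧
      (∀ x, HasDerivAt (fun s : ℝ => a (x + s • EuclideanSpace.single i 1))
        (h x - stepDeriv δ (x i - c i) * H x) 0) ∧
      (∀ x, δ ≤ |x i - c i| → a x = 0) ∧
      (∀ x (s : ℝ), H (x + s • EuclideanSpace.single i 1) = H x) ∧
      (∀ x, (∀ s : ℝ, h (x + s • EuclideanSpace.single i 1) = 0) → a x = 0 ∧ H x = 0) ∧
      ∀ j ≠ i, (∀ x (s : ℝ), h (x + s • EuclideanSpace.single j 1) = h x) →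
        ∀ x (s : ℝ), H (x + s • EuclideanSpace.single j 1) = H x := by
  set e : E d := EuclideanSpace.single i 1 with he
  have hei : e i = 1 := by simp [he]
  -- The value of `h` at the point of the line through `x` whose coordinate `i` is `c i + τ`; it
  -- does not depend on the position of `x` on the line.
  set g : E d → ℝ → ℝ := fun x τ => h (x + (c i + τ - x i) • e) with hg
  have hgs : ∀ (x : E d) (s τ : ℝ), g (x + s • e) τ = g x τ := fun x s τ => by
    simp only [hg, PiLp.add_apply, PiLp.smul_apply, hei, smul_eq_mul, mul_one, add_assoc, ← add_smul]
    congr 3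
    ring
  have hgc : ContDiff ℝ ∞ fun p : E d × ℝ => g p.1 p.2 := hh.comp (by fun_prop)
  have hgx : ∀ x, Continuous (g x) := fun x =>
    hgc.continuous.comp (continuous_const.prodMk continuous_id)
  have hg0 : ∀ x τ, δ ≤ |τ| → g x τ = 0 := fun x τ hτ => h0 _ (by
    simp only [PiLp.add_apply, PiLp.smul_apply, hei, smul_eq_mul, mul_one]
    rwa [show x i + (c i + τ - x i) - c i = τ by ring])
  have hgself : ∀ x, g x (x i - c i) = h x := fun x => by
    simp only [hg, add_sub_cancel, sub_self, zero_smul, add_zero]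
  set H : E d → ℝ := fun x => ∫ τ in (-δ)..δ, g x τ with hH
  set A : E d → ℝ := fun x => ∫ τ in (-δ)..(x i - c i), g x τ with hA
  have hsm : ∀ {b : E d → ℝ}, ContDiff ℝ ∞ b →
      ContDiff ℝ ∞ fun x => ∫ τ in (-δ)..(b x), g x τ := fun {b} hb => by
    simp only [integral_eq_mul_integral_unitInterval]
    rw [← contDiffOn_univ]
    refine convex_univ.locallyQuasiconvex.contDiffOn_integral uniqueDiffOn_univ
      (isCompact_Icc (a := (0 : ℝ)) (b := 1)) uniqueDiffOn_unitInterval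
      (ae_restrict_mem measurableSet_Icc)
      (F := fun p : E d × ℝ => (b p.1 - -δ) * g p.1 (-δ + (b p.1 - -δ) * p.2)) ?_
    have hb' : ContDiff ℝ ∞ fun p : E d × ℝ => b p.1 - -δ := (hb.comp contDiff_fst).sub contDiff_const
    exact (hb'.mul (hgc.comp (contDiff_fst.prodMk
      (contDiff_const.add (hb'.mul contDiff_snd))))).contDiffOn
  have hHs : ∀ (x : E d) (s : ℝ), H (x + s • e) = H x := fun x s => by simp only [hH, hgs]
  have hcoord : ContDiff ℝ ∞ fun x : E d => x i - c i := by fun_prop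
  -- The plain primitive `A` equals the full line integral `H` beyond the slab; subtracting a smooth
  -- step times `H` restores the support.
  refine ⟨fun x => A x - smoothStep δ (x i - c i) * H x, H,
    (hsm hcoord).sub (((contDiff_smoothStep δ).comp hcoord).mul (hsm contDiff_const)),
    hsm contDiff_const, fun x => ?_, fun x hx => ?_, hHs, fun x hx => ?_, fun j hj hx x s => ?_⟩
  · have hlin : HasDerivAt (fun s : ℝ => x i - c i + s) 1 0 := (hasDerivAt_id 0).const_add _
    have h1 : HasDerivAt (fun u => ∫ τ in (-δ)..u, g x τ) (h x) (x i - c i + 0) := by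
      rw [add_zero, ← hgself x]
      exact ((hgx x).integral_hasStrictDerivAt _ _).hasDerivAt
    have h2 : HasDerivAt (smoothStep δ) (stepDeriv δ (x i - c i)) (x i - c i + 0) := by
      rw [add_zero]
      exact hasDerivAt_smoothStep _ _
    have h3 := (h1.comp 0 hlin).sub ((h2.comp 0 hlin).mul_const (H x))
    rw [mul_one, mul_one] at h3
    refine h3.congr_of_eventuallyEq (Filter.Eventually.of_forall fun s => ?_)
    have : (x + s • e) i - c i = x i - c i + s := by
      simp only [PiLp.add_apply, PiLp.smul_apply, hei, smul_eq_mul, mul_one]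
      ring
    simp only [hA, hgs, hHs, this]
    rfl
  · dsimp only
    rcases le_abs.1 hx with hx | hx
    · have : A x = H x := by
        rw [hA, hH]
        dsimp only
        rw [← intervalIntegral.integral_add_adjacent_intervals
          ((hgx x).intervalIntegrable (-δ) δ) ((hgx x).intervalIntegrable δ _), add_eq_left]
        refine intervalIntegral.integral_zero_ae (Filter.Eventually.of_forall fun τ hτ => ?_)
        rw [uIoc_of_le hx] at hτ
        exact hg0 x τ (hτ.1.le.trans (le_abs_self τ))
      rw [this, smoothStep_of_le hδ hx, one_mul, sub_self]
    · have : A x = 0 := by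
        refine intervalIntegral.integral_zero_ae (Filter.Eventually.of_forall fun τ hτ => ?_)
        rw [uIoc_comm, uIoc_of_le (by linarith)] at hτ
        exact hg0 x τ ((by linarith [hτ.2] : δ ≤ -τ).trans (neg_le_abs τ))
      rw [this, smoothStep_of_le_neg hδ (by linarith), zero_mul, sub_self]
  · have : ∀ τ, g x τ = 0 := fun τ => hx _
    have hH0 : H x = 0 := by simp [hH, this]
    exact ⟨by simp [hA, this, hH0], hH0⟩
  · have hji : (EuclideanSpace.single j (1 : ℝ) : E d) i = 0 := by simp [hj.symm]
    have : ∀ τ, g (x + s • EuclideanSpace.single j 1) τ = g x τ := fun τ => by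
      simp only [hg, PiLp.add_apply, PiLp.smul_apply, hji, smul_zero, add_zero]
      rw [add_right_comm, hx]
    simp only [hH, this]

theorem stepDeriv_prod_line {δ : ℝ} {c : E d} {s : Finset (Fin d)} {i : Fin d} (hi : i ∉ s) (x : E d)
    (τ : ℝ) : ∏ j ∈ s, stepDeriv δ ((x + τ • EuclideanSpace.single i (1 : ℝ)) j - c j) =
      ∏ j ∈ s, stepDeriv δ (x j - c j) := by
  refine Finset.prod_congr rfl fun j hj => ?_
  have : j ≠ i := fun h => hi (h ▸ hj)
  simp [this]

/-- Each coordinate is integrated out in turn by `exists_line_primitive`, leaving a bump in that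
variable. The new component of the field is the primitive times the bumps in the earlier
coordinates. These do not depend on the new variable, so they pass through the derivative, and they
keep the field supported in the cube. -/
theorem exists_lineDeriv_add_cube {f : E d → ℝ} (hf : ContDiff ℝ ∞ f) (c : E d) {δ : ℝ} (hδ : 0 < δ)
    (h0 : ∀ x, (∃ j, δ ≤ |x j - c j|) → f x = 0) (s : Finset (Fin d)) :
    ∃ (m : Fin d → E d → ℝ) (H : E d → ℝ), (∀ i, ContDiff ℝ ∞ (m i)) ∧
      (∀ i x, (∃ j, δ ≤ |x j - c j|) → m i x = 0) ∧ ContDiff ℝ ∞ H ∧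
      (∀ j ∈ s, ∀ x (τ : ℝ), H (x + τ • EuclideanSpace.single j 1) = H x) ∧
      (∀ x, (∃ j ∉ s, δ ≤ |x j - c j|) → H x = 0) ∧
      ∀ x, f x = ∑ i, fderiv ℝ (m i) x (EuclideanSpace.single i 1) +
        (∏ j ∈ s, stepDeriv δ (x j - c j)) * H x := by
  classical
  induction s using Finset.induction_on with
  | empty =>
    refine ⟨fun _ _ => 0, f, fun i => contDiff_const, fun i x _ => rfl, hf, by simp, ?_, by simp⟩
    rintro x ⟨j, -, hj⟩
    exact h0 x ⟨j, hj⟩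
  | insert i s hi ih =>
    obtain ⟨m, H, hm, hm0, hH, hHs, hH0, hfm⟩ := ih
    obtain ⟨a, H', ha, hH', hder, ha0, hHi, hvan, hind⟩ :=
      exists_line_primitive hH c i hδ fun x hx => hH0 x ⟨i, hi, hx⟩
    set P : E d → ℝ := fun x => ∏ j ∈ s, stepDeriv δ (x j - c j) with hP
    have hPs : ContDiff ℝ ∞ P := contDiff_prod fun j _ => (contDiff_stepDeriv δ).comp (by fun_prop)
    have hPa := hPs.mul ha
    have hline : ∀ x (τ : ℝ) (j : Fin d), j ≠ i → (x + τ • EuclideanSpace.single i (1 : ℝ)) j = x j :=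
      fun x τ j hj => by simp [hj]
    have hPader : ∀ x, fderiv ℝ (fun x => P x * a x) x (EuclideanSpace.single i 1) =
        P x * (H x - stepDeriv δ (x i - c i) * H' x) := fun x => by
      have h1 : HasDerivAt (fun τ : ℝ => x + τ • EuclideanSpace.single i (1 : ℝ))
          (EuclideanSpace.single i 1) 0 := by
        simpa using ((hasDerivAt_id (0 : ℝ)).smul_const (EuclideanSpace.single i (1 : ℝ))).const_add x
      have h2 : HasFDerivAt (fun x => P x * a x) (fderiv ℝ (fun x => P x * a x) x)
          (x + (0 : ℝ) • EuclideanSpace.single i 1) := by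
        rw [zero_smul, add_zero]
        exact ((hPa.differentiable (by simp)) x).hasFDerivAt
      refine (h2.comp_hasDerivAt (0 : ℝ) h1).unique ?_
      refine ((hder x).const_mul (P x)).congr_of_eventuallyEq (Filter.Eventually.of_forall fun τ => ?_)
      simp only [Function.comp, hP, stepDeriv_prod_line hi]
    refine ⟨fun k x => m k x + if k = i then P x * a x else 0, H', fun k => ?_, fun k x hx => ?_, hH',
      fun j hj x τ => ?_, ?_, fun x => ?_⟩
    · by_cases hk : k = i
      · simp only [hk, if_true]
        exact (hm i).add hPa
      · simp only [hk, if_false, add_zero]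
        exact hm k
    · dsimp only
      rw [hm0 k x hx, zero_add, ite_eq_right_iff]
      rintro rfl
      obtain ⟨j, hj⟩ := hx
      by_cases hjs : j ∈ s
      · rw [hP]
        dsimp only
        rw [Finset.prod_eq_zero hjs (stepDeriv_eq_zero hδ hj), zero_mul]
      · by_cases hjk : j = k
        · rw [ha0 x (hjk ▸ hj), mul_zero]
        · rw [(hvan x fun τ => hH0 _ ⟨j, hjs, by rwa [hline x τ j hjk]⟩).1, mul_zero]
    · rcases Finset.mem_insert.1 hj with rfl | hj
      · exact hHi x τ
      · exact hind j (fun h => hi (h ▸ hj)) (hHs j hj) x τ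
    · rintro x ⟨j, hj, hjx⟩
      rw [Finset.mem_insert, not_or] at hj
      exact (hvan x fun τ => hH0 _ ⟨j, hj.2, by rwa [hline x τ j hj.1]⟩).2
    · have e : ∀ k, fderiv ℝ (fun x => m k x + if k = i then P x * a x else 0) x
          (EuclideanSpace.single k 1) = fderiv ℝ (m k) x (EuclideanSpace.single k 1) +
          if k = i then P x * (H x - stepDeriv δ (x i - c i) * H' x) else 0 := fun k => by
        by_cases hk : k = i
        · subst hk
          simp only [if_true]
          rw [fderiv_fun_add ((hm k).differentiable (by simp) x) (hPa.differentiable (by simp) x),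
            add_apply, hPader]
        · simp only [hk, if_false, add_zero]
      rw [Finset.sum_congr rfl fun k _ => e k, Finset.sum_add_distrib, Finset.sum_ite_eq',
        if_pos (Finset.mem_univ i), Finset.prod_insert hi, hfm x]
      simp only [hP]
      ring

variable (D : Domain d)

/-- A smooth function on a domain, from its values. -/
def Domain.fn (F : E d → ℝ) (h : ContDiffOn ℝ ∞ F D.space.carrier) : SmoothFn D.space :=
  mkFn F h trivial

theorem Domain.ev_fn {F : E d → ℝ} (h : ContDiffOn ℝ ∞ F D.space.carrier) {x : E d}
    (hx : x ∈ D.space.carrier) : ev (D.fn F h) x = F x := ev_mkFn _ _ hx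

/-- In a cube inside of the domain, a smooth function is a multiple of a fixed function up to a
divergence. -/
theorem exists_divS_add_smul (c : E d) {δ δ' : ℝ} (hδ : 0 < δ) (hδ' : 0 < δ')
    (hQ : ∀ x, (∀ j, |x j - c j| < δ) → D.r x ≤ -δ') :
    ∃ b : SmoothFn D.space, (∀ x ∈ D.space.carrier, (∃ j, δ ≤ |x j - c j|) → ev b x = 0) ∧
      ∀ σ : SmoothFn D.space,
      (∀ x ∈ D.space.carrier, (∃ j, δ ≤ |x j - c j|) → ev σ x = 0) →
      ∃ (m : SmoothVec D.space) (κ : ℝ),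
        (∀ i, ∀ x ∈ D.space.carrier, (∃ j, δ ≤ |x j - c j|) → ev (m i) x = 0) ∧
          σ = divS m + κ • b := by
  have hb : ContDiff ℝ ∞ fun x : E d => ∏ j, stepDeriv δ (x j - c j) :=
    contDiff_prod fun j _ => (contDiff_stepDeriv δ).comp (by fun_prop)
  refine ⟨D.fn _ hb.contDiffOn, fun x hx ⟨j, hj⟩ => ?_, fun σ hσ => ?_⟩
  · rw [D.ev_fn _ hx]
    exact Finset.prod_eq_zero (Finset.mem_univ j) (stepDeriv_eq_zero hδ hj)
  -- The cube stays away from the boundary, so a function supported in it is smooth on `ℝ^d` when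
  -- extended by zero.
  have hout : ∀ x, -δ' < D.r x → ∃ j, δ ≤ |x j - c j| := fun x hx => by
    by_contra! h
    exact absurd (hQ x h) (not_le.2 hx)
  have hσs := contDiff_ev_of_eq_zero_near_boundary D σ hδ' fun x hx hxr => hσ x hx (hout x hxr)
  obtain ⟨m, H, hm, hm0, hH, hHs, -, hfm⟩ := exists_lineDeriv_add_cube hσs c hδ (fun x hx => by
    by_cases hxc : x ∈ D.space.carrier
    · exact hσ x hxc hx
    · exact ev_of_notMem σ hxc) Finset.univ
  -- With all coordinates integrated out, `H` is constant; its value is the coefficient of the fixed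
  -- bump.
  have hHc : ∀ x, H x = H 0 := fun x => by
    refine is_const_of_fderiv_eq_zero (hH.differentiable (by simp)) (fun y => ?_) x 0
    ext z
    rw [clm_apply_eq_sum]
    refine Finset.sum_eq_zero fun i _ => ?_
    have h1 : HasDerivAt (fun τ : ℝ => y + τ • EuclideanSpace.single i (1 : ℝ))
        (EuclideanSpace.single i 1) 0 := by
      simpa using ((hasDerivAt_id (0 : ℝ)).smul_const (EuclideanSpace.single i (1 : ℝ))).const_add y
    have h2 : HasFDerivAt H (fderiv ℝ H y) (y + (0 : ℝ) • EuclideanSpace.single i 1) := by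
      rw [zero_smul, add_zero]
      exact ((hH.differentiable (by simp)) y).hasFDerivAt
    have h3 : HasDerivAt (H ∘ fun τ : ℝ => y + τ • EuclideanSpace.single i (1 : ℝ)) 0 0 :=
      (hasDerivAt_const (0 : ℝ) (H y)).congr_of_eventuallyEq
        (Filter.Eventually.of_forall fun τ => hHs i (Finset.mem_univ i) y τ)
    rw [(h2.comp_hasDerivAt (0 : ℝ) h1).unique h3, mul_zero]
  refine ⟨fun i => D.fn (m i) (hm i).contDiffOn, H 0, fun i x hx hxo => ?_,
    SmoothFn.ext_carrier fun x hx => ?_⟩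
  · rw [D.ev_fn _ hx]
    exact hm0 i x hxo
  · rw [ev_add, ev_smul, D.ev_fn _ hx, hfm x, hHc x, divS_apply, ev_sum, mul_comm (H 0)]
    congr 1
    refine Finset.sum_congr rfl fun i _ => ?_
    exact (ev_dx_of_hasFDerivAt (fun y hy => D.ev_fn _ hy) hx
      (((hm i).differentiable (by simp)) x).hasFDerivAt i).symm

end Cube

/-! ### Local potentials at interior points. -/

section LocalPotential

open Filter Topology

variable {d : ℕ} (D : Domain d)

/-- A bump function at `x`, which is `1` on the ball of radius `ρ / 2` and vanishes outside of the
ball of radius `ρ`. -/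
def Domain.bump (x : E d) {ρ : ℝ} (hρ : 0 < ρ) : SmoothFn D.space :=
  D.fn (⟨ρ / 2, ρ, half_pos hρ, half_lt_self hρ⟩ : ContDiffBump x) (ContDiffBump.contDiff _).contDiffOn

variable {D}

theorem Domain.ev_bump_of_le {x y : E d} {ρ : ℝ} (hρ : 0 < ρ) (hy : y ∈ D.space.carrier)
    (h : dist y x ≤ ρ / 2) : ev (D.bump x hρ) y = 1 :=
  (D.ev_fn _ hy).trans (ContDiffBump.one_of_mem_closedBall _ h)

theorem Domain.ev_bump_of_ge {x y : E d} {ρ : ℝ} (hρ : 0 < ρ) (hy : y ∈ D.space.carrier)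
    (h : ρ ≤ dist y x) : ev (D.bump x hρ) y = 0 :=
  (D.ev_fn _ hy).trans (ContDiffBump.zero_of_le_dist _ h)

theorem Domain.ev_bump_nonneg {x y : E d} {ρ : ℝ} (hρ : 0 < ρ) (hy : y ∈ D.space.carrier) :
    0 ≤ ev (D.bump x hρ) y := by
  rw [bump, D.ev_fn _ hy]
  exact ContDiffBump.nonneg _

/-- A function that is smooth near a point agrees near that point with a smooth function. -/
theorem Domain.exists_smoothFn_eq {F : E d → ℝ} {x₀ : E d} {ρ R : ℝ} (hρ : 0 < ρ) (hR : ρ < R)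
    (hF : ContDiffOn ℝ ∞ F (D.space.carrier ∩ Metric.ball x₀ R)) :
    ∃ f : SmoothFn D.space, (∀ x ∈ D.space.carrier, dist x x₀ ≤ ρ → ev f x = F x) ∧
      ∀ x ∈ D.space.carrier, R ≤ dist x x₀ ∨ F x = 0 → ev f x = 0 := by
  set χ : ContDiffBump x₀ := ⟨ρ, (ρ + R) / 2, hρ, by linarith⟩
  have hχs : ContDiff ℝ ∞ χ := χ.contDiff
  have hs : ContDiffOn ℝ ∞ (fun x => χ x * F x) D.space.carrier := by
    intro x hx
    by_cases h : dist x x₀ < R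
    · refine ((hχs.contDiffOn.mul hF) x ⟨hx, h⟩).mono_of_mem_nhdsWithin ?_
      exact inter_mem self_mem_nhdsWithin
        (mem_nhdsWithin_of_mem_nhds (Metric.isOpen_ball.mem_nhds h))
    · refine (contDiffWithinAt_const (c := (0 : ℝ))).congr_of_eventuallyEq ?_ ?_
      · have : {y | (ρ + R) / 2 < dist y x₀} ∈ 𝓝 x :=
          (isOpen_lt continuous_const (continuous_id.dist continuous_const)).mem_nhds
            (show (ρ + R) / 2 < dist x x₀ by linarith)
        filter_upwards [mem_nhdsWithin_of_mem_nhds this] with y hy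
        rw [χ.zero_of_le_dist (le_of_lt hy), zero_mul]
      · rw [χ.zero_of_le_dist (show (ρ + R) / 2 ≤ dist x x₀ by linarith), zero_mul]
  refine ⟨D.fn _ hs, fun x hx h => ?_, fun x hx h => ?_⟩
  · rw [D.ev_fn _ hx, χ.one_of_mem_closedBall h, one_mul]
  · rw [D.ev_fn _ hx]
    rcases h with h | h
    · rw [χ.zero_of_le_dist (show (ρ + R) / 2 ≤ dist x x₀ by linarith), zero_mul]
    · rw [h, mul_zero]

theorem Domain.ev_dx_of_eq_near {f : SmoothFn D.space} {F : E d → ℝ} {x₀ : E d} {ρ : ℝ}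
    (hf : ∀ x ∈ D.space.carrier, dist x x₀ < ρ → ev f x = F x) {x : E d}
    (hx : x ∈ D.space.carrier) (hxρ : dist x x₀ < ρ) {l : E d →L[ℝ] ℝ}
    (h : HasFDerivWithinAt F l D.space.carrier x) (i : Fin d) :
    ev (dx i f) x = l (EuclideanSpace.single i 1) := by
  rw [dx_apply]
  refine ev_grad_of_hasFDerivWithinAt hx (h.congr_of_eventuallyEq ?_ (hf x hx hxρ)) i
  filter_upwards [self_mem_nhdsWithin,
    mem_nhdsWithin_of_mem_nhds (Metric.isOpen_ball.mem_nhds (Metric.mem_ball.2 hxρ))] with y hy hyρ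
  exact hf y hy hyρ

/-- Near `x₀`, the function `ψ` is a potential of `v` and represents the functional `T`. -/
structure Represents (T : SmoothFn D.space →ₗ[ℝ] ℝ) (v : SmoothVec D.space) (x₀ : E d) (ρ : ℝ)
    (ψ : SmoothFn D.space) : Prop where
  pos : 0 < ρ
  dx_eq : ∀ x ∈ D.space.carrier, dist x x₀ < ρ → ∀ i, ev (dx i ψ) x = ev (v i) x
  apply_eq : ∀ σ : SmoothFn D.space, (∀ x ∈ D.space.carrier, ρ ≤ dist x x₀ → ev σ x = 0) →
    T σ = intS (ψ * σ)

theorem Domain.interior_mem_nhds {x : E d} (hx : D.r x < 0) : D.space.carrier ∈ 𝓝 x :=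
  mem_of_superset ((isOpen_lt D.smooth.continuous continuous_const).mem_nhds hx)
    fun y (hy : D.r y < 0) => hy.le

/-- The Poincaré lemma on a ball for the closed form `∑ vᵢ dxᵢ`, followed by a cutoff that makes the
primitive a function on all of `Ω`. -/
theorem exists_local_potential {v : SmoothVec D.space} (hcurl : ∀ i j, dx i (v j) = dx j (v i))
    {x₀ : E d} {R : ℝ} (hR : 0 < R) (hball : ∀ x ∈ Metric.ball x₀ R, D.r x < 0) :
    ∃ ψ : SmoothFn D.space, ∀ x ∈ D.space.carrier, dist x x₀ < R / 2 →
      ∀ i, ev (dx i ψ) x = ev (v i) x := by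
  set α : E d → E d →L[ℝ] ℝ := fun x => ∑ i, ev (v i) x • (EuclideanSpace.proj i : E d →L[ℝ] ℝ)
  have hsub : Metric.ball x₀ R ⊆ D.space.carrier := fun x hx => (hball x hx).le
  have hα : ContDiffOn ℝ ∞ α (Metric.ball x₀ R) :=
    ContDiffOn.sum fun i _ => ((contDiffOn_ev (v i)).mono hsub).smul contDiffOn_const
  have hd : ∀ x ∈ Metric.ball x₀ R, ∀ i, HasFDerivAt (ev (v i))
      (fderivWithin ℝ (ev (v i)) D.space.carrier x) x := fun x hx i =>
    (differentiableWithinAt_ev (v i) (hsub hx)).hasFDerivWithinAt.hasFDerivAt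
      (D.interior_mem_nhds (hball x hx))
  obtain ⟨φ, hφ⟩ := (convex_ball x₀ R).exists_forall_hasFDerivAt_of_fderiv_symmetric
    Metric.isOpen_ball (hα.differentiableOn (by simp)) fun x hx y z => by
      have h1 : HasFDerivAt α (∑ i, (fderivWithin ℝ (ev (v i)) D.space.carrier x).smulRight
          (EuclideanSpace.proj i : E d →L[ℝ] ℝ)) x :=
        HasFDerivAt.fun_sum fun i _ => (hd x hx i).smul_const (EuclideanSpace.proj i : E d →L[ℝ] ℝ)
      rw [h1.fderiv]
      simp only [sum_apply, ContinuousLinearMap.smulRight_apply, smul_apply,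
        fderivWithin_ev_apply _ (hsub hx), smul_eq_mul, Finset.sum_mul]
      rw [Finset.sum_comm]
      refine Finset.sum_congr rfl fun i _ => Finset.sum_congr rfl fun j _ => ?_
      rw [hcurl i j]
      change y i * _ * z j = z j * _ * y i
      ring
  have hφs : ContDiffOn ℝ ∞ φ (Metric.ball x₀ R) := by
    rw [contDiffOn_infty_iff_fderiv_of_isOpen Metric.isOpen_ball]
    exact ⟨fun x hx => (hφ x hx).differentiableAt.differentiableWithinAt,
      hα.congr fun x hx => (hφ x hx).fderiv⟩
  obtain ⟨ψ, hψ, -⟩ := D.exists_smoothFn_eq (half_pos hR) (half_lt_self hR)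
    (hφs.mono inter_subset_right)
  refine ⟨ψ, fun x hx hxR i => ?_⟩
  have hxb : x ∈ Metric.ball x₀ R := Metric.mem_ball.2 (hxR.trans (half_lt_self hR))
  rw [D.ev_dx_of_eq_near (fun y hy hyR => hψ y hy hyR.le) hx hxR (hφ x hxb).hasFDerivWithinAt i]
  simp [α]

theorem exists_cube_subset_ball (x₀ : E d) {R : ℝ} (hR : 0 < R) :
    ∃ δ > 0, ∀ x : E d, (∀ j, |x j - x₀ j| < δ) → dist x x₀ < R := by
  have hc : Continuous fun y : Fin d → ℝ => (WithLp.toLp 2 y : E d) := PiLp.continuous_toLp 2 _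
  have ho : (fun y : Fin d → ℝ => (WithLp.toLp 2 y : E d)) ⁻¹' Metric.ball x₀ R ∈ 𝓝 (x₀ : Fin d → ℝ) :=
    hc.continuousAt.preimage_mem_nhds (Metric.ball_mem_nhds _ hR)
  obtain ⟨δ, hδ, hs⟩ := Metric.mem_nhds_iff.1 ho
  refine ⟨δ, hδ, fun x hx => ?_⟩
  exact hs (show (x : Fin d → ℝ) ∈ Metric.ball (x₀ : Fin d → ℝ) δ from (dist_pi_lt_iff hδ).2 hx)

variable {T : SmoothFn D.space →ₗ[ℝ] ℝ} {v : SmoothVec D.space}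

/-- After integration by parts only the values of `∇ψ` where `m` is nonzero matter, so a local
potential suffices to evaluate `T` on the divergence of a localized field. -/
theorem apply_divS_eq_of_potential
    (hT : ∀ m : SmoothVec D.space, (D.space.NoFlux fun i => ev (m i)) →
      T (divS m) = -intS (∑ i, m i * v i)) {ψ : SmoothFn D.space} {m : SmoothVec D.space}
    (hm : D.space.NoFlux fun i => ev (m i))
    (h : ∀ x ∈ D.space.carrier, ∀ i, ev (m i) x = 0 ∨ ev (dx i ψ) x = ev (v i) x) :
    T (divS m) = intS (ψ * divS m) := by
  rw [hT m hm, intS_mul_divS ψ m hm]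
  congr 2
  refine Finset.sum_congr rfl fun i _ => SmoothFn.ext_carrier fun x hx => ?_
  rw [ev_mul, ev_mul]
  rcases h x hx i with h | h
  · rw [h, zero_mul, zero_mul]
  · rw [h]

theorem intS_constFn_mul {Ω : SampleSpace d} (c : ℝ) (f : SmoothFn Ω) :
    intS (constFn Ω c * f) = c * intS f := by
  have : constFn Ω c * f = c • f := SmoothFn.ext_carrier fun x hx => by
    rw [ev_mul, ev_constFn c hx, ev_smul]
  rw [this, map_smul, smul_eq_mul]

/-- For `σ` supported in a small cube write `σ = div m + κ b` with `b` fixed. `T` and integration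
against `ψ` agree on `div m`, so they differ by `κ` times a number that depends on `b` only. As `κ`
is proportional to `∫ σ`, adding a constant to `ψ` removes the difference. -/
theorem exists_represents_of_interior (hcurl : ∀ i j, dx i (v j) = dx j (v i))
    (hT : ∀ m : SmoothVec D.space, (D.space.NoFlux fun i => ev (m i)) →
      T (divS m) = -intS (∑ i, m i * v i)) {x₀ : E d} (hx₀ : D.r x₀ < 0) :
    ∃ ρ ψ, Represents T v x₀ ρ ψ := by
  obtain ⟨R, hR, hball⟩ := Metric.mem_nhds_iff.1
    ((isOpen_lt D.smooth.continuous continuous_const).mem_nhds (show D.r x₀ < D.r x₀ / 2 by linarith))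
  replace hball : ∀ x ∈ Metric.ball x₀ R, D.r x < D.r x₀ / 2 := fun x hx => hball hx
  obtain ⟨ψ, hψ⟩ := exists_local_potential hcurl hR fun x hx => by linarith [hball x hx]
  obtain ⟨δ, hδ, hcube⟩ := exists_cube_subset_ball x₀ (half_pos hR)
  have hcube' : ∀ x, R / 2 ≤ dist x x₀ → ∃ j, δ ≤ |x j - x₀ j| := fun x hx => by
    by_contra! h
    exact absurd (hcube x h) (not_lt.2 hx)
  obtain ⟨b, hb, hdec⟩ := exists_divS_add_smul D x₀ hδ (δ' := -(D.r x₀ / 2)) (by linarith)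
    fun x hx => by
      rw [neg_neg]
      exact (hball x (Metric.ball_subset_ball (half_le_self hR.le) (hcube x hx))).le
  have hout : ∀ x : E d, (∃ j, δ ≤ |x j - x₀ j|) → δ ≤ dist x x₀ := by
    rintro x ⟨j, hj⟩
    refine hj.trans ?_
    rw [dist_eq_norm]
    exact PiLp.norm_apply_le (x - x₀) j
  have key : ∀ σ : SmoothFn D.space, (∀ x ∈ D.space.carrier, δ ≤ dist x x₀ → ev σ x = 0) →
      ∃ κ, intS σ = κ * intS b ∧ T σ = intS (ψ * σ) + κ * (T b - intS (ψ * b)) := by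
    intro σ hσ
    obtain ⟨m, κ, hm, hσm⟩ := hdec σ fun x hx hxo => hσ x hx (hout x hxo)
    have hmn : D.space.NoFlux fun i => ev (m i) := fun x hx => by
      have hxo : ∃ j, δ ≤ |x j - x₀ j| := by
        refine hcube' x (not_lt.1 fun h => ?_)
        have := hball x (Metric.ball_subset_ball (half_le_self hR.le) h)
        rw [hx] at this
        linarith
      exact Finset.sum_eq_zero fun i _ => 
        mul_eq_zero_of_left (hm i x (show D.r x ≤ 0 from hx.le) hxo) _
    have hTm := apply_divS_eq_of_potential hT (ψ := ψ) hmn fun x hx i => by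
      by_cases h : dist x x₀ < R / 2
      · exact Or.inr (hψ x hx h i)
      · exact Or.inl (hm i x hx (hcube' x (not_lt.1 h)))
    refine ⟨κ, ?_, ?_⟩
    · rw [hσm, map_add, intS_divS m hmn, zero_add, map_smul, smul_eq_mul]
    · rw [hσm, map_add, hTm, mul_add, map_add, mul_smul_comm, map_smul, map_smul, smul_eq_mul,
        smul_eq_mul]
      ring
  -- A bump has positive integral, and that integral is a multiple of `∫ b`.
  have hb0 : intS b ≠ 0 := by
    obtain ⟨κ, hκ, -⟩ := key (D.bump x₀ hδ) fun x hx => Domain.ev_bump_of_ge hδ hx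
    have hpos : 0 < intS (D.bump x₀ hδ) := intS_pos (fun x hx => Domain.ev_bump_nonneg hδ hx)
      fun h => by
        have := Domain.ev_bump_of_le (D := D) (x := x₀) hδ (show D.r x₀ ≤ 0 from hx₀.le)
          (by rw [dist_self]; linarith)
        rw [h, ev_zero] at this
        exact zero_ne_one this
    intro h
    rw [hκ, h, mul_zero] at hpos
    exact hpos.false
  set C := (T b - intS (ψ * b)) / intS b with hC
  refine ⟨min δ (R / 2), ψ + constFn D.space C, lt_min hδ (half_pos hR), fun x hx hxδ i => ?_,
    fun σ hσ => ?_⟩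
  · rw [map_add, dx_constFn, add_zero, hψ x hx (hxδ.trans_le (min_le_right _ _))]
  · obtain ⟨κ, hκ, hTσ⟩ := key σ fun x hx h => hσ x hx ((min_le_left _ _).trans h)
    rw [hTσ, add_mul, map_add, intS_constFn_mul, hκ, hC]
    field_simp

end LocalPotential

/-! ### Local potentials at boundary points. -/

section BoundaryPotential

open Filter Topology

variable {d : ℕ} {D : Domain d} {x₀ : E d}

theorem BoundaryChart.add_smul_le (c : BoundaryChart D.r x₀) {x : E d}
    (hx : x ∈ Metric.ball x₀ c.radius) {s : ℝ} (hs : s ∈ Icc 0 c.height) :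
    D.r (x + s • c.dir) ≤ D.r x - s := by
  have := c.decrease x hx (-s) 0 (by rw [abs_neg, abs_of_nonneg hs.1]; exact hs.2)
    (by rw [abs_zero]; exact c.height_pos.le) (by linarith [hs.1])
  rw [neg_smul, sub_neg_eq_add, zero_smul, sub_zero] at this
  linarith

theorem Domain.locallyQuasiconvex_inter_ball (x₀ : E d) (R : ℝ) :
    LocallyQuasiconvex (D.space.carrier ∩ Metric.ball x₀ R) :=
  D.space.locallyQuasiconvex_carrier.inter_isOpen Metric.isOpen_ball

theorem Domain.uniqueDiffOn_inter_ball (x₀ : E d) (R : ℝ) :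
    UniqueDiffOn ℝ (D.space.carrier ∩ Metric.ball x₀ R) :=
  D.space.uniqueDiffOn_carrier.inter Metric.isOpen_ball

/-- The integral of `q` over the segments `[x, x + S • e]`. -/
def segmentInt (q : SmoothFn D.space) (e : E d) (S : ℝ) (x : E d) : ℝ :=
  ∫ τ in Icc (0 : ℝ) S, ev q (x + τ • e)

section LineInt

variable {q : SmoothFn D.space} {e : E d} {S R : ℝ}

theorem hasFDerivWithinAt_ev_add (f : SmoothFn D.space) {A : Set (E d)} {y x : E d}
    (h : ∀ x ∈ A, x + y ∈ D.space.carrier) (hx : x ∈ A) :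
    HasFDerivWithinAt (fun x => ev f (x + y))
      (fderivWithin ℝ (ev f) D.space.carrier (x + y)) A x := by
  have := (differentiableWithinAt_ev f (h x hx)).hasFDerivWithinAt.comp x
    ((hasFDerivAt_id x).add_const y).hasFDerivWithinAt
    (show MapsTo (fun x => x + y) A D.space.carrier from fun x hx => h x hx)
  exact this

theorem contDiffOn_segmentInt (hS : 0 < S)
    (hmem : ∀ x ∈ D.space.carrier ∩ Metric.ball x₀ R, ∀ τ ∈ Icc 0 S, x + τ • e ∈ D.space.carrier) :
    ContDiffOn ℝ ∞ (segmentInt q e S) (D.space.carrier ∩ Metric.ball x₀ R) := by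
  refine (D.locallyQuasiconvex_inter_ball x₀ R).contDiffOn_integral
    (D.uniqueDiffOn_inter_ball x₀ R) (isCompact_Icc (a := (0 : ℝ)) (b := S)) (uniqueDiffOn_Icc hS)
    (ae_restrict_mem measurableSet_Icc) (F := fun p : E d × ℝ => ev q (p.1 + p.2 • e)) ?_
  exact ContDiffOn.comp (g := ev q) (f := fun p : E d × ℝ => p.1 + p.2 • e) (contDiffOn_ev q)
    (by fun_prop) fun p hp => hmem p.1 hp.1 p.2 hp.2

theorem continuousOn_fderivWithin_ev_line (f : SmoothFn D.space) {x : E d}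
    (hmem : ∀ τ ∈ Icc 0 S, x + τ • e ∈ D.space.carrier) :
    ContinuousOn (fun τ : ℝ => fderivWithin ℝ (ev f) D.space.carrier (x + τ • e)) (Icc 0 S) :=
  ContinuousOn.comp (g := fderivWithin ℝ (ev f) D.space.carrier) (f := fun τ : ℝ => x + τ • e)
    ((contDiffOn_ev f).continuousOn_fderivWithin D.space.uniqueDiffOn_carrier (by simp))
    (by fun_prop) fun τ hτ => hmem τ hτ

theorem hasFDerivWithinAt_segmentInt
    (hmem : ∀ x ∈ D.space.carrier ∩ Metric.ball x₀ R, ∀ τ ∈ Icc 0 S, x + τ • e ∈ D.space.carrier)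
    {x : E d} (hx : x ∈ D.space.carrier ∩ Metric.ball x₀ R) :
    HasFDerivWithinAt (segmentInt q e S)
      (∫ τ in Icc (0 : ℝ) S, fderivWithin ℝ (ev q) D.space.carrier (x + τ • e))
      (D.space.carrier ∩ Metric.ball x₀ R) x := by
  have hmaps : MapsTo (fun p : E d × ℝ => p.1 + p.2 • e)
      ((D.space.carrier ∩ Metric.ball x₀ R) ×ˢ Icc 0 S) D.space.carrier :=
    fun p hp => hmem p.1 hp.1 p.2 hp.2
  have hshift : ContinuousOn (fun p : E d × ℝ => p.1 + p.2 • e)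
      ((D.space.carrier ∩ Metric.ball x₀ R) ×ˢ Icc 0 S) := by fun_prop
  exact (D.locallyQuasiconvex_inter_ball x₀ R).hasFDerivWithinAt_integral
    (isCompact_Icc (a := (0 : ℝ)) (b := S)) (μ := volume.restrict (Icc (0 : ℝ) S))
    (ae_restrict_mem measurableSet_Icc)
    (F := fun p : E d × ℝ => ev q (p.1 + p.2 • e))
    (D := fun p => fderivWithin ℝ (ev q) D.space.carrier (p.1 + p.2 • e))
    (fun x hx τ hτ => hasFDerivWithinAt_ev_add q (fun y hy => hmem y hy τ hτ) hx)
    (ContinuousOn.comp (g := ev q) (contDiffOn_ev q).continuousOn hshift hmaps)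
    (ContinuousOn.comp (g := fderivWithin ℝ (ev q) D.space.carrier)
      ((contDiffOn_ev q).continuousOn_fderivWithin D.space.uniqueDiffOn_carrier (by simp))
      hshift hmaps) hx

/-- The fundamental theorem of calculus on a segment, for a function with directional derivative
`dx i q`. -/
theorem integral_fderivWithin_line {f : SmoothFn D.space} (hS : 0 ≤ S) {i : Fin d}
    (hf : ∑ j, e j • dx j f = dx i q) {x : E d}
    (hmem : ∀ τ ∈ Icc 0 S, x + τ • e ∈ D.space.carrier) :
    (∫ τ in Icc (0 : ℝ) S, fderivWithin ℝ (ev q) D.space.carrier (x + τ • e))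
      (EuclideanSpace.single i 1) = ev f (x + S • e) - ev f x := by
  have hc := continuousOn_fderivWithin_ev_line q hmem
  rw [ContinuousLinearMap.integral_apply (hc.integrableOn_compact isCompact_Icc)]
  have hline : ∀ τ ∈ Icc 0 S, HasDerivWithinAt (fun τ : ℝ => ev f (x + τ • e))
      (fderivWithin ℝ (ev q) D.space.carrier (x + τ • e) (EuclideanSpace.single i 1))
      (Icc 0 S) τ := fun τ hτ => by
    have h1 : HasDerivWithinAt (fun τ : ℝ => x + τ • e) e (Icc 0 S) τ := by
      simpa using (((hasDerivAt_id τ).smul_const e).const_add x).hasDerivWithinAt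
    refine ((differentiableWithinAt_ev f (hmem τ hτ)).hasFDerivWithinAt.comp_hasDerivWithinAt τ h1
      fun s hs => hmem s hs).congr_deriv ?_
    rw [fderivWithin_ev_apply _ (hmem τ hτ), ← ev_dx _ _ (hmem τ hτ), ← hf, ev_sum]
    exact Finset.sum_congr rfl fun j _ => (ev_smul _ _ _).symm
  have hFTC := intervalIntegral.integral_eq_sub_of_hasDeriv_right_of_le hS
    (fun τ hτ => (hline τ hτ).continuousWithinAt)
    (fun τ hτ => ((hline τ (Ioo_subset_Icc_self hτ)).hasDerivAt
      (Icc_mem_nhds hτ.1 hτ.2)).hasDerivWithinAt)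
    ((hc.clm_apply continuousOn_const).intervalIntegrable_of_Icc hS)
  rwa [intervalIntegral.integral_of_le hS, ← integral_Icc_eq_integral_Ioc, zero_smul,
    add_zero] at hFTC

end LineInt

/-- The potential is carried from an interior point along the inward direction `e`: `ψ x = φ (x + S
e) - ∫₀ˢ (e·v) (x + τ e) dτ`. As `v` is curl-free, `∂ᵢ (e·v)` is the derivative of `vᵢ` along `e`,
and the fundamental theorem of calculus leaves `vᵢ x`. -/
theorem exists_potential_of_boundary {v : SmoothVec D.space}
    (hcurl : ∀ i j, dx i (v j) = dx j (v i)) (c : BoundaryChart D.r x₀) (h0 : D.r x₀ = 0) :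
    ∃ R > 0, ∃ ψ : SmoothFn D.space, ∀ x ∈ D.space.carrier, dist x x₀ < R →
      ∀ i, ev (dx i ψ) x = ev (v i) x := by
  have hS : 0 < c.height := c.height_pos
  have hP : D.r (x₀ + c.height • c.dir) < 0 := by
    have := c.add_smul_le (Metric.mem_ball_self c.radius_pos) (right_mem_Icc.2 hS.le)
    rw [h0] at this
    linarith
  obtain ⟨R', hR', hball⟩ := Metric.mem_nhds_iff.1
    ((isOpen_lt D.smooth.continuous continuous_const).mem_nhds hP)
  obtain ⟨φ, hφ⟩ := exists_local_potential hcurl hR' fun x hx => hball hx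
  obtain ⟨R, hR, hRc, hR2⟩ : ∃ R > 0, R ≤ c.radius ∧ R ≤ R' / 2 :=
    ⟨min c.radius (R' / 2), lt_min c.radius_pos (half_pos hR'), min_le_left _ _, min_le_right _ _⟩
  have hmem : ∀ x ∈ D.space.carrier ∩ Metric.ball x₀ R, ∀ τ ∈ Icc 0 c.height,
      x + τ • c.dir ∈ D.space.carrier := fun x hx τ hτ => by
    have h1 := c.add_smul_le (Metric.ball_subset_ball hRc hx.2) hτ
    have h2 : D.r x ≤ 0 := hx.1
    exact show D.r (x + τ • c.dir) ≤ 0 by linarith [hτ.1]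
  have hSm := right_mem_Icc.2 hS.le
  have hφs : ContDiffOn ℝ ∞ (fun x => ev φ (x + c.height • c.dir))
      (D.space.carrier ∩ Metric.ball x₀ R) :=
    ContDiffOn.comp (g := ev φ) (f := fun x => x + c.height • c.dir) (contDiffOn_ev φ)
      (by fun_prop) fun x hx => hmem x hx _ hSm
  obtain ⟨ψ, hψ, -⟩ := D.exists_smoothFn_eq (half_pos hR) (half_lt_self hR)
    (hφs.sub (contDiffOn_segmentInt (q := ∑ j, c.dir j • v j) hS hmem))
  refine ⟨R / 2, half_pos hR, ψ, fun x hx hxR i => ?_⟩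
  have hxA : x ∈ D.space.carrier ∩ Metric.ball x₀ R := ⟨hx, hxR.trans (half_lt_self hR)⟩
  have hdist : dist (x + c.height • c.dir) (x₀ + c.height • c.dir) < R' / 2 := by
    rw [dist_add_right]
    exact (Metric.mem_ball.1 hxA.2).trans_le hR2
  have hd := ((hasFDerivWithinAt_ev_add φ (fun y hy => hmem y hy _ hSm) hxA).sub
    (hasFDerivWithinAt_segmentInt (q := ∑ j, c.dir j • v j) hmem hxA)).mono_of_mem_nhdsWithin
    (s := D.space.carrier) (inter_mem self_mem_nhdsWithin
      (mem_nhdsWithin_of_mem_nhds (Metric.isOpen_ball.mem_nhds hxA.2)))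
  rw [D.ev_dx_of_eq_near (fun y hy hyR => hψ y hy hyR.le) hx hxR hd i, sub_apply,
    ← ev_dx φ i (hmem x hxA _ hSm), hφ _ (hmem x hxA _ hSm) hdist,
    integral_fderivWithin_line hS.le (f := v i) ?_ (hmem x hxA), sub_sub_cancel]
  rw [map_sum]
  exact Finset.sum_congr rfl fun j _ => by rw [map_smul, hcurl]

end BoundaryPotential

/-! ### Integrals along segments to the boundary. -/

section Tube

open Filter Topology

variable {d : ℕ} {D : Domain d} {x₀ : E d} (c : BoundaryChart D.r x₀) (σ : SmoothFn D.space)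

/-- The integral of `σ` over the segment from a point near `x₀` to the boundary. -/
def tubeInt (x : E d) : ℝ := ∫ τ in (0 : ℝ)..(c.time x), ev σ (x - τ • c.dir)

variable {c σ}

theorem contDiffOn_tubeInt {R : ℝ} (hR : R ≤ c.radius) :
    ContDiffOn ℝ ∞ (tubeInt c σ) (D.space.carrier ∩ Metric.ball x₀ R) := by
  have hsub := Metric.ball_subset_ball (x := x₀) hR
  simp only [funext fun x => show tubeInt c σ x = _ from integral_eq_mul_integral_unitInterval _ _ _]
  refine (D.locallyQuasiconvex_inter_ball x₀ R).contDiffOn_integral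
    (D.uniqueDiffOn_inter_ball x₀ R) (isCompact_Icc (a := (0 : ℝ)) (b := 1))
    uniqueDiffOn_unitInterval (ae_restrict_mem measurableSet_Icc)
    (F := fun p : E d × ℝ => (c.time p.1 - 0) *
      ev σ (p.1 - (0 + (c.time p.1 - 0) * p.2) • c.dir)) ?_
  have ht : ContDiffOn ℝ ∞ (fun p : E d × ℝ => c.time p.1 - 0)
      ((D.space.carrier ∩ Metric.ball x₀ R) ×ˢ Icc 0 1) :=
    (c.smooth.comp contDiffOn_fst fun p hp => hsub hp.1.2).sub contDiffOn_const
  refine ht.mul ((contDiffOn_ev σ).comp (contDiffOn_fst.sub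
    ((contDiffOn_const.add (ht.mul contDiffOn_snd)).smul contDiffOn_const)) fun p hp => ?_)
  have h0 := c.time_nonneg (hsub hp.1.2) hp.1.1
  rw [sub_zero, zero_add]
  exact c.nonpos_of_le_time (hsub hp.1.2) (mul_nonneg h0 hp.2.1) (mul_le_of_le_one_right h0 hp.2.2)

theorem tubeInt_eq_zero {x : E d} (h0 : 0 ≤ c.time x)
    (h : ∀ τ ∈ Icc 0 (c.time x), ev σ (x - τ • c.dir) = 0) : tubeInt c σ x = 0 := by
  refine intervalIntegral.integral_zero_ae (Filter.Eventually.of_forall fun τ hτ => ?_)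
  rw [uIoc_of_le h0] at hτ
  exact h τ (Ioc_subset_Icc_self hτ)

/-- Moving `x` inwards by `h` lengthens the segment at its inner end: after a shift of the variable
the integral runs from `-h` to `time x` along the fixed line. The derivative is one-sided because
`x` may lie on the boundary. -/
theorem exists_hasDerivWithinAt_tubeInt {R : ℝ} (hR : R ≤ c.radius) {x : E d}
    (hx : x ∈ D.space.carrier) (hxR : x ∈ Metric.ball x₀ R) :
    ∃ h₀ > 0, (∀ h ∈ Icc 0 h₀, x + h • c.dir ∈ D.space.carrier ∧ x + h • c.dir ∈ Metric.ball x₀ R ∧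
      c.time (x + h • c.dir) = c.time x + h) ∧
      HasDerivWithinAt (fun h : ℝ => tubeInt c σ (x + h • c.dir)) (ev σ x) (Icc 0 h₀) 0 := by
  have hxr := Metric.ball_subset_ball hR hxR
  have ht0 := c.time_nonneg hxr hx
  have hth := (le_abs_self _).trans_lt (c.abs_time_lt x hxr)
  have hcont : Continuous fun h : ℝ => x + h • c.dir := by fun_prop
  obtain ⟨ε, hε, hεball⟩ := Metric.mem_nhds_iff.1 (hcont.continuousAt.preimage_mem_nhds (x := 0)
    (Metric.isOpen_ball.mem_nhds (show x + (0 : ℝ) • c.dir ∈ Metric.ball x₀ R by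
      rwa [zero_smul, add_zero])))
  set h₀ := min (ε / 2) (c.height - c.time x)
  have hh₀ : 0 < h₀ := lt_min (half_pos hε) (by linarith)
  have hle : ∀ h ∈ Icc 0 h₀, h ≤ c.height - c.time x := fun h hh => hh.2.trans (min_le_right _ _)
  have hcar : ∀ h ∈ Icc 0 h₀, x + h • c.dir ∈ D.space.carrier := fun h hh => by
    have h1 := c.add_smul_le hxr (s := h) ⟨hh.1, by linarith [hle h hh]⟩
    have h2 : D.r x ≤ 0 := hx
    exact show D.r (x + h • c.dir) ≤ 0 by linarith [hh.1]
  have hball : ∀ h ∈ Icc 0 h₀, x + h • c.dir ∈ Metric.ball x₀ R := fun h hh => hεball (by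
    rw [Metric.mem_ball, dist_zero_right, Real.norm_of_nonneg hh.1]
    linarith [hh.2.trans (min_le_left _ _)])
  have htime : ∀ h ∈ Icc 0 h₀, c.time (x + h • c.dir) = c.time x + h := fun h hh => by
    have := c.time_sub_smul (s := -h) hxr
      (by rw [neg_smul, sub_neg_eq_add]; exact Metric.ball_subset_ball hR (hball h hh))
      (by rw [sub_neg_eq_add, abs_of_nonneg (by linarith [hh.1])]; linarith [hle h hh])
    rwa [neg_smul, sub_neg_eq_add, sub_neg_eq_add] at this
  refine ⟨h₀, hh₀, fun h hh => ⟨hcar h hh, hball h hh, htime h hh⟩, ?_⟩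
  set q : ℝ → ℝ := fun τ => ev σ (x - τ • c.dir) with hq
  have hqc : ContinuousOn q (Icc (-h₀) (c.time x)) := by
    refine (contDiffOn_ev σ).continuousOn.comp (by fun_prop) fun τ hτ => ?_
    rcases le_total 0 τ with h | h
    · exact c.nonpos_of_le_time hxr h hτ.2
    · have := hcar (-τ) ⟨by linarith, by linarith [hτ.1]⟩
      rwa [neg_smul, ← sub_eq_add_neg] at this
  have hF : ∀ h ∈ Icc 0 h₀, tubeInt c σ (x + h • c.dir) = ∫ τ in (-h)..(c.time x), q τ := fun h hh => by
    rw [tubeInt, htime h hh]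
    have := intervalIntegral.integral_comp_sub_right (a := 0) (b := c.time x + h) q h
    rw [zero_sub, add_sub_cancel_right] at this
    rw [← this]
    refine intervalIntegral.integral_congr fun τ _ => ?_
    simp only [hq, sub_smul]
    congr 1
    abel
  have hfact : Fact ((0 : ℝ) ∈ Icc (-h₀) 0) := ⟨⟨by linarith, le_rfl⟩⟩
  have hq' := hqc.mono (Icc_subset_Icc_right ht0)
  have hint := intervalIntegral.integral_hasDerivWithinAt_left (a := 0) (b := c.time x)
    (s := Icc (-h₀) 0) (t := Icc (-h₀) 0) (f := q)
    ((hqc.mono (Icc_subset_Icc_left (by linarith))).intervalIntegrable_of_Icc ht0)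
    (hq'.stronglyMeasurableAtFilter_nhdsWithin measurableSet_Icc 0) (hq' 0 hfact.out)
  have hneg : HasDerivWithinAt (fun h : ℝ => -h) (-1) (Icc 0 h₀) 0 := (hasDerivWithinAt_id _ _).neg
  have hz : (0 : ℝ) ∈ Icc 0 h₀ := ⟨le_rfl, hh₀.le⟩
  have hcomp := HasDerivWithinAt.comp (h := fun h : ℝ => -h)
    (h₂ := fun u => ∫ τ in u..(c.time x), q τ) (s' := Icc (-h₀) 0) (h₂' := -q 0) 0
    (by rw [neg_zero]; exact hint) hneg
    fun h hh => ⟨by linarith [hh.2], by linarith [hh.1]⟩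
  refine (hcomp.congr_deriv ?_).congr hF (hF 0 hz)
  simp [hq]

end Tube

/-! ### Representation of the functional near the boundary. -/

section BoundaryRepresents

open Filter Topology

variable {d : ℕ} {D : Domain d} {x₀ : E d}

theorem sum_mul_ev_dx_eq_of_hasDerivWithinAt {Ω : SampleSpace d} (f : SmoothFn Ω) {x e : E d}
    (hx : x ∈ Ω.carrier) {h₀ : ℝ} (hh₀ : 0 < h₀) (hmem : ∀ h ∈ Icc 0 h₀, x + h • e ∈ Ω.carrier)
    {a : ℝ} (ha : HasDerivWithinAt (fun h : ℝ => ev f (x + h • e)) a (Icc 0 h₀) 0) :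
    ∑ i, e i * ev (dx i f) x = a := by
  have h1 : HasDerivWithinAt (fun h : ℝ => x + h • e) e (Icc 0 h₀) 0 := by
    simpa using (((hasDerivAt_id (0 : ℝ)).smul_const e).const_add x).hasDerivWithinAt
  have h2 : HasFDerivWithinAt (ev f) (fderivWithin ℝ (ev f) Ω.carrier x) Ω.carrier
      (x + (0 : ℝ) • e) := by
    rw [zero_smul, add_zero]
    exact (differentiableWithinAt_ev f hx).hasFDerivWithinAt
  have h3 := h2.comp_hasDerivWithinAt (0 : ℝ) h1 fun h hh => hmem h hh
  rw [← fderivWithin_ev_apply f hx]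
  exact (uniqueDiffOn_Icc hh₀ 0 ⟨le_rfl, hh₀.le⟩).eq_deriv _ h3 ha

theorem exists_ne_zero_of_tubeInt_ne_zero {c : BoundaryChart D.r x₀} {σ : SmoothFn D.space} {x : E d}
    (h0 : 0 ≤ c.time x) (h : tubeInt c σ x ≠ 0) :
    ∃ τ ∈ Icc 0 (c.time x), ev σ (x - τ • c.dir) ≠ 0 := by
  by_contra! hall
  exact h (tubeInt_eq_zero h0 hall)

/-- A function supported near a boundary point is, up to the divergence of a field that vanishes
on the boundary, a function supported near an interior point. -/
theorem exists_divS_add_of_boundary (c : BoundaryChart D.r x₀) {R s κ η : ℝ} (hR : 0 < R)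
    (hRc : R ≤ c.radius) (hκ : 0 < κ) (hκs : 2 * κ ≤ s) (hηR : η ≤ R)
    (hN : η + (s + κ) * ‖c.dir‖ ≤ R / 2)
    (hη : ∀ x ∈ D.space.carrier, dist x x₀ < η → c.time x < κ) {σ : SmoothFn D.space}
    (hσ : ∀ x ∈ D.space.carrier, η ≤ dist x x₀ → ev σ x = 0) :
    ∃ (m : SmoothVec D.space) (g : SmoothFn D.space), (D.space.NoFlux fun i => ev (m i)) ∧
      (∀ i, ∀ x ∈ D.space.carrier, R ≤ dist x x₀ → ev (m i) x = 0) ∧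
      (∀ x ∈ D.space.carrier, η + 2 * κ * ‖c.dir‖ ≤ dist x (x₀ + s • c.dir) → ev g x = 0) ∧
      σ = divS m + g := by
  have hsub := Metric.ball_subset_ball (x := x₀) hRc
  have hts : ContDiffOn ℝ ∞ (fun x => c.time x - s) (D.space.carrier ∩ Metric.ball x₀ R) :=
    (c.smooth.mono (inter_subset_right.trans hsub)).sub contDiffOn_const
  have hU := contDiffOn_tubeInt (σ := σ) hRc
  -- The field `F • dir` carries the mass of `σ` inwards and is switched off around depth `s`; `G`
  -- is the mass deposited there. Along `dir` the derivative of `F` is `σ - G`, because the step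
  -- vanishes on the support of `σ`.
  set F : E d → ℝ := fun x => (1 - smoothStep κ (c.time x - s)) * tubeInt c σ x with hF
  set G : E d → ℝ := fun x => stepDeriv κ (c.time x - s) * tubeInt c σ x with hG
  have hFs : ContDiffOn ℝ ∞ F (D.space.carrier ∩ Metric.ball x₀ R) :=
    (contDiffOn_const.sub ((contDiff_smoothStep κ).comp_contDiffOn hts)).mul hU
  have hGs : ContDiffOn ℝ ∞ G (D.space.carrier ∩ Metric.ball x₀ R) :=
    ((contDiff_stepDeriv κ).comp_contDiffOn hts).mul hU
  -- a nonzero tube integral comes from a point in the support of `σ`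
  have hpt : ∀ x ∈ D.space.carrier, dist x x₀ < R → tubeInt c σ x ≠ 0 →
      ∃ τ, 0 ≤ τ ∧ τ ≤ c.time x ∧ dist (x - τ • c.dir) x₀ < η ∧ c.time x - τ < κ := by
    intro x hx hxR h
    have hxr : x ∈ Metric.ball x₀ c.radius := hsub hxR
    obtain ⟨τ, hτ, hne⟩ := exists_ne_zero_of_tubeInt_ne_zero (c.time_nonneg hxr hx) h
    have hy : x - τ • c.dir ∈ D.space.carrier := c.nonpos_of_le_time hxr hτ.1 hτ.2
    have hd : dist (x - τ • c.dir) x₀ < η := by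
      by_contra! hd
      exact hne (hσ _ hy hd)
    refine ⟨τ, hτ.1, hτ.2, hd, ?_⟩
    have := hη _ hy hd
    rwa [c.time_sub_smul hxr (hsub (hd.trans_le hηR)) (by
      rw [abs_of_nonneg (by linarith [hτ.2])]
      linarith [hτ.1, (le_abs_self _).trans_lt (c.abs_time_lt x hxr)])] at this
  have hdist : ∀ (x : E d) (τ s : ℝ),
      dist x (x₀ + s • c.dir) ≤ dist (x - τ • c.dir) x₀ + |τ - s| * ‖c.dir‖ := fun x τ s => by
    rw [dist_eq_norm, dist_eq_norm, ← Real.norm_eq_abs, ← norm_smul]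
    refine le_trans (le_of_eq ?_) (norm_add_le _ _)
    rw [sub_smul]
    congr 1
    abel
  have hF0 : ∀ x ∈ D.space.carrier, dist x x₀ < R → R / 2 ≤ dist x x₀ → F x = 0 := by
    intro x hx hxR hxR2
    by_contra hne
    obtain ⟨τ, h0, h1, h2, -⟩ := hpt x hx hxR (right_ne_zero_of_mul hne)
    have h3 : c.time x < s + κ := by
      by_contra! h
      rw [hF] at hne
      dsimp only at hne
      rw [smoothStep_of_le hκ (by linarith), sub_self, zero_mul] at hne
      exact hne rfl
    have h4 := hdist x τ 0
    rw [zero_smul, add_zero, sub_zero, abs_of_nonneg h0] at h4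
    have h5 : τ * ‖c.dir‖ ≤ (s + κ) * ‖c.dir‖ := by gcongr; linarith
    linarith
  have hG0 : ∀ x ∈ D.space.carrier, dist x x₀ < R →
      η + 2 * κ * ‖c.dir‖ ≤ dist x (x₀ + s • c.dir) → G x = 0 := by
    intro x hx hxR hxp
    by_contra hne
    obtain ⟨τ, h0, h1, h2, h3⟩ := hpt x hx hxR (right_ne_zero_of_mul hne)
    have h4 : |c.time x - s| < κ := by
      by_contra! h
      exact hne (by rw [hG]; dsimp only; rw [stepDeriv_eq_zero hκ h, zero_mul])
    rw [abs_lt] at h4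
    have h5 : |τ - s| * ‖c.dir‖ ≤ 2 * κ * ‖c.dir‖ := by
      gcongr
      exact abs_le.2 ⟨by linarith, by linarith⟩
    linarith [hdist x τ s]
  have hG1 : ∀ x ∈ D.space.carrier, dist x x₀ < R → R / 2 ≤ dist x x₀ → G x = 0 := by
    intro x hx hxR hxR2
    by_contra hne
    obtain ⟨τ, h0, h1, h2, h3⟩ := hpt x hx hxR (right_ne_zero_of_mul hne)
    have h4 : |c.time x - s| < κ := by
      by_contra! h
      exact hne (by rw [hG]; dsimp only; rw [stepDeriv_eq_zero hκ h, zero_mul])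
    rw [abs_lt] at h4
    have h6 := hdist x τ 0
    rw [zero_smul, add_zero, sub_zero, abs_of_nonneg h0] at h6
    have h5 : τ * ‖c.dir‖ ≤ (s + κ) * ‖c.dir‖ := by gcongr; linarith
    linarith
  obtain ⟨f, hf, hf'⟩ := D.exists_smoothFn_eq (half_pos hR) (half_lt_self hR) hFs
  obtain ⟨g, hg, hg'⟩ := D.exists_smoothFn_eq (half_pos hR) (half_lt_self hR) hGs
  have hfF : ∀ x ∈ D.space.carrier, dist x x₀ < R → ev f x = F x := fun x hx hxR => by
    rcases le_total (dist x x₀) (R / 2) with h | h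
    · exact hf x hx h
    · rw [hF0 x hx hxR h, hf' x hx (Or.inr (hF0 x hx hxR h))]
  have hgG : ∀ x ∈ D.space.carrier, dist x x₀ < R → ev g x = G x := fun x hx hxR => by
    rcases le_total (dist x x₀) (R / 2) with h | h
    · exact hg x hx h
    · rw [hG1 x hx hxR h, hg' x hx (Or.inr (hG1 x hx hxR h))]
  refine ⟨fun i => c.dir i • f, g, fun x hx => ?_, fun i x hx hxR => ?_, fun x hx hxp => ?_,
    SmoothFn.ext_carrier fun x hx => ?_⟩
  · have hxc : x ∈ D.space.carrier := hx.le
    -- At a boundary point the segment has length zero, so the whole field vanishes there, not only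
    -- its normal part.
    have : ev f x = 0 := by
      rcases lt_or_ge (dist x x₀) R with hxR | hxR
      · refine hf' x hxc (Or.inr ?_)
        have ht : 0 = c.time x := c.time_unique (hsub hxR)
          (by rw [abs_zero]; exact c.height_pos.le) (by rw [zero_smul, sub_zero]; exact hx)
        rw [hF]
        dsimp only
        rw [tubeInt, ← ht, intervalIntegral.integral_same, mul_zero]
      · exact hf' x hxc (Or.inl hxR)
    exact Finset.sum_eq_zero fun i _ => by dsimp only; rw [ev_smul, this, mul_zero, zero_mul]
  · rw [ev_smul, hf' x hx (Or.inl hxR), mul_zero]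
  · rcases lt_or_ge (dist x x₀) R with hxR | hxR
    · rw [hgG x hx hxR, hG0 x hx hxR hxp]
    · exact hg' x hx (Or.inl hxR)
  · have hdiv : ev (divS fun i => c.dir i • f) x = ∑ i, c.dir i * ev (dx i f) x := by
      rw [divS_apply, ev_sum]
      exact Finset.sum_congr rfl fun i _ => by rw [map_smul, ev_smul]
    rw [ev_add, hdiv]
    rcases lt_or_ge (dist x x₀) R with hxR | hxR
    · obtain ⟨h₀, hh₀, hline, hder⟩ := exists_hasDerivWithinAt_tubeInt (σ := σ) hRc hx
        (Metric.mem_ball.2 hxR)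
      have hz : (0 : ℝ) ∈ Icc 0 h₀ := ⟨le_rfl, hh₀.le⟩
      have h1 : HasDerivAt (fun h : ℝ => smoothStep κ (c.time x + h - s))
          (stepDeriv κ (c.time x - s)) 0 := by
        have h2 : HasDerivAt (fun h : ℝ => c.time x + h - s) 1 0 :=
          ((hasDerivAt_id 0).const_add _).sub_const _
        have h3 : HasDerivAt (smoothStep κ) (stepDeriv κ (c.time x - s)) (c.time x + 0 - s) := by
          rw [add_zero]
          exact hasDerivAt_smoothStep _ _
        exact (h3.comp 0 h2).congr_deriv (mul_one _)
      have h2 := ((h1.const_sub 1).hasDerivWithinAt (s := Icc 0 h₀)).mul hder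
      have h3 : HasDerivWithinAt (fun h : ℝ => ev f (x + h • c.dir)) _ (Icc 0 h₀) 0 :=
        h2.congr (fun h hh => by
          obtain ⟨a1, a2, a3⟩ := hline h hh
          rw [hfF _ a1 a2, hF]
          dsimp only
          rw [a3]; rfl) (by
          obtain ⟨a1, a2, a3⟩ := hline 0 hz
          rw [hfF _ a1 a2, hF]
          dsimp only
          rw [a3]; rfl)
      rw [sum_mul_ev_dx_eq_of_hasDerivWithinAt f hx hh₀ (fun h hh => (hline h hh).1) h3,
        hgG x hx hxR, hG]
      dsimp only
      rw [zero_smul, add_zero, add_zero]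
      -- On the support of `σ` the depth is below `κ ≤ s - κ`, so the step is still `0`.
      by_cases hxη : dist x x₀ < η
      · rw [smoothStep_of_le_neg hκ (by linarith [hη x hx hxη])]
        ring
      · rw [hσ x hx (not_lt.1 hxη)]
        ring
    · rw [hσ x hx (hηR.trans hxR), hg' x hx (Or.inl hxR), add_zero, Finset.sum_eq_zero]
      intro i _
      rw [D.ev_dx_of_eq_near (F := fun _ => 0) (x₀ := x) (ρ := R / 2) (fun y hy hyx => ?_) hx
        (by rw [dist_self]; exact half_pos hR) (hasFDerivWithinAt_const 0 x _) i]
      · simp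
      · have := dist_triangle_left x x₀ y
        rcases lt_or_ge (dist y x₀) R with hyR | hyR
        · rw [hfF y hy hyR, hF0 y hy hyR (by linarith)]
        · exact hf' y hy (Or.inl hyR)

variable {T : SmoothFn D.space →ₗ[ℝ] ℝ} {v : SmoothVec D.space}

theorem Represents.mono {p : E d} {ρ ρ' : ℝ} {ψ : SmoothFn D.space} (h : Represents T v p ρ ψ)
    (h0 : 0 < ρ') (hle : ρ' ≤ ρ) : Represents T v p ρ' ψ :=
  ⟨h0, fun x hx hxp => h.dx_eq x hx (hxp.trans_le hle),
    fun σ hσ => h.apply_eq σ fun x hx hxp => hσ x hx (hle.trans hxp)⟩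

/-- At an interior point, every potential represents `T` up to a constant. -/
theorem Represents.exists_add_constFn {p : E d} {ρ R : ℝ} {φ ψ : SmoothFn D.space}
    (h : Represents T v p ρ φ) (hp : D.r p < 0) (hR : 0 < R)
    (hψ : ∀ x ∈ D.space.carrier, dist x p < R → ∀ i, ev (dx i ψ) x = ev (v i) x) :
    ∃ C, ∃ ρ' ≤ R, Represents T v p ρ' (ψ + constFn D.space C) := by
  obtain ⟨δ, hδ, hball⟩ := Metric.mem_nhds_iff.1
    ((isOpen_lt D.smooth.continuous continuous_const).mem_nhds hp)
  obtain ⟨ρ', h0, hδ', hR', hρ'⟩ : ∃ ρ' > 0, ρ' ≤ δ ∧ ρ' ≤ R ∧ ρ' ≤ ρ :=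
    ⟨min δ (min R ρ), lt_min hδ (lt_min hR h.pos), min_le_left _ _,
      (min_le_right _ _).trans (min_le_left _ _), (min_le_right _ _).trans (min_le_right _ _)⟩
  have hb : ∀ x ∈ Metric.ball p ρ', D.r x < 0 := fun x hx => hball (Metric.ball_subset_ball hδ' hx)
  -- Two potentials of `v` on a ball differ by a constant.
  have hconst : ∀ x ∈ Metric.ball p ρ', ev (φ - ψ) x = ev (φ - ψ) p := fun x hx => by
    refine (convex_ball p ρ').is_const_of_fderivWithin_eq_zero (𝕜 := ℝ) (f := ev (φ - ψ))
      (fun y hy => ((differentiableWithinAt_ev (φ - ψ) (hb y hy).le).mono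
        fun z hz => (hb z hz).le)) (fun y hy => ?_) hx (Metric.mem_ball_self h0)
    rw [fderivWithin_of_mem_nhds (Metric.isOpen_ball.mem_nhds hy),
      ← fderivWithin_of_mem_nhds (D.interior_mem_nhds (hb y hy))]
    ext z
    rw [fderivWithin_ev_apply _ (hb y hy).le]
    refine Finset.sum_eq_zero fun i _ => ?_
    rw [map_sub, ev_sub, h.dx_eq y (hb y hy).le ((Metric.mem_ball.1 hy).trans_le hρ'),
      hψ y (hb y hy).le ((Metric.mem_ball.1 hy).trans_le hR'), sub_self, mul_zero]
  refine ⟨ev (φ - ψ) p, ρ', hR', h0, fun x hx hxp i => ?_, fun σ hσ => ?_⟩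
  · rw [map_add, dx_constFn, add_zero, hψ x hx (hxp.trans_le hR')]
  · rw [(h.mono h0 hρ').apply_eq σ hσ]
    congr 1
    refine SmoothFn.ext_carrier fun x hx => ?_
    rw [ev_mul, ev_mul, ev_add, ev_constFn _ hx]
    by_cases hxp : dist x p < ρ'
    · rw [← hconst x hxp, ev_sub]
      ring
    · rw [hσ x hx (not_lt.1 hxp), mul_zero, mul_zero]

/-- The potential `ψ` near `x₀` is also valid at the interior point `p = x₀ + s • dir`, where its
constant can be adjusted so that it represents `T`. A function near `x₀` is a divergence of a field
on which `ψ` is a potential, plus a function supported near `p`; so the same constant works at `x₀`.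
-/
theorem exists_represents_of_boundary (hcurl : ∀ i j, dx i (v j) = dx j (v i))
    (hT : ∀ m : SmoothVec D.space, (D.space.NoFlux fun i => ev (m i)) →
      T (divS m) = -intS (∑ i, m i * v i)) (h0 : D.r x₀ = 0) :
    ∃ ρ ψ, Represents T v x₀ ρ ψ := by
  obtain ⟨c⟩ := exists_boundaryChart D.smooth h0 (D.regular x₀ h0)
  obtain ⟨R₀, hR₀, ψ, hψ⟩ := exists_potential_of_boundary hcurl c h0
  obtain ⟨R, hR, hRc, hRR₀⟩ : ∃ R > 0, R ≤ c.radius ∧ R ≤ R₀ :=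
    ⟨min c.radius R₀, lt_min c.radius_pos hR₀, min_le_left _ _, min_le_right _ _⟩
  set N := ‖c.dir‖ with hN
  have hN0 : 0 ≤ N := norm_nonneg _
  -- This keeps `p`, and the path of the transported mass, well inside the ball on which `ψ` is a
  -- potential.
  obtain ⟨s, hs, hsh, hsN⟩ : ∃ s > 0, s ≤ c.height ∧ s * N ≤ R / 8 := by
    refine ⟨min c.height (R / (8 * (N + 1))), lt_min c.height_pos (by positivity),
      min_le_left _ _, ?_⟩
    calc min c.height (R / (8 * (N + 1))) * N ≤ R / (8 * (N + 1)) * (N + 1) := by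
          gcongr
          · exact min_le_right _ _
          · linarith
      _ = R / 8 := by field_simp
  have hp : D.r (x₀ + s • c.dir) < 0 := by
    have := c.add_smul_le (Metric.mem_ball_self c.radius_pos) (s := s) ⟨hs.le, hsh⟩
    rw [h0] at this
    linarith
  have hpx : dist (x₀ + s • c.dir) x₀ ≤ R / 8 := by
    rw [dist_eq_norm, add_sub_cancel_left, norm_smul, Real.norm_of_nonneg hs.le]
    exact hsN
  obtain ⟨ρp, ψp, hrep⟩ := exists_represents_of_interior hcurl hT hp
  obtain ⟨C, ρ', hρR, hrep'⟩ := hrep.exists_add_constFn hp (half_pos hR) fun x hx hxp =>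
    hψ x hx (by
      have := dist_triangle x (x₀ + s • c.dir) x₀
      linarith)
  have hρ' := hrep'.pos
  -- With `η ≤ ρ' / 2` below, the deposited mass lies within `η + 2 * κ * N ≤ ρ'` of `p`.
  obtain ⟨κ, hκ, hκs, hκN⟩ : ∃ κ > 0, 2 * κ ≤ s ∧ 2 * κ * N ≤ ρ' / 2 := by
    refine ⟨min (s / 2) (ρ' / (4 * (N + 1))), lt_min (half_pos hs) (by positivity),
      by linarith [min_le_left (s / 2) (ρ' / (4 * (N + 1)))], ?_⟩
    calc 2 * min (s / 2) (ρ' / (4 * (N + 1))) * N ≤ 2 * (ρ' / (4 * (N + 1))) * (N + 1) := by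
          gcongr
          · exact min_le_right _ _
          · linarith
      _ = ρ' / 2 := by field_simp; norm_num
  obtain ⟨ε, hε, hεr⟩ := Metric.mem_nhds_iff.1
    ((isOpen_lt continuous_const D.smooth.continuous).mem_nhds
      (show -κ < D.r x₀ by rw [h0]; linarith))
  obtain ⟨η, hη, hηε, hηR, hηρ⟩ : ∃ η > 0, η ≤ ε ∧ η ≤ R / 4 ∧ η ≤ ρ' / 2 :=
    ⟨min ε (min (R / 4) (ρ' / 2)), lt_min hε (lt_min (by linarith) (half_pos hρ')),
      min_le_left _ _, (min_le_right _ _).trans (min_le_left _ _),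
      (min_le_right _ _).trans (min_le_right _ _)⟩
  have hψ' : ∀ x ∈ D.space.carrier, dist x x₀ < R → ∀ i,
      ev (dx i (ψ + constFn D.space C)) x = ev (v i) x := fun x hx hxR i => by
    rw [map_add, dx_constFn, add_zero, hψ x hx (hxR.trans_le hRR₀)]
  refine ⟨η, ψ + constFn D.space C, hη, fun x hx hxη => hψ' x hx (by linarith), fun σ hσ => ?_⟩
  obtain ⟨m, g, hm, hm0, hg0, hσm⟩ := exists_divS_add_of_boundary c hR hRc hκ hκs
    (by linarith) (η := η) (by rw [add_mul]; nlinarith) (fun x hx hxη => by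
      have h1 := c.time_le (Metric.ball_subset_ball (show η ≤ c.radius by linarith) hxη) hx
      have h2 : -κ < D.r x := hεr (Metric.ball_subset_ball hηε hxη)
      linarith) hσ
  rw [hσm, map_add, mul_add, map_add, apply_divS_eq_of_potential hT hm (fun x hx i => ?_),
    hrep'.apply_eq g fun x hx hxp => hg0 x hx (by linarith)]
  by_cases hxR : dist x x₀ < R
  · exact Or.inr (hψ' x hx hxR i)
  · exact Or.inl (hm0 i x hx (not_lt.1 hxR))

theorem exists_represents (hcurl : ∀ i j, dx i (v j) = dx j (v i))
    (hT : ∀ m : SmoothVec D.space, (D.space.NoFlux fun i => ev (m i)) →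
      T (divS m) = -intS (∑ i, m i * v i)) (hx : x₀ ∈ D.space.carrier) :
    ∃ ρ ψ, Represents T v x₀ ρ ψ := by
  rcases lt_or_eq_of_le (show D.r x₀ ≤ 0 from hx) with h | h
  · exact exists_represents_of_interior hcurl hT h
  · exact exists_represents_of_boundary hcurl hT h

end BoundaryRepresents

/-! ### Gluing of local representations. -/

section Globalize

open Filter Topology

variable {d : ℕ} {D : Domain d} {T : SmoothFn D.space →ₗ[ℝ] ℝ} {v : SmoothVec D.space}

/-- A linear condition holds for all smooth functions if it holds for those supported near any given
point. -/
theorem Domain.mem_of_forall_local (S : Submodule ℝ (SmoothFn D.space))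
    (h : ∀ x ∈ D.space.carrier, ∃ ρ > 0, ∀ σ : SmoothFn D.space,
      (∀ y ∈ D.space.carrier, ρ ≤ dist y x → ev σ y = 0) → σ ∈ S) (σ : SmoothFn D.space) : σ ∈ S := by
  classical
  have hc : IsCompact D.space.carrier := D.compact
  choose! ρ hρ hS using h
  obtain ⟨t, ht, hcov⟩ := hc.elim_nhds_subcover (fun x => Metric.ball x (ρ x / 2))
    fun x hx => Metric.ball_mem_nhds x (half_pos (hρ x hx))
  -- In place of a partition of unity, bumps are removed one by one: `σ - χ * σ` vanishes on the
  -- half-ball where `χ = 1`.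
  have key : ∀ u : Finset (E d), (∀ x ∈ u, x ∈ D.space.carrier) → ∀ σ : SmoothFn D.space,
      (∀ y ∈ D.space.carrier, (∀ x ∈ u, ρ x / 2 ≤ dist y x) → ev σ y = 0) → σ ∈ S := by
    intro u
    induction u using Finset.induction_on with
    | empty =>
      intro _ σ hσ
      have : σ = 0 := SmoothFn.ext_carrier fun y hy => by
        rw [hσ y hy (by simp), ev_zero]
      rw [this]
      exact S.zero_mem
    | insert x u hx ih =>
      intro hu σ hσ
      have hxc := hu x (Finset.mem_insert_self x u)
      set χ := D.bump x (hρ x hxc)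
      have h1 : σ = χ * σ + (σ - χ * σ) := (add_sub_cancel _ _).symm
      rw [h1]
      refine S.add_mem (hS x hxc _ fun y hy hyx => ?_)
        (ih (fun z hz => hu z (Finset.mem_insert_of_mem hz)) _ fun y hy hyu => ?_)
      · rw [ev_mul, Domain.ev_bump_of_ge _ hy hyx, zero_mul]
      · rw [ev_sub, ev_mul]
        rcases le_total (dist y x) (ρ x / 2) with hyx | hyx
        · rw [Domain.ev_bump_of_le _ hy hyx, one_mul, sub_self]
        · rw [hσ y hy (by
            intro z hz
            rcases Finset.mem_insert.1 hz with rfl | hz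
            · exact hyx
            · exact hyu z hz), mul_zero, sub_zero]
  refine key t ht σ fun y hy hyt => ?_
  obtain ⟨x, hx, hyx⟩ := mem_iUnion₂.1 (hcov hy)
  exact absurd (Metric.mem_ball.1 hyx) (not_lt.2 (hyt x hx))

/-- Both functions compute `T` on `(ψ - φ)` times a bump at `x`, so the integral of `(ψ - φ)²` times
the bump is zero. No additive constant is left free. -/
theorem Represents.ev_eq {p q : E d} {ρ ρ' : ℝ} {ψ φ : SmoothFn D.space}
    (hψ : Represents T v p ρ ψ) (hφ : Represents T v q ρ' φ) {x : E d} (hx : x ∈ D.space.carrier)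
    (hp : dist x p < ρ) (hq : dist x q < ρ') : ev ψ x = ev φ x := by
  obtain ⟨δ, hδ, h1, h2⟩ : ∃ δ > 0, δ ≤ ρ - dist x p ∧ δ ≤ ρ' - dist x q :=
    ⟨min (ρ - dist x p) (ρ' - dist x q), lt_min (sub_pos.2 hp) (sub_pos.2 hq), min_le_left _ _,
      min_le_right _ _⟩
  have hfar : ∀ y ∈ D.space.carrier, δ ≤ dist y x → ev ((ψ - φ) * D.bump x hδ) y = 0 :=
    fun y hy hyx => by rw [ev_mul, Domain.ev_bump_of_ge hδ hy hyx, mul_zero]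
  have e1 := hψ.apply_eq ((ψ - φ) * D.bump x hδ) fun y hy hyp => hfar y hy (by
    have := dist_triangle y x p
    linarith)
  have e2 := hφ.apply_eq ((ψ - φ) * D.bump x hδ) fun y hy hyq => hfar y hy (by
    have := dist_triangle y x q
    linarith)
  have h0 : intS ((ψ - φ) * ((ψ - φ) * D.bump x hδ)) = 0 := by
    rw [sub_mul, map_sub, ← e1, ← e2, sub_self]
  have h3 := eq_zero_of_intS_eq_zero (fun y hy => by
    rw [ev_mul, ev_mul, ← mul_assoc]
    exact mul_nonneg (mul_self_nonneg _) (Domain.ev_bump_nonneg hδ hy)) h0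
  have h4 : ev ((ψ - φ) * ((ψ - φ) * D.bump x hδ)) x = 0 := by rw [h3, ev_zero]
  rw [ev_mul, ev_mul, Domain.ev_bump_of_le hδ hx (by rw [dist_self]; exact (half_pos hδ).le), mul_one,
    mul_self_eq_zero, ev_sub, sub_eq_zero] at h4
  exact h4

/-- A functional that is a distributional potential of a curl-free field is given by a smooth
potential. -/
theorem exists_eq_intS_mul_of_hasPotential (hcurl : ∀ i j, dx i (v j) = dx j (v i))
    (hT : ∀ m : SmoothVec D.space, (D.space.NoFlux fun i => ev (m i)) →
      T (divS m) = -intS (∑ i, m i * v i)) :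
    ∃ Φ : SmoothFn D.space, (∀ σ, T σ = intS (Φ * σ)) ∧ grad Φ = v := by
  choose! ρ ψ hψ using fun x (hx : x ∈ D.space.carrier) => exists_represents (x₀ := x) hcurl hT hx
  have hloc : ∀ x ∈ D.space.carrier, ∀ y ∈ D.space.carrier, dist y x < ρ x →
      ev (ψ y) y = ev (ψ x) y := fun x hx y hy hyx =>
    (hψ y hy).ev_eq (hψ x hx) hy (by rw [dist_self]; exact (hψ y hy).pos) hyx
  -- The diagonal `x ↦ ψₓ(x)` is smooth, as near each point it coincides with the single function
  -- chosen at that point.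
  have hs : ContDiffOn ℝ ∞ (fun x => ev (ψ x) x) D.space.carrier := fun x hx => by
    refine ((contDiffOn_ev (ψ x)) x hx).congr_of_eventuallyEq ?_ rfl
    filter_upwards [self_mem_nhdsWithin,
      mem_nhdsWithin_of_mem_nhds (Metric.ball_mem_nhds x (hψ x hx).pos)] with y hy hyx
    exact hloc x hx y hy hyx
  set Φ := D.fn _ hs with hΦ
  have hΦψ : ∀ x ∈ D.space.carrier, ∀ y ∈ D.space.carrier, dist y x < ρ x →
      ev Φ y = ev (ψ x) y := fun x hx y hy hyx => by rw [hΦ, D.ev_fn _ hy, hloc x hx y hy hyx]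
  have hTΦ : ∀ σ, T σ = intS (Φ * σ) := fun σ => by
    have := Domain.mem_of_forall_local
      (LinearMap.eqLocus T (intS.comp (LinearMap.mulLeft ℝ Φ))) (fun x hx => ?_) σ
    · exact this
    refine ⟨ρ x, (hψ x hx).pos, fun σ hσ => ?_⟩
    change T σ = intS (Φ * σ)
    rw [(hψ x hx).apply_eq σ hσ]
    congr 1
    refine SmoothFn.ext_carrier fun y hy => ?_
    rw [ev_mul, ev_mul]
    rcases lt_or_ge (dist y x) (ρ x) with h | h
    · rw [hΦψ x hx y hy h]
    · rw [hσ y hy h, mul_zero, mul_zero]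
  refine ⟨Φ, hTΦ, ?_⟩
  ext1 i
  refine SmoothFn.ext_carrier fun x hx => ?_
  have h0 : dist x x < ρ x := by rw [dist_self]; exact (hψ x hx).pos
  rw [← dx_apply, ← (hψ x hx).dx_eq x hx h0 i,
    D.ev_dx_of_eq_near (hΦψ x hx) hx h0 (differentiableWithinAt_ev (ψ x) hx).hasFDerivWithinAt,
    ev_dx _ _ hx]

theorem ev_eq_of_segment_subset {Ω : SampleSpace d} {Φ : SmoothFn Ω} (h : grad Φ = 0) {x y : E d}
    (hxy : segment ℝ x y ⊆ Ω.carrier) : ev Φ y = ev Φ x := by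
  have h0 : ∀ z ∈ segment ℝ x y, HasFDerivWithinAt (ev Φ) (0 : E d →L[ℝ] ℝ) (segment ℝ x y) z :=
    fun z hz => by
      have h1 := (differentiableWithinAt_ev Φ (hxy hz)).hasFDerivWithinAt.mono hxy
      convert h1 using 1
      ext w
      rw [fderivWithin_ev_apply _ (hxy hz)]
      refine (Finset.sum_eq_zero fun i _ => ?_).symm
      rw [dx_apply, h, Pi.zero_apply, ev_zero, mul_zero]
  have := (convex_segment x y).norm_image_sub_le_of_norm_hasFDerivWithin_le (C := 0) h0
    (fun z _ => by rw [norm_zero]) (left_mem_segment ℝ x y) (right_mem_segment ℝ x y)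
  rw [zero_mul, norm_le_zero_iff, sub_eq_zero] at this
  exact this

/-- Local quasiconvexity makes `Φ` locally constant up to the boundary; connectedness does the rest.
-/
theorem Domain.eq_constFn_of_grad_eq_zero {Φ : SmoothFn D.space} (h : grad Φ = 0) :
    ∃ C, Φ = constFn D.space C := by
  have hconn : IsConnected D.space.carrier := D.connected
  have : PreconnectedSpace D.space.carrier := Subtype.preconnectedSpace hconn.isPreconnected
  obtain ⟨x₀, hx₀⟩ := hconn.nonempty
  have hloc : IsLocallyConstant fun x : D.space.carrier => ev Φ x :=
    (IsLocallyConstant.iff_eventually_eq _).2 fun x => by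
      obtain ⟨C, hC⟩ := D.space.locallyQuasiconvex_carrier x x.2
      have : ∀ᶠ y in 𝓝[D.space.carrier] (x : E d), ev Φ y = ev Φ x := by
        filter_upwards [hC] with y ⟨p, q, h1, h2, h3, _⟩
        rw [ev_eq_of_segment_subset h h3, ev_eq_of_segment_subset h h2,
          ev_eq_of_segment_subset h h1]
      rwa [nhdsWithin_eq_map_subtype_coe x.2, eventually_map] at this
  refine ⟨ev Φ x₀, SmoothFn.ext_carrier fun x hx => ?_⟩
  rw [ev_constFn _ hx]
  exact hloc.apply_eq_of_preconnectedSpace ⟨x, hx⟩ ⟨x₀, hx₀⟩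

end Globalize

/-! ### Range of the divergence and the orthogonal complement of its kernel. -/

section Poisson

variable {d : ℕ} {Ω : SampleSpace d} {D : Domain d}

/-- Purely algebraic: `l` descends to the range of `f` and extends linearly to `W`. Continuity is
never required of the functionals. -/
theorem exists_comp_eq_of_ker_le {V W : Type} [AddCommGroup V] [Module ℝ V] [AddCommGroup W]
    [Module ℝ W] (f : V →ₗ[ℝ] W) (l : V →ₗ[ℝ] ℝ) (h : ∀ x, f x = 0 → l x = 0) :
    ∃ T : W →ₗ[ℝ] ℝ, ∀ x, T (f x) = l x := by
  obtain ⟨T, hT⟩ := LinearMap.exists_extend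
    (((LinearMap.ker f).liftQ l fun x hx => h x hx) ∘ₗ f.quotKerEquivRange.symm.toLinearMap)
  refine ⟨T, fun x => ?_⟩
  have h1 := LinearMap.congr_fun hT (f.quotKerEquivRange (Submodule.Quotient.mk x))
  rw [LinearMap.comp_apply, LinearMap.comp_apply, LinearEquiv.coe_coe,
    LinearEquiv.symm_apply_apply] at h1
  exact h1

/-- The vector fields that satisfy the boundary condition. -/
def noFluxFields (Ω : SampleSpace d) : Submodule ℝ (SmoothVec Ω) where
  carrier := {m | Ω.NoFlux fun i => ev (m i)}
  add_mem' hm hn := hm.add hn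
  zero_mem' := by
    cases Ω with
    | periodic L hL => trivial
    | neumann r hr hreg hc hconn =>
      exact fun x _ => Finset.sum_eq_zero fun i _ => zero_mul _
  smul_mem' c _ hm := hm.smul c

/-- Orthogonality says that `m ↦ -∫ m·v` vanishes on the kernel of the divergence, so it equals `T ∘
div` for some functional `T`, and the smooth function that represents `T` is the potential. -/
theorem exists_grad_eq_neumann (v : SmoothVec D.space) (h : ∀ w : SmoothVec D.space,
    (D.space.NoFlux fun i => ev (w i)) → divS w = 0 → intS (∑ i, w i * v i) = 0) :
    ∃ Φ : SmoothFn D.space, grad Φ = v := by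
  obtain ⟨T, hT⟩ := exists_comp_eq_of_ker_le (divS ∘ₗ (noFluxFields D.space).subtype)
    (-((intS ∘ₗ ∑ i, LinearMap.mulRight ℝ (v i) ∘ₗ LinearMap.proj i) ∘ₗ
      (noFluxFields D.space).subtype)) fun m hm => by
        have := h m.1 m.2 hm
        simpa using this
  obtain ⟨Φ, -, hΦ⟩ := exists_eq_intS_mul_of_hasPotential (T := T) (dx_eq_dx_of_orthogonal v h)
    fun m hm => by
      have := hT ⟨m, hm⟩
      simpa using this
  exact ⟨Φ, hΦ⟩

/-- Otherwise some linear functional kills all divergences but not `σ`. It is represented by a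
function with zero gradient, that is, a constant, and a constant does kill `σ`. -/
theorem exists_divS_eq_neumann (σ : SmoothFn D.space) (h : intS σ = 0) :
    ∃ m : SmoothVec D.space, (D.space.NoFlux fun i => ev (m i)) ∧ divS m = σ := by
  by_contra! hne
  obtain ⟨T, hTσ, hT⟩ := Submodule.exists_le_ker_of_notMem
    (p := (noFluxFields D.space).map divS) (v := σ) fun ⟨m, hm, hmσ⟩ => hne m hm hmσ
  obtain ⟨Φ, hTΦ, hΦ⟩ := exists_eq_intS_mul_of_hasPotential (T := T) (v := 0)
    (fun i j => by simp) fun m hm => by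
      have : T (divS m) = 0 := hT ⟨m, hm, rfl⟩
      simp [this]
  obtain ⟨C, rfl⟩ := Domain.eq_constFn_of_grad_eq_zero hΦ
  exact hTσ (by rw [hTΦ, intS_constFn_mul, h, mul_zero])

/-- Every smooth function with mean zero is the divergence of a field that satisfies the boundary
condition. -/
theorem exists_divS_eq (σ : SmoothFn Ω) (h : intS σ = 0) :
    ∃ m : SmoothVec Ω, (Ω.NoFlux fun i => ev (m i)) ∧ divS m = σ := by
  cases Ω with
  | periodic L hL =>
    obtain ⟨m, hm⟩ := exists_divS_eq_periodic σ h
    exact ⟨m, trivial, hm⟩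
  | neumann r hr hreg hc hconn => exact exists_divS_eq_neumann (D := ⟨r, hr, hreg, hc, hconn⟩) σ h

/-- A vector field orthogonal to the divergence-free fields is a gradient. -/
theorem exists_grad_eq (v : SmoothVec Ω) (h : ∀ w : SmoothVec Ω, (Ω.NoFlux fun i => ev (w i)) →
    divS w = 0 → intS (∑ i, w i * v i) = 0) : ∃ Φ : SmoothFn Ω, grad Φ = v := by
  cases Ω with
  | periodic L hL => exact exists_grad_eq_periodic v fun w hw => h w trivial hw
  | neumann r hr hreg hc hconn => exact exists_grad_eq_neumann (D := ⟨r, hr, hreg, hc, hconn⟩) v h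

end Poisson

/-! ### Critical points of the action and potentials. -/

section Geodesic

open Filter Topology

variable {d : ℕ} {Ω : SampleSpace d}

theorem continuityEquation_iff {η : ℝ → SmoothFn Ω} (hη : SmoothFamily Ω (Icc 0 1) η)
    (w : ℝ → SmoothVec Ω) :
    ContinuityEquation Ω (fun t => ev (η t)) (fun t i => ev (w t i)) ↔
      ∀ t ∈ Icc (0 : ℝ) 1, dt η t = -divS (w t) ∧ Ω.NoFlux fun i => ev (w t i) := by
  constructor
  · refine fun h t ht => ⟨SmoothFn.ext_carrier fun x hx => ?_, h.boundary t ht⟩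
    rw [hη.ev_dt ht hx, ev_neg, ev_divS _ hx]
    exact eq_neg_of_add_eq_zero_left (h.equation t ht x hx)
  · refine fun h => ⟨fun t ht x hx => ?_, fun t ht => (h t ht).2⟩
    rw [← hη.ev_dt ht hx, (h t ht).1, ev_neg, ev_divS _ hx, neg_add_cancel]

theorem eq_of_dt_eq {a b : ℝ → SmoothFn Ω} (ha : SmoothFamily Ω (Icc 0 1) a)
    (hb : SmoothFamily Ω (Icc 0 1) b) (h0 : a 0 = b 0)
    (h : ∀ t ∈ Icc (0 : ℝ) 1, dt a t = dt b t) {t : ℝ} (ht : t ∈ Icc (0 : ℝ) 1) : a t = b t := by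
  refine SmoothFn.ext_carrier fun x hx => ?_
  have hd : ∀ s ∈ Icc (0 : ℝ) 1, HasDerivWithinAt (fun s => ev (a s) x - ev (b s) x) 0
      (Icc 0 1) s := fun s hs => by
    have := (ha.hasDerivWithinAt_ev hs hx).sub (hb.hasDerivWithinAt_ev hs hx)
    rwa [h s hs, sub_self] at this
  have := constant_of_derivWithin_zero (fun s hs => (hd s hs).differentiableWithinAt)
    (fun s hs => (hd s (Ico_subset_Icc_self hs)).derivWithin
      (uniqueDiffOn_unitInterval s (Ico_subset_Icc_self hs))) t ht
  rw [h0, sub_self] at this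
  exact sub_eq_zero.1 this

theorem eq_zero_of_forall_mem_Ioo {u : ℝ → SmoothFn Ω} (hu : SmoothFamily Ω (Icc 0 1) u)
    (h : ∀ t ∈ Ioo (0 : ℝ) 1, u t = 0) {t : ℝ} (ht : t ∈ Icc (0 : ℝ) 1) : u t = 0 := by
  refine SmoothFn.ext_carrier fun x hx => ?_
  have hE : EqOn (fun s => ev (u s) x) (fun _ => 0) (Ioo 0 1) := fun s hs => by
    simp only [h s hs, ev_zero]
  have := hE.of_subset_closure (hu.contDiffOn_slice hx).continuousOn continuousOn_const
    Ioo_subset_Icc_self (by rw [closure_Ioo zero_ne_one])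
  exact (this ht).trans (ev_zero x).symm

/-- The mass is preserved by the continuity equation. -/
theorem intS_eq_of_dt_eq {η : ℝ → SmoothFn Ω} (hη : SmoothFamily Ω (Icc 0 1) η)
    {w : ℝ → SmoothVec Ω}
    (h : ∀ t ∈ Icc (0 : ℝ) 1, dt η t = -divS (w t) ∧ Ω.NoFlux fun i => ev (w t i)) {t : ℝ}
    (ht : t ∈ Icc (0 : ℝ) 1) : intS (η t) = intS (η 0) := by
  have hd : ∀ s ∈ Icc (0 : ℝ) 1, HasDerivWithinAt (fun s => intS (η s)) 0 (Icc 0 1) s := by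
    intro s hs
    refine (hη.hasDerivWithinAt_intS uniqueDiffOn_unitInterval (convex_Icc _ _) hs).congr_deriv ?_
    calc _ = intS (dt η s) := integral_congr_carrier Ω fun x hx => (hη.ev_dt hs hx).symm
      _ = 0 := by rw [(h s hs).1, map_neg, intS_divS _ (h s hs).2, neg_zero]
  exact constant_of_derivWithin_zero (fun s hs => (hd s hs).differentiableWithinAt)
    (fun s hs => (hd s (Ico_subset_Icc_self hs)).derivWithin
      (uniqueDiffOn_unitInterval s (Ico_subset_Icc_self hs))) t ht

theorem exists_primitive {g : ℝ → SmoothFn Ω} (hg : SmoothFamily Ω (Icc 0 1) g) :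
    ∃ G : ℝ → SmoothFn Ω, SmoothFamily Ω (Icc 0 1) G ∧ G 0 = 0 ∧
      ∀ t ∈ Icc (0 : ℝ) 1, dt G t = g t := by
  have hS : ContDiffOn ℝ ∞ (fun p : ℝ × E d => ∫ s in (0 : ℝ)..p.1, ev (g s) p.2)
      (Icc 0 1 ×ˢ Ω.carrier) := by
    -- Rescaling to `[0,1]` moves the variable endpoint into the integrand, so that smoothness of
    -- parameter integrals applies.
    simp only [integral_eq_mul_integral_unitInterval, sub_zero, zero_add]
    refine (LocallyQuasiconvex.prod (convex_Icc (0 : ℝ) 1) Ω.locallyQuasiconvex_carrier).contDiffOn_integral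
      (uniqueDiffOn_unitInterval.prod Ω.uniqueDiffOn_carrier) (isCompact_Icc (a := (0 : ℝ)) (b := 1))
      uniqueDiffOn_unitInterval (ae_restrict_mem measurableSet_Icc)
      (F := fun q : (ℝ × E d) × ℝ => q.1.1 * ev (g (q.1.1 * q.2)) q.1.2) ?_
    refine ContDiffOn.mul (by fun_prop) ?_
    exact ContDiffOn.comp (f := fun q : (ℝ × E d) × ℝ => (q.1.1 * q.2, q.1.2)) hg (by fun_prop)
      fun q hq => ⟨⟨mul_nonneg hq.1.1.1 hq.2.1, mul_le_one₀ hq.1.1.2 hq.2.1 hq.2.2⟩, hq.1.2⟩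
  have hp : ∀ t, Ω.IsPeriodic fun x => ∫ s in (0 : ℝ)..t, ev (g s) x := by
    intro t
    cases Ω with
    | periodic L hL =>
      intro i x
      simp only [fun s => isPeriodic_ev (g s) i x]
    | neumann => trivial
  have hc : ∀ t ∈ Icc (0 : ℝ) 1, ContDiffOn ℝ ∞ (fun x => ∫ s in (0 : ℝ)..t, ev (g s) x)
      Ω.carrier := fun t ht =>
    hS.comp (f := fun x => (t, x)) (by fun_prop) fun x hx => ⟨ht, hx⟩
  classical
  set G : ℝ → SmoothFn Ω := fun t => if h : t ∈ Icc (0 : ℝ) 1 then mkFn _ (hc t h) (hp t) else 0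
    with hG
  have hev : ∀ t ∈ Icc (0 : ℝ) 1, ∀ x ∈ Ω.carrier,
      ev (G t) x = ∫ s in (0 : ℝ)..t, ev (g s) x := fun t ht x hx => by
    rw [hG]
    dsimp only
    rw [dif_pos ht, ev_mkFn _ _ hx]
  have hGs : SmoothFamily Ω (Icc 0 1) G := hS.congr fun p hp => hev p.1 hp.1 p.2 hp.2
  refine ⟨G, hGs, SmoothFn.ext_carrier fun x hx => ?_, fun t ht => hGs.dt_eq ht fun x hx => ?_⟩
  · rw [hev 0 (by simp) x hx, intervalIntegral.integral_same, ev_zero]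
  · have hcont := (hg.contDiffOn_slice hx).continuousOn
    have : Fact (t ∈ Icc (0 : ℝ) 1) := ⟨ht⟩
    have hint : IntervalIntegrable (fun s => ev (g s) x) volume 0 t :=
      (hcont.mono (by rw [uIcc_of_le ht.1]; exact Icc_subset_Icc_right ht.2)).intervalIntegrable
    have := intervalIntegral.integral_hasDerivWithinAt_right (s := Icc (0 : ℝ) 1)
      (t := Icc (0 : ℝ) 1) hint (hcont.stronglyMeasurableAtFilter_nhdsWithin measurableSet_Icc t)
      (hcont t ht)
    exact this.congr (fun s hs => hev s hs x hx) (hev t ht x hx)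

theorem eqOn_zero_of_intervalIntegral_eq_zero {F : ℝ → ℝ} (hF : ContinuousOn F (Icc 0 1))
    (h0 : ∀ t ∈ Icc (0 : ℝ) 1, 0 ≤ F t) (h : ∫ t in (0 : ℝ)..1, F t = 0) {t : ℝ}
    (ht : t ∈ Icc (0 : ℝ) 1) : F t = 0 := by
  by_contra hne
  exact (intervalIntegral.integral_pos zero_lt_one hF
    (fun s hs => h0 s (Ioc_subset_Icc_self hs)) ⟨t, ht, (h0 t ht).lt_of_ne' hne⟩).ne' h

variable {H : SmoothFn Ω → ℝ} {K : OperatorField Ω} {ρ g : ℝ → SmoothFn Ω} {v : ℝ → SmoothVec Ω}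

theorem IsGeodesic.integral_eq_zero (hK : IsL2Hessian Ω H K) (h : IsGeodesic K ρ v)
    (hg : ∀ t ∈ Icc (0 : ℝ) 1, HasFirstVariation Ω (dualEnergy K (v t)) (ρ t) (g t))
    {η : ℝ → SmoothFn Ω} {w : ℝ → SmoothVec Ω} (hη : SmoothFamily Ω (Icc 0 1) η)
    (hw : ∀ i, SmoothFamily Ω (Icc 0 1) fun t => w t i)
    (hc : ∀ t ∈ Icc (0 : ℝ) 1, dt η t = -divS (w t) ∧ Ω.NoFlux fun i => ev (w t i))
    (h0 : η 0 = 0) (h1 : η 1 = 0) :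
    ∫ t in (0 : ℝ)..1, (2 * intS (∑ i, w t i * v t i) - intS (g t * η t)) = 0 := by
  have hη0 : ∀ t ∈ Icc (0 : ℝ) 1, IsTangent Ω (η t) := fun t ht => by
    rw [isTangent_iff, intS_eq_of_dt_eq hη hc ht, h0, map_zero]
  exact (hK.hasDerivAt_action h.1.smooth_density h.1.density h.1.smooth_field hη hη0 hw hg).unique
    (h.2 η w hη hw ((continuityEquation_iff hη w).2 hc) h0 h1)

theorem SmoothFamily.two_smul_dt_add_dx (hv : ∀ i, SmoothFamily Ω (Icc 0 1) fun t => v t i)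
    (hg : SmoothFamily Ω (Icc 0 1) g) (i : Fin d) :
    SmoothFamily Ω (Icc 0 1) fun t => (2 : ℝ) • HessianTransport.dt (fun s => v s i) t +
      HessianTransport.dx i (g t) :=
  (SmoothFamily.smul contDiffOn_const (hv i).dt).add (hg.dx uniqueDiffOn_unitInterval i)

/-- Every field `B` that vanishes at both times and whose time derivative is admissible yields the
variation `w = ∂ₜB`, `η = -div B`. Integration by parts in time and space turns the first variation
into `-∫∫ B·u`, with `u = 2 ∂ₜv + ∇g`. The choice `B = weight * t(1-t) u` makes this a weighted
square. -/
theorem IsGeodesic.dt_field (hK : IsL2Hessian Ω H K) (h : IsGeodesic K ρ v)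
    (hgs : SmoothFamily Ω (Icc 0 1) g)
    (hg : ∀ t ∈ Icc (0 : ℝ) 1, HasFirstVariation Ω (dualEnergy K (v t)) (ρ t) (g t))
    (i : Fin d) {t : ℝ} (ht : t ∈ Icc (0 : ℝ) 1) :
    (2 : ℝ) • dt (fun s => v s i) t + dx i (g t) = 0 := by
  have hv := h.1.smooth_field
  have hu := fun i => SmoothFamily.two_smul_dt_add_dx hv hgs i
  set u : Fin d → ℝ → SmoothFn Ω := fun i t => (2 : ℝ) • dt (fun s => v s i) t + dx i (g t)
  have hζ : ContDiffOn ℝ ∞ (fun t : ℝ => t * (1 - t)) (Icc 0 1) := by fun_prop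
  have hB : ∀ i, SmoothFamily Ω (Icc 0 1) fun t => weight Ω * ((t * (1 - t)) • u i t) := fun i =>
    (smoothFamily_const _).mul (SmoothFamily.smul hζ (hu i))
  set B : ℝ → SmoothVec Ω := fun t i => weight Ω * ((t * (1 - t)) • u i t)
  have hBn : ∀ t, Ω.NoFlux fun i => ev (B t i) := fun t => noFlux_weight_mul _
  have hη := (SmoothFamily.divS uniqueDiffOn_unitInterval hB).neg
  have hc : ∀ t ∈ Icc (0 : ℝ) 1, dt (fun t => -divS (B t)) t = -divS (fun i => dt (fun s => B s i) t)
      ∧ Ω.NoFlux fun i => ev (dt (fun s => B s i) t) := fun t ht => by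
    constructor
    · rw [← dt_divS hB ht]
      exact hη.dt_eq ht fun x hx =>
        ((SmoothFamily.divS uniqueDiffOn_unitInterval hB).hasDerivWithinAt_ev ht hx).neg
    · convert noFlux_weight_mul (fun i => dt (fun s : ℝ => (s * (1 - s)) • u i s) t) using 3 with i
      rw [dt_mul (smoothFamily_const _) (SmoothFamily.smul hζ (hu i)) ht,
        (smoothFamily_const (weight Ω)).dt_eq (h := 0) ht fun x _ => by
          rw [ev_zero]; exact hasDerivWithinAt_const _ _ _]
      rw [zero_mul, zero_add]
  have hB0 : B 0 = 0 := by ext1 i; simp [B]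
  have hB1 : B 1 = 0 := by ext1 i; simp [B]
  have key := h.integral_eq_zero hK hg hη (fun i => (hB i).dt) hc
    ((congrArg (fun b => -divS b) hB0).trans (by simp)) ((congrArg (fun b => -divS b) hB1).trans (by simp))
  have hBv : SmoothFamily Ω (Icc 0 1) fun t => ∑ i, B t i * v t i :=
    SmoothFamily.sum fun i _ => (hB i).mul (hv i)
  have hFTC := intervalIntegral_intS_dt hBv
  simp only [hB0, hB1, Pi.zero_apply, zero_mul, Finset.sum_const_zero, map_zero, sub_zero] at hFTC
  have hQ : SmoothFamily Ω (Icc 0 1) fun t => ∑ i, B t i * u i t :=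
    SmoothFamily.sum fun i _ => (hB i).mul (hu i)
  have hint : ∫ t in (0 : ℝ)..1, intS (∑ i, B t i * u i t) = 0 := by
    have e : ∀ t ∈ uIcc (0 : ℝ) 1, intS (∑ i, B t i * u i t) =
        2 * intS (dt (fun t => ∑ i, B t i * v t i) t) -
          (2 * intS (∑ i, dt (fun s => B s i) t * v t i) - intS (g t * -divS (B t))) := by
      intro t ht
      rw [uIcc_of_le zero_le_one] at ht
      rw [mul_neg, map_neg, intS_mul_divS _ _ (hBn t), neg_neg,
        dt_sum (fun i _ => (hB i).mul (hv i)) ht]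
      simp only [map_sum]
      rw [Finset.mul_sum, Finset.mul_sum, ← Finset.sum_sub_distrib, ← Finset.sum_sub_distrib]
      refine Finset.sum_congr rfl fun i _ => ?_
      rw [dt_mul (hB i) (hv i) ht, map_add]
      have : B t i * u i t = (2 : ℝ) • (B t i * dt (fun s => v s i) t) + B t i * dx i (g t) := by
        simp only [u, mul_add, mul_smul_comm]
      rw [this, map_add, map_smul, smul_eq_mul]
      ring
    rw [intervalIntegral.integral_congr e, intervalIntegral.integral_sub, key,
      intervalIntegral.integral_const_mul, hFTC, mul_zero, sub_zero]
    · exact (ContinuousOn.const_mul (hBv.dt.continuousOn_intS) 2).intervalIntegrable_of_Icc zero_le_one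
    · refine ContinuousOn.intervalIntegrable_of_Icc zero_le_one ?_
      exact (ContinuousOn.const_mul (SmoothFamily.continuousOn_intS
        (SmoothFamily.sum fun i _ => (hB i).dt.mul (hv i))) 2).sub
        (hgs.mul hη).continuousOn_intS
  -- The factor `t(1-t)` vanishes at the end times, which are recovered by continuity.
  refine eq_zero_of_forall_mem_Ioo (hu i) (fun s hs => ?_) ht
  have hs' := Ioo_subset_Icc_self hs
  have hpos : 0 < s * (1 - s) := mul_pos hs.1 (by linarith [hs.2])
  have hterm : ∀ t ∈ Icc (0 : ℝ) 1, ∀ i, 0 ≤ intS (B t i * u i t) := fun t ht i =>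
    intS_nonneg fun x hx => by
      simp only [B, ev_mul, ev_smul]
      have h1 := weight_nonneg hx
      have h2 : 0 ≤ t * (1 - t) := mul_nonneg ht.1 (by linarith [ht.2])
      rw [show ev (weight Ω) x * (t * (1 - t) * ev (u i t) x) * ev (u i t) x =
        ev (weight Ω) x * (t * (1 - t)) * (ev (u i t) x * ev (u i t) x) by ring]
      exact mul_nonneg (mul_nonneg h1 h2) (mul_self_nonneg _)
  have hz := eqOn_zero_of_intervalIntegral_eq_zero hQ.continuousOn_intS
    (fun t ht => by rw [map_sum]; exact Finset.sum_nonneg fun i _ => hterm t ht i) hint hs'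
  rw [map_sum, Finset.sum_eq_zero_iff_of_nonneg fun i _ => hterm s hs' i] at hz
  have hz' := hz i (Finset.mem_univ i)
  refine eq_zero_of_intS_weight_mul ?_
  have : B s i * u i s = (s * (1 - s)) • (weight Ω * (u i s * u i s)) := by
    simp only [B, mul_smul_comm, smul_mul_assoc, mul_assoc]
  rw [this, map_smul, smul_eq_mul] at hz'
  exact (mul_eq_zero.1 hz').resolve_left hpos.ne'

/-- For divergence-free `W` the density need not move. With `c t = ∫ W·v t` and `w = c W` the first
variation is `2 ∫ c²`, so `c` vanishes, in particular at time `0`. Later times are reached through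
`IsGeodesic.dt_field`. -/
theorem IsGeodesic.exists_grad_eq_zero_time (hK : IsL2Hessian Ω H K) (h : IsGeodesic K ρ v)
    (hg : ∀ t ∈ Icc (0 : ℝ) 1, HasFirstVariation Ω (dualEnergy K (v t)) (ρ t) (g t)) :
    ∃ Φ : SmoothFn Ω, grad Φ = v 0 := by
  refine exists_grad_eq (v 0) fun W hW hdiv => ?_
  have hv := h.1.smooth_field
  have hWv : SmoothFamily Ω (Icc 0 1) fun t => ∑ i, W i * v t i :=
    SmoothFamily.sum fun i _ => (smoothFamily_const (W i)).mul (hv i)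
  have hc := hWv.contDiffOn_intS uniqueDiffOn_unitInterval (convex_Icc _ _).locallyQuasiconvex
  set c : ℝ → ℝ := fun t => intS (∑ i, W i * v t i)
  have key := h.integral_eq_zero hK hg (η := 0) (w := fun t i => c t • W i) smoothFamily_zero
    (fun i => SmoothFamily.smul hc (smoothFamily_const _)) (fun t ht => ⟨?_, ?_⟩) rfl rfl
  · have e : ∀ t, 2 * intS (∑ i, c t • W i * v t i) - intS (g t * (0 : ℝ → SmoothFn Ω) t) =
        2 * c t ^ 2 := fun t => by
      simp only [smul_mul_assoc, ← Finset.smul_sum, map_smul, Pi.zero_apply, mul_zero, map_zero,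
        sub_zero, smul_eq_mul, c]
      ring
    simp only [e] at key
    have := eqOn_zero_of_intervalIntegral_eq_zero ((hc.continuousOn.pow 2).const_mul 2)
      (fun t _ => mul_nonneg zero_le_two (sq_nonneg (c t))) key (t := 0) (by simp)
    exact pow_eq_zero_iff two_ne_zero |>.1 ((mul_eq_zero.1 this).resolve_left two_ne_zero)
  · have e : divS (fun i => c t • W i) = c t • divS W := (divS.map_smul (c t) W)
    rw [e, hdiv, smul_zero, neg_zero]
    exact smoothFamily_zero.dt_eq ht fun x _ => by
      simp only [Pi.zero_apply, ev_zero]; exact hasDerivWithinAt_const _ _ _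
  · exact hW.smul (c t)

/-- The function `Φ₀ - ½ ∫₀ᵗ g` has gradient `v` at time `0`, and its gradient has the same time
derivative as `v`. -/
theorem IsGeodesic.exists_potential (hK : IsL2Hessian Ω H K) (h : IsGeodesic K ρ v)
    (hgs : SmoothFamily Ω (Icc 0 1) g)
    (hg : ∀ t ∈ Icc (0 : ℝ) 1, HasFirstVariation Ω (dualEnergy K (v t)) (ρ t) (g t)) :
    ∃ Φ : ℝ → SmoothFn Ω, SmoothFamily Ω (Icc 0 1) Φ ∧
      (∀ t ∈ Icc (0 : ℝ) 1, v t = grad (Φ t)) ∧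
      ∀ t ∈ Icc (0 : ℝ) 1, dt Φ t = -(1 / 2 : ℝ) • g t := by
  obtain ⟨Φ₀, hΦ₀⟩ := h.exists_grad_eq_zero_time hK hg
  obtain ⟨G, hG, hG0, hGt⟩ := exists_primitive hgs
  have hΦ : SmoothFamily Ω (Icc 0 1) fun t => Φ₀ + (-(1 / 2 : ℝ)) • G t :=
    (smoothFamily_const Φ₀).add (SmoothFamily.smul contDiffOn_const hG)
  have hdt : ∀ t ∈ Icc (0 : ℝ) 1, dt (fun t => Φ₀ + (-(1 / 2 : ℝ)) • G t) t =
      -(1 / 2 : ℝ) • g t := fun t ht => hΦ.dt_eq ht fun x hx => by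
    rw [← hGt t ht, ev_smul]
    exact ((hG.hasDerivWithinAt_ev ht hx).const_mul (-(1 / 2 : ℝ))).const_add (ev Φ₀ x)
  refine ⟨_, hΦ, fun t ht => funext fun i => ?_, hdt⟩
  refine eq_of_dt_eq (h.1.smooth_field i) (hΦ.dx uniqueDiffOn_unitInterval i) ?_ (fun s hs => ?_) ht
  · rw [hG0, smul_zero, add_zero, dx_apply, hΦ₀]
  · rw [dt_dx hΦ i hs, hdt s hs, map_smul]
    have := eq_neg_of_add_eq_zero_left (h.dt_field hK hgs hg i hs)
    rw [neg_smul, ← smul_neg, ← this, smul_smul]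
    norm_num

/-- Integration by parts gives `∫ w·∇Φ = ∫ Φ ∂ₜη`, and `g = -2 ∂ₜΦ`; so the integrand of the first
variation is `2 d/dt ∫ Φ η`, and `η` vanishes at both ends. -/
theorem isGeodesic_of_potential (hK : IsL2Hessian Ω H K) (h : IsFlow K ρ v)
    (hg : ∀ t ∈ Icc (0 : ℝ) 1, HasFirstVariation Ω (dualEnergy K (v t)) (ρ t) (g t))
    {Φ : ℝ → SmoothFn Ω} (hΦ : SmoothFamily Ω (Icc 0 1) Φ)
    (hv : ∀ t ∈ Icc (0 : ℝ) 1, v t = grad (Φ t))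
    (hdt : ∀ t ∈ Icc (0 : ℝ) 1, dt Φ t = -(1 / 2 : ℝ) • g t) : IsGeodesic K ρ v := by
  refine ⟨h, fun η w hη hw hcont h0 h1 => ?_⟩
  have hc := (continuityEquation_iff hη w).1 hcont
  have hη0 : ∀ t ∈ Icc (0 : ℝ) 1, IsTangent Ω (η t) := fun t ht => by
    rw [isTangent_iff, intS_eq_of_dt_eq hη hc ht, h0, map_zero]
  refine (hK.hasDerivAt_action h.smooth_density h.density h.smooth_field hη hη0 hw
    hg).congr_deriv ?_
  have e : ∀ t ∈ uIcc (0 : ℝ) 1, 2 * intS (∑ i, w t i * v t i) - intS (g t * η t) =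
      2 * intS (dt (fun t => Φ t * η t) t) := fun t ht => by
    rw [uIcc_of_le zero_le_one] at ht
    have e1 : intS (∑ i, w t i * v t i) = intS (Φ t * dt η t) := by
      rw [(hc t ht).1, mul_neg, map_neg, intS_mul_divS _ _ (hc t ht).2, neg_neg, hv t ht]
      rfl
    have e2 : g t = (-2 : ℝ) • dt Φ t := by
      rw [hdt t ht, smul_smul]
      norm_num
    rw [dt_mul hΦ hη ht, e1, e2, map_add, smul_mul_assoc, map_smul, smul_eq_mul]
    ring
  rw [intervalIntegral.integral_congr e, intervalIntegral.integral_const_mul,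
    intervalIntegral_intS_dt (hΦ.mul hη), h0, h1]
  simp

end Geodesic

/-! ### Minimizers, finiteness of the distance, and the geodesic system. -/

section Minimizer

open Filter Topology

variable {d : ℕ} {Ω : SampleSpace d} {H : SmoothFn Ω → ℝ} {K : OperatorField Ω}
  {ρ : ℝ → SmoothFn Ω} {v : ℝ → SmoothVec Ω}

theorem dualEnergy_eq_fluxEnergy (K : OperatorField Ω) (v : SmoothVec Ω) (ρ : SmoothFn Ω) :
    dualEnergy K v ρ = fluxEnergy K (flux K ρ v) ρ := by
  rw [dualEnergy_eq, fluxEnergy_eq]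
  simp only [flux, LinearEquiv.apply_symm_apply, mul_comm]

theorem IsL2Hessian.fluxEnergy_nonneg (hK : IsL2Hessian Ω H K) {ρ : SmoothFn Ω}
    (hρ : IsDensity Ω ρ) (m : SmoothVec Ω) : 0 ≤ fluxEnergy K m ρ := by
  rw [fluxEnergy_eq, map_sum]
  refine Finset.sum_nonneg fun i _ => ?_
  by_cases h : m i = 0
  · rw [h, zero_mul, map_zero]
  · exact (hK.positive ρ hρ (m i) h).le

theorem IsL2Hessian.action_eq (hK : IsL2Hessian Ω H K) (h : IsFlow K ρ v) :
    action K ρ v = ENNReal.ofReal (∫ t in (0 : ℝ)..1, dualEnergy K (v t) (ρ t)) := by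
  have hc : ContinuousOn (fun t => dualEnergy K (v t) (ρ t)) (Icc 0 1) := by
    simp only [dualEnergy_eq]
    exact SmoothFamily.continuousOn_intS (SmoothFamily.sum fun i _ => (h.smooth_field i).mul
      (hK.smooth_curve one_pos h.smooth_density h.density (h.smooth_field i)).2)
  rw [action, ← ofReal_integral_eq_lintegral_ofReal, integral_Icc_eq_integral_Ioc,
    intervalIntegral.integral_of_le zero_le_one]
  · exact hc.integrableOn_compact isCompact_Icc
  · filter_upwards [ae_restrict_mem measurableSet_Icc] with t ht
    rw [dualEnergy_eq_fluxEnergy]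
    exact hK.fluxEnergy_nonneg (h.density t ht) _

theorem flux_apply_self (K : OperatorField Ω) (ρ : SmoothFn Ω) (m : SmoothVec Ω) :
    (flux K ρ fun i => K ρ (m i)) = m := funext fun i => (K ρ).symm_apply_apply (m i)

/-- A smooth curve of densities with a smooth flux is a flow. -/
theorem IsL2Hessian.isFlow_of_flux (hK : IsL2Hessian Ω H K) {m : ℝ → SmoothVec Ω}
    (hρ : SmoothFamily Ω (Icc 0 1) ρ) (hd : ∀ t ∈ Icc (0 : ℝ) 1, IsDensity Ω (ρ t))
    (hm : ∀ i, SmoothFamily Ω (Icc 0 1) fun t => m t i)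
    (hc : ∀ t ∈ Icc (0 : ℝ) 1, dt ρ t = -divS (m t) ∧ Ω.NoFlux fun i => ev (m t i)) :
    IsFlow K ρ fun t i => K (ρ t) (m t i) where
  smooth_density := hρ
  smooth_field i := (hK.smooth_curve one_pos hρ hd (hm i)).1
  density := hd
  continuity := by
    simp only [flux_apply_self]
    exact (continuityEquation_iff hρ m).2 hc

theorem IsFlow.dt_eq (h : IsFlow K ρ v) {t : ℝ} (ht : t ∈ Icc (0 : ℝ) 1) :
    dt ρ t = -divS (flux K (ρ t) (v t)) ∧ Ω.NoFlux fun i => ev (flux K (ρ t) (v t) i) :=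
  (continuityEquation_iff h.smooth_density fun t => flux K (ρ t) (v t)).1 h.continuity t ht

/-- For small `ε` the varied density stays positive and the linear constraint is preserved, so the
varied pair is a competing flow. Its action has a local minimum at `ε = 0`, and the derivative there
exists. -/
theorem IsMinimizer.isGeodesic (hK : IsL2Hessian Ω H K) (h : IsMinimizer K ρ v) :
    IsGeodesic K ρ v := by
  refine ⟨h.1, fun η w hη hw hcont h0 h1 => ?_⟩
  have hf := h.1
  have hc := (continuityEquation_iff hη w).1 hcont
  have hη0 : ∀ t ∈ Icc (0 : ℝ) 1, IsTangent Ω (η t) := fun t ht => by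
    rw [isTangent_iff, intS_eq_of_dt_eq hη hc ht, h0, map_zero]
  obtain ⟨g, -, hg⟩ := hK.exists_firstVariation hf.smooth_density hf.density hf.smooth_field
  have hder := hK.hasDerivAt_action hf.smooth_density hf.density hf.smooth_field hη hη0 hw hg
  refine hder.congr_deriv (IsLocalMin.hasDerivAt_eq_zero ?_ hder)
  obtain ⟨δ, hδ, hdens⟩ := exists_isDensity_add_smul isCompact_Icc hf.smooth_density hη hf.density
    hη0
  have hm : ∀ i, SmoothFamily Ω (Icc 0 1) fun t => flux K (ρ t) (v t) i := fun i =>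
    (hK.smooth_curve one_pos hf.smooth_density hf.density (hf.smooth_field i)).2
  filter_upwards [Icc_mem_nhds (neg_lt_zero.2 hδ) hδ] with ε hε
  have hρ' : SmoothFamily Ω (Icc 0 1) fun t => ρ t + ε • η t :=
    hf.smooth_density.add (SmoothFamily.smul contDiffOn_const hη)
  have hm' : ∀ i, SmoothFamily Ω (Icc 0 1) fun t => (flux K (ρ t) (v t) + ε • w t) i := fun i =>
    (hm i).add (SmoothFamily.smul contDiffOn_const (hw i))
  have hflow := hK.isFlow_of_flux (m := fun t => flux K (ρ t) (v t) + ε • w t) hρ' (hdens ε hε) hm'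
    fun t ht => by
      constructor
      · rw [map_add, map_smul, neg_add, ← (hf.dt_eq ht).1, ← smul_neg, ← (hc t ht).1]
        exact hρ'.dt_eq ht fun x hx => (hf.smooth_density.hasDerivWithinAt_ev ht hx).add
          ((hη.hasDerivWithinAt_ev ht hx).const_mul ε)
      · exact (hf.dt_eq ht).2.add ((hc t ht).2.smul ε)
  have hle := h.2 _ _ hflow (by rw [h0, smul_zero, add_zero]) (by rw [h1, smul_zero, add_zero])
  rw [hK.action_eq hf, hK.action_eq hflow] at hle
  simp only [dualEnergy_eq_fluxEnergy, flux_apply_self] at hle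
  rw [ENNReal.ofReal_le_ofReal_iff] at hle
  · simpa using hle
  · exact intervalIntegral.integral_nonneg zero_le_one fun t ht =>
      hK.fluxEnergy_nonneg (hdens ε hε t ht) _

/-- The segment between the densities is a smooth curve in `P(Ω)`; it flows with a flux, constant in
time, of divergence `ρ₀ - ρ₁`. -/
theorem IsL2Hessian.distance_lt_top (hK : IsL2Hessian Ω H K) {ρ₀ ρ₁ : SmoothFn Ω}
    (h₀ : IsDensity Ω ρ₀) (h₁ : IsDensity Ω ρ₁) : distance K ρ₀ ρ₁ < ⊤ := by
  have hσ : intS (ρ₀ - ρ₁) = 0 := by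
    have e0 : intS ρ₀ = 1 := h₀.mass
    have e1 : intS ρ₁ = 1 := h₁.mass
    rw [map_sub, e0, e1, sub_self]
  obtain ⟨m, hm, hdiv⟩ := exists_divS_eq _ hσ
  have hρ : SmoothFamily Ω (Icc 0 1) fun t : ℝ => ρ₀ + t • (ρ₁ - ρ₀) :=
    (smoothFamily_const ρ₀).add (SmoothFamily.smul contDiffOn_id (smoothFamily_const _))
  have hd : ∀ t ∈ Icc (0 : ℝ) 1, IsDensity Ω (ρ₀ + t • (ρ₁ - ρ₀)) := fun t ht => by
    constructor
    · intro x hx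
      simp only [ev_add, ev_smul, ev_sub]
      have a := h₀.pos x hx
      have b := h₁.pos x hx
      rcases ht.2.lt_or_eq with h | h
      · nlinarith [mul_nonneg ht.1 b.le, mul_pos (sub_pos.2 h) a]
      · rw [h]
        linarith
    · change intS (ρ₀ + t • (ρ₁ - ρ₀)) = 1
      rw [map_add, map_smul, ← neg_sub, map_neg, hσ, neg_zero, smul_zero, add_zero]
      exact h₀.mass
  have hflow := hK.isFlow_of_flux (m := fun _ => m) hρ hd (fun i => smoothFamily_const (m i))
    fun t ht => by
      refine ⟨hρ.dt_eq ht fun x hx => ?_, hm⟩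
      rw [hdiv, neg_sub]
      have := ((hasDerivAt_id t).mul_const (ev (ρ₁ - ρ₀) x)).const_add (ev ρ₀ x)
      rw [one_mul] at this
      exact this.hasDerivWithinAt
  refine ENNReal.rpow_lt_top_of_nonneg (by norm_num) (ne_top_of_le_ne_top ?_
    (iInf₂_le_of_le _ _ (iInf_le_of_le hflow (iInf₂_le_of_le (by simp) (by simp) le_rfl))))
  rw [hK.action_eq hflow]
  exact ENNReal.ofReal_ne_top

theorem ContinuityEquation.congr {r : ℝ → E d → ℝ} {m m' : ℝ → Fin d → E d → ℝ}
    (h : ContinuityEquation Ω r m) (hm : ∀ t ∈ Icc (0 : ℝ) 1, ∀ i, ∀ x ∈ Ω.carrier,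
      m' t i x = m t i x) : ContinuityEquation Ω r m' where
  equation t ht x hx := by
    have e : divergence Ω (m' t) x = divergence Ω (m t) x := Finset.sum_congr rfl fun i _ => by
      simp only [partialD]
      rw [fderivWithin_congr (hm t ht i) (hm t ht i x hx)]
    rw [e]
    exact h.equation t ht x hx
  boundary t ht := by
    have := h.boundary t ht
    cases Ω with
    | periodic => trivial
    | neumann r hr hreg hc hconn =>
      intro x hx
      rw [← this x hx]
      exact Finset.sum_congr rfl fun i _ => by rw [hm t ht i x (show r x ≤ 0 from hx.le)]

theorem IsL2Hessian.isGeodesic_iff (hK : IsL2Hessian Ω H K) :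
    IsGeodesic K ρ v ↔ ∃ Φ, GeodesicSystem K ρ Φ ∧ ∀ t ∈ Icc (0 : ℝ) 1, v t = grad (Φ t) := by
  constructor
  · intro h
    have hf := h.1
    obtain ⟨g, hgs, hg⟩ := hK.exists_firstVariation hf.smooth_density hf.density hf.smooth_field
    obtain ⟨Φ, hΦ, hv, hdt⟩ := h.exists_potential hK hgs hg
    refine ⟨Φ, ⟨hf.smooth_density, hΦ, hf.density, hf.continuity.congr fun t ht i x _ => ?_,
      fun t ht => ⟨g t, hv t ht ▸ hg t ht, fun x hx => ?_⟩⟩, hv⟩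
    · rw [hv t ht]
    · rw [← hΦ.ev_dt ht hx, hdt t ht, ev_smul]
      ring
  · rintro ⟨Φ, h, hv⟩
    have hdt : ∀ t ∈ Icc (0 : ℝ) 1, dt Φ t = -(1 / 2 : ℝ) • ((-2 : ℝ) • dt Φ t) := fun t _ => by
      rw [smul_smul]
      norm_num
    -- The Hamilton-Jacobi equation identifies the chosen first variation at each time with `-2
    -- ∂ₜΦ`, which removes the freedom of the constant.
    refine isGeodesic_of_potential hK ⟨h.smooth_density, fun i => ?_, h.density,
      h.continuity.congr fun t ht i x _ => by rw [hv t ht]⟩ (g := fun t => (-2 : ℝ) • dt Φ t)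
      (fun t ht => ?_) h.smooth_potential hv hdt
    · exact (h.smooth_potential.dx uniqueDiffOn_unitInterval i).congr fun t ht => by rw [hv t ht]; rfl
    · obtain ⟨g, hg, he⟩ := h.hamiltonJacobi t ht
      have : (-2 : ℝ) • dt Φ t = g := SmoothFn.ext_carrier fun x hx => by
        have := he x hx
        rw [← h.smooth_potential.ev_dt ht hx] at this
        rw [ev_smul]
        linarith
      rw [this, hv t ht]
      exact hg

end Minimizer

/-! ### Compositions of scalar functions with densities. -/

section Composition

open Filter Topology

variable {d : ℕ} {Ω : SampleSpace d}

open Classical in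
/-- The composition `φ ∘ ρ` of a smooth function on `(0, ∞)` with a density. -/
def compFn (φ : ℝ → ℝ) (ρ : SmoothFn Ω) : SmoothFn Ω :=
  -- The factor `1 ∈ C^∞(Ω)` is zero outside of the domain, as required there. Membership holds for
  -- densities and smooth `φ` by `mul_mem`, so the default `0` is not met.
  if h : (fun x => φ (ev ρ x) * ev (1 : SmoothFn Ω) x) ∈ SmoothFn Ω then ⟨_, h⟩ else 0

variable {φ ψ : ℝ → ℝ} {ρ σ : SmoothFn Ω}

theorem ev_compFn (hφ : ContDiffOn ℝ ∞ φ (Ioi 0)) (hρ : IsDensity Ω ρ) {x : E d}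
    (hx : x ∈ Ω.carrier) : ev (compFn φ ρ) x = φ (ev ρ x) := by
  rw [compFn, dif_pos (mul_mem hφ hρ 1)]
  change φ (ev ρ x) * ev (1 : SmoothFn Ω) x = _
  rw [ev_one hx, mul_one]

theorem SmoothFamily.compFn {V : Type} [NormedAddCommGroup V] [NormedSpace ℝ V] {S : Set V}
    {ρ : V → SmoothFn Ω} (hφ : ContDiffOn ℝ ∞ φ (Ioi 0)) (hρ : SmoothFamily Ω S ρ)
    (hd : ∀ s ∈ S, IsDensity Ω (ρ s)) :
    SmoothFamily Ω S fun s => HessianTransport.compFn φ (ρ s) :=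
  (ContDiffOn.comp hφ hρ fun p hp => (hd p.1 hp.1).pos p.2 hp.2).congr fun p hp =>
    ev_compFn hφ (hd p.1 hp.1) hp.2

theorem exists_forall_isDensity_add_smul (hρ : IsDensity Ω ρ) (hσ : IsTangent Ω σ) :
    ∃ δ > (0 : ℝ), ∀ a ∈ Icc (-δ) δ, IsDensity Ω (ρ + a • σ) := by
  obtain ⟨δ, hδ, h⟩ := exists_isDensity_add_smul (isCompact_singleton (x := (0 : ℝ)))
    (ρ := fun _ => ρ) (η := fun _ => σ) (smoothFamily_const ρ) (smoothFamily_const σ)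
    (fun _ _ => hρ) (fun _ _ => hσ)
  exact ⟨δ, hδ, fun a ha => h a ha 0 rfl⟩

theorem hasDerivAt_intS_compFn_mul (hφ : ContDiffOn ℝ ∞ φ (Ioi 0))
    (hψ : ContDiffOn ℝ ∞ ψ (Ioi 0)) (hd : ∀ s, 0 < s → HasDerivAt φ (ψ s) s) {δ : ℝ}
    (hδ : ∀ a ∈ Icc (-δ) δ, IsDensity Ω (ρ + a • σ)) (h : SmoothFn Ω) {a : ℝ}
    (ha : a ∈ Ioo (-δ) δ) : HasDerivAt (fun a : ℝ => intS (compFn φ (ρ + a • σ) * h))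
      (intS (compFn ψ (ρ + a • σ) * σ * h)) a := by
  have ha' := Ioo_subset_Icc_self ha
  have hu : UniqueDiffOn ℝ (Icc (-δ) δ) := uniqueDiffOn_Icc (ha.1.trans ha.2)
  have hfam : SmoothFamily Ω (Icc (-δ) δ) fun a : ℝ => ρ + a • σ :=
    (smoothFamily_const ρ).add (SmoothFamily.smul contDiffOn_id (smoothFamily_const σ))
  have key := ((hfam.compFn hφ hδ).mul (smoothFamily_const h)).hasDerivWithinAt_intS hu
    (convex_Icc _ _) ha'
  refine (key.hasDerivAt (Icc_mem_nhds ha.1 ha.2)).congr_deriv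
    (integral_congr_carrier Ω fun x hx => HasDerivWithinAt.derivWithin ?_ (hu a ha'))
  have h1 : HasDerivAt (fun a : ℝ => ev ρ x + a * ev σ x) (ev σ x) a := by
    simpa using ((hasDerivAt_id a).mul_const (ev σ x)).const_add (ev ρ x)
  have h2 := ((hd _ ((hδ a ha').pos x hx)).comp a h1).mul_const (ev h x)
  rw [ev_mul, ev_mul, ev_compFn hψ (hδ a ha') hx]
  refine h2.hasDerivWithinAt.congr (fun s hs => ?_) ?_ <;>
  rw [ev_mul, ev_compFn hφ (hδ _ (by assumption)) hx] <;> rfl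

end Composition

/-! ### The entropies `H_f`. -/

section Convex

open Filter Topology

variable {d : ℕ} {Ω : SampleSpace d} {f : ℝ → ℝ}

theorem IsConvexIntegrand.smooth_inv (hf : IsConvexIntegrand f) :
    ContDiffOn ℝ ∞ (fun s => (deriv (deriv f) s)⁻¹) (Ioi 0) :=
  hf.smooth_deriv2.inv fun s hs => (hf.pos s hs).ne'

/-- The derivative of `1 / f''`. -/
def derivInv (f : ℝ → ℝ) (s : ℝ) : ℝ :=
  -(deriv (deriv (deriv f)) s / deriv (deriv f) s ^ 2)

theorem IsConvexIntegrand.smooth_derivInv (hf : IsConvexIntegrand f) :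
    ContDiffOn ℝ ∞ (derivInv f) (Ioi 0) :=
  ((hf.smooth_deriv2.deriv_of_isOpen (m := ∞) isOpen_Ioi (by simp)).div
    (hf.smooth_deriv2.pow 2) fun s hs => pow_ne_zero 2 (hf.pos s hs).ne').neg

theorem hasDerivAt_of_contDiffOn_Ioi {φ : ℝ → ℝ} (hφ : ContDiffOn ℝ ∞ φ (Ioi 0)) {s : ℝ}
    (hs : 0 < s) : HasDerivAt φ (deriv φ s) s :=
  ((hφ.contDiffAt (Ioi_mem_nhds hs)).differentiableAt (by simp)).hasDerivAt

theorem IsConvexIntegrand.hasDerivAt_inv (hf : IsConvexIntegrand f) {s : ℝ} (hs : 0 < s) :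
    HasDerivAt (fun s => (deriv (deriv f) s)⁻¹) (derivInv f s) s := by
  refine ((hasDerivAt_of_contDiffOn_Ioi hf.smooth_deriv2 hs).fun_inv (hf.pos s hs).ne').congr_deriv
    (neg_div _ _)

theorem fHessian_apply (hf : IsConvexIntegrand f) {ρ : SmoothFn Ω} (hρ : IsDensity Ω ρ)
    (g : SmoothFn Ω) : fHessian Ω hf ρ g = compFn (deriv (deriv f)) ρ * g := by
  refine SmoothFn.ext_carrier fun x hx => ?_
  rw [fHessian, dif_pos hρ, ev_mul, ev_compFn hf.smooth_deriv2 hρ hx]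
  rfl

theorem fHessian_symm_apply (hf : IsConvexIntegrand f) {ρ : SmoothFn Ω} (hρ : IsDensity Ω ρ)
    (g : SmoothFn Ω) :
    (fHessian Ω hf ρ).symm g = compFn (fun s => (deriv (deriv f) s)⁻¹) ρ * g := by
  refine SmoothFn.ext_carrier fun x hx => ?_
  rw [fHessian, dif_pos hρ, ev_mul, ev_compFn hf.smooth_inv hρ hx]
  rfl

theorem fEntropy_eq (hf : IsConvexIntegrand f) {ρ : SmoothFn Ω} (hρ : IsDensity Ω ρ) :
    fEntropy Ω f ρ = intS (compFn f ρ * 1) :=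
  integral_congr_carrier Ω fun x hx => by
    rw [mul_one]
    exact (ev_compFn hf.smooth hρ hx).symm

theorem IsConvexIntegrand.second_variation (hf : IsConvexIntegrand f) {ρ σ : SmoothFn Ω}
    (hρ : IsDensity Ω ρ) (hσ : IsTangent Ω σ) :
    ContDiffAt ℝ 2 (fun a : ℝ => fEntropy Ω f (ρ + a • σ)) 0 ∧
    iteratedDeriv 2 (fun a : ℝ => fEntropy Ω f (ρ + a • σ)) 0 =
      integral Ω fun x => ev σ x * ev (fHessian Ω hf ρ σ) x := by
  obtain ⟨δ, hδ, hdens⟩ := exists_forall_isDensity_add_smul hρ hσ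
  have hu : UniqueDiffOn ℝ (Icc (-δ) δ) := uniqueDiffOn_Icc (by linarith)
  have hnhds : Ioo (-δ) δ ∈ 𝓝 (0 : ℝ) := Ioo_mem_nhds (by linarith) hδ
  have hfam : SmoothFamily Ω (Icc (-δ) δ) fun a : ℝ => ρ + a • σ :=
    (smoothFamily_const ρ).add (SmoothFamily.smul contDiffOn_id (smoothFamily_const σ))
  have hf1 : ContDiffOn ℝ ∞ (deriv f) (Ioi 0) := hf.smooth.deriv_of_isOpen isOpen_Ioi (by simp)
  constructor
  · have h := ((hfam.compFn hf.smooth hdens).mul (smoothFamily_const 1)).contDiffOn_intS hu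
      (convex_Icc _ _).locallyQuasiconvex
    exact ((h.congr fun a ha => fEntropy_eq hf (hdens a ha)).contDiffAt
      (mem_of_superset hnhds Ioo_subset_Icc_self)).of_le (WithTop.coe_le_coe.2 le_top)
  · have h1 : ∀ a ∈ Ioo (-δ) δ, HasDerivAt (fun a : ℝ => fEntropy Ω f (ρ + a • σ))
        (intS (compFn (deriv f) (ρ + a • σ) * σ)) a := fun a ha => by
      have := hasDerivAt_intS_compFn_mul hf.smooth hf1
        (fun s hs => hasDerivAt_of_contDiffOn_Ioi hf.smooth hs) hdens 1 ha
      rw [mul_one] at this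
      refine this.congr_of_eventuallyEq ?_
      filter_upwards [Ioo_mem_nhds ha.1 ha.2] with b hb
      exact fEntropy_eq hf (hdens b (Ioo_subset_Icc_self hb))
    have h2 := hasDerivAt_intS_compFn_mul hf1 hf.smooth_deriv2
      (fun s hs => hasDerivAt_of_contDiffOn_Ioi hf1 hs) hdens σ (a := 0) ⟨by linarith, hδ⟩
    rw [iteratedDeriv_succ, iteratedDeriv_one]
    have h3 : deriv (fun a : ℝ => fEntropy Ω f (ρ + a • σ)) =ᶠ[𝓝 0]
        fun a => intS (compFn (deriv f) (ρ + a • σ) * σ) := by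
      filter_upwards [hnhds] with a ha
      exact (h1 a ha).deriv
    rw [h3.deriv_eq, h2.deriv, integral_mul_eq, fHessian_apply hf hρ, zero_smul, add_zero]
    congr 1
    ring

/-- The functional is `∫ h² / f''(ρ)`, so its first variation is `h²` times the derivative of `1 /
f''`, which is the source of `f''' / f''²`. -/
theorem IsConvexIntegrand.hasFirstVariation (hf : IsConvexIntegrand f) {ρ : SmoothFn Ω}
    (hρ : IsDensity Ω ρ) (h : SmoothFn Ω) :
    HasFirstVariation Ω (fun ρ' => integral Ω fun x => ev h x * ev ((fHessian Ω hf ρ').symm h) x) ρ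
      (compFn (derivInv f) ρ * (h * h)) := by
  intro σ hσ
  obtain ⟨δ, hδ, hdens⟩ := exists_forall_isDensity_add_smul hρ hσ
  have key := hasDerivAt_intS_compFn_mul hf.smooth_inv hf.smooth_derivInv
    (fun s hs => hf.hasDerivAt_inv hs) hdens (h * h) (a := 0) ⟨by linarith, hδ⟩
  rw [zero_smul, add_zero] at key
  refine (key.congr_of_eventuallyEq ?_).congr_deriv ?_
  · filter_upwards [Icc_mem_nhds (neg_lt_zero.2 hδ) hδ] with a ha
    rw [integral_mul_eq, fHessian_symm_apply hf (hdens a ha)]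
    congr 1
    ring
  · rw [integral_mul_eq]
    congr 1
    ring

theorem IsConvexIntegrand.isL2Hessian (hf : IsConvexIntegrand f) :
    IsL2Hessian Ω (fEntropy Ω f) (fHessian Ω hf) where
  second_variation ρ σ hρ hσ := hf.second_variation hρ hσ
  symmetric ρ hρ g h := by
    rw [integral_mul_eq, integral_mul_eq, fHessian_apply hf hρ, fHessian_apply hf hρ]
    congr 1
    ring
  positive ρ hρ g hg := by
    rw [integral_mul_eq, fHessian_apply hf hρ]
    have hev : ∀ x ∈ Ω.carrier, ev (g * (compFn (deriv (deriv f)) ρ * g)) x =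
        deriv (deriv f) (ev ρ x) * (ev g x * ev g x) := fun x hx => by
      rw [ev_mul, ev_mul, ev_compFn hf.smooth_deriv2 hρ hx]
      ring
    refine intS_pos (fun x hx => ?_) fun h0 => hg (SmoothFn.ext_carrier fun x hx => ?_)
    · rw [hev x hx]
      exact mul_nonneg (hf.pos _ (hρ.pos x hx)).le (mul_self_nonneg _)
    · have := hev x hx
      rw [h0, ev_zero, eq_comm, mul_eq_zero, or_iff_right (hf.pos _ (hρ.pos x hx)).ne',
        mul_self_eq_zero] at this
      rw [this, ev_zero]
  smooth a b a' b' _ _ ρ g hρ hd hg :=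
    ⟨((hρ.compFn hf.smooth_deriv2 hd).mul hg).congr fun s hs => fHessian_apply hf (hd s hs) _,
      ((hρ.compFn hf.smooth_inv hd).mul hg).congr fun s hs => fHessian_symm_apply hf (hd s hs) _⟩
  variation ρ g hρ hd hg := ⟨fun t => compFn (derivInv f) (ρ t) * (g t * g t),
    (hρ.compFn hf.smooth_derivInv hd).mul (hg.mul hg),
    fun t ht => hf.hasFirstVariation (hd t ht) (g t)⟩

theorem IsConvexIntegrand.hasFirstVariation_dualEnergy (hf : IsConvexIntegrand f)
    {ρ : SmoothFn Ω} (hρ : IsDensity Ω ρ) (v : SmoothVec Ω) :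
    HasFirstVariation Ω (dualEnergy (fHessian Ω hf) v) ρ
      (∑ i, compFn (derivInv f) ρ * (v i * v i)) := by
  convert HasFirstVariation.sum (s := Finset.univ) fun i _ => hf.hasFirstVariation hρ (v i) using 1
  ext ρ'
  rw [dualEnergy_eq, map_sum]
  rfl

theorem ev_sum_compFn_derivInv (hf : IsConvexIntegrand f) {ρ : SmoothFn Ω} (hρ : IsDensity Ω ρ)
    (v : SmoothVec Ω) {x : E d} (hx : x ∈ Ω.carrier) :
    ev (∑ i, compFn (derivInv f) ρ * (v i * v i)) x = -((∑ i, ev (v i) x ^ 2) *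
      (deriv (deriv (deriv f)) (ev ρ x) / deriv (deriv f) (ev ρ x) ^ 2)) := by
  rw [← Finset.mul_sum, ev_mul, ev_compFn hf.smooth_derivInv hρ hx, ev_sum, derivInv]
  simp only [ev_mul, pow_two]
  ring

theorem ev_flux_fHessian (hf : IsConvexIntegrand f) {ρ : SmoothFn Ω} (hρ : IsDensity Ω ρ)
    (v : SmoothVec Ω) (i : Fin d) {x : E d} (hx : x ∈ Ω.carrier) :
    ev (flux (fHessian Ω hf) ρ v i) x = (deriv (deriv f) (ev ρ x))⁻¹ * ev (v i) x := by
  rw [flux, fHessian_symm_apply hf hρ, ev_mul, ev_compFn hf.smooth_inv hρ hx]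

/-- The explicit first variation is supplied directly in both directions; the general system leaves
an additive constant free at each time, whereas here the equation for `Φ` has none. -/
theorem IsConvexIntegrand.isGeodesic_iff (hf : IsConvexIntegrand f) {ρ : ℝ → SmoothFn Ω}
    {v : ℝ → SmoothVec Ω} : IsGeodesic (fHessian Ω hf) ρ v ↔
      ∃ Φ, FGeodesicSystem f ρ Φ ∧ ∀ t ∈ Icc (0 : ℝ) 1, v t = grad (Φ t) := by
  have hK := hf.isL2Hessian (Ω := Ω)
  constructor
  · intro h
    have hfl := h.1
    obtain ⟨Φ, hΦ, hv, hdt⟩ := h.exists_potential hK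
      (SmoothFamily.sum fun i _ => (hfl.smooth_density.compFn hf.smooth_derivInv hfl.density).mul
        ((hfl.smooth_field i).mul (hfl.smooth_field i)))
      fun t ht => hf.hasFirstVariation_dualEnergy (hfl.density t ht) (v t)
    refine ⟨Φ, ⟨hfl.smooth_density, hΦ, hfl.density, hfl.continuity.congr fun t ht i x hx => ?_,
      fun t ht x hx => ?_⟩, hv⟩
    · rw [ev_flux_fHessian hf (hfl.density t ht) _ i hx, hv t ht]
    · rw [← hΦ.ev_dt ht hx, hdt t ht, ev_smul, ev_sum_compFn_derivInv hf (hfl.density t ht) _ hx,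
        hv t ht]
      ring
  · rintro ⟨Φ, h, hv⟩
    refine isGeodesic_of_potential hK ⟨h.smooth_density, fun i => ?_, h.density,
      h.continuity.congr fun t ht i x hx => ?_⟩
      (g := fun t => ∑ i, compFn (derivInv f) (ρ t) * (v t i * v t i))
      (fun t ht => hf.hasFirstVariation_dualEnergy (h.density t ht) (v t))
      h.smooth_potential hv fun t ht => SmoothFn.ext_carrier fun x hx => ?_
    · exact (h.smooth_potential.dx uniqueDiffOn_unitInterval i).congr fun t ht => by rw [hv t ht]; rfl
    · rw [ev_flux_fHessian hf (h.density t ht) _ i hx, hv t ht]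
    · have := h.hamiltonJacobi t ht x hx
      rw [← h.smooth_potential.ev_dt ht hx] at this
      rw [ev_smul, ev_sum_compFn_derivInv hf (h.density t ht) _ hx, hv t ht]
      linarith

end Convex

end HessianTransport

end

theorem mainTheorem3 {d : ℕ} (Ω : HessianTransport.SampleSpace d) :
    -- an arbitrary entropy `H` with `L²` Hessian `K = δ²H`
    (∀ (H : HessianTransport.SmoothFn Ω → ℝ) (K : HessianTransport.OperatorField Ω),
      HessianTransport.IsL2Hessian Ω H K →
      -- the distance is finite
      (∀ ρ₀ ρ₁ : HessianTransport.SmoothFn Ω, HessianTransport.IsDensity Ω ρ₀ →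
        HessianTransport.IsDensity Ω ρ₁ → HessianTransport.distance K ρ₀ ρ₁ < ⊤) ∧
      -- minimizers solve the geodesic system
      (∀ ρ v, HessianTransport.IsMinimizer K ρ v →
        ∃ Φ, HessianTransport.GeodesicSystem K ρ Φ ∧
          ∀ t ∈ Set.Icc (0 : ℝ) 1, v t = HessianTransport.grad (Φ t)) ∧
      -- the geodesic system characterizes the critical points of the action
      (∀ ρ v, HessianTransport.IsGeodesic K ρ v ↔
        ∃ Φ, HessianTransport.GeodesicSystem K ρ Φ ∧
          ∀ t ∈ Set.Icc (0 : ℝ) 1, v t = HessianTransport.grad (Φ t))) ∧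
    -- the entropy `H_f`, with `δ²H_f(ρ) = f''(ρ)`
    (∀ (f : ℝ → ℝ) (hf : HessianTransport.IsConvexIntegrand f),
      HessianTransport.IsL2Hessian Ω (HessianTransport.fEntropy Ω f)
        (HessianTransport.fHessian Ω hf) ∧
      (∀ ρ v, HessianTransport.IsMinimizer (HessianTransport.fHessian Ω hf) ρ v →
        ∃ Φ, HessianTransport.FGeodesicSystem f ρ Φ ∧
          ∀ t ∈ Set.Icc (0 : ℝ) 1, v t = HessianTransport.grad (Φ t)) ∧
      (∀ ρ v, HessianTransport.IsGeodesic (HessianTransport.fHessian Ω hf) ρ v ↔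
        ∃ Φ, HessianTransport.FGeodesicSystem f ρ Φ ∧
          ∀ t ∈ Set.Icc (0 : ℝ) 1, v t = HessianTransport.grad (Φ t))) :=
  ⟨fun _ _ hK => ⟨fun _ _ => hK.distance_lt_top,
    fun _ _ h => hK.isGeodesic_iff.1 (h.isGeodesic hK), fun _ _ => hK.isGeodesic_iff⟩,
    fun _ hf => ⟨hf.isL2Hessian,
      fun _ _ h => hf.isGeodesic_iff.1 (h.isGeodesic hf.isL2Hessian), fun _ _ => hf.isGeodesic_iff⟩⟩
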